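/- Let $n\ge 1$ and let $a_0,\dots,a_n\ge 1$ be integers. Put $f(z)=z_0^{a_0}+\dots+z_n^{a_n}$, $V_f=f^{-1}(0)\subset\mathbb C^{n+1}$, and $$\Sigma(a_0,\dots,a_n)=V_f\cap S^{2n+1},\qquad \widetilde\Sigma(a_0,\dots,a_n)=V_f\cap(\mathbb C\times S^{2n-1}),$$ with the $1$-forms $$\alpha_1=\tfrac i2\sum_{j=0}^n a_j(z_j\,d\bar z_j-\bar z_j\,dz_j),\quad \beta=\tfrac i2\sum_{j=1}^n a_j(z_j\,d\bar z_j-\bar z_j\,dz_j),\quad \alpha_{\mathrm{std}}=\tfrac i2\sum_{j=1}^n (z_j\,d\bar z_j-\bar z_j\,dz_j)$$ on $\Sigma(a_0,\dots,a_n)$ and (the last two) on $S^{2n-1}$; let $\Sigma(a_1,\dots,a_n)\subset S^{2n-1}$ be defined in the same way by $z_1^{a_1}+\dots+z_n^{a_n}=0$. A $k$-fold cyclic covering $p\colon M\to N$ branched along a codimension-two submanifold $B\subset N$ is a smooth surjection that is a smooth covering over $N\setminus B$, has the local form $(\zeta,y)\mapsto(\zeta^k,y)$ with $B=\{\zeta=0\}$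 near the points over $B$, and whose fibres are the orbits of a cyclic group of deck transformations of order $k$ that acts freely over $N\setminus B$ and trivially over $B$. If $\alpha$ is a contact form on $N$ that restricts to a contact form on $B$, then $\ker dp$ (along $p^{-1}(B)$) is oriented by the orientations of $M$ and $p^{-1}(B)$ pulled back from the contact manifolds $N$ and $B$. We say that $p\colon(M,\ker\eta)\to(N,\ker\alpha)$ is a contact branched covering along $(B,\alpha|_{TB})$ if $\eta$ is a contact form on $M$, there are $1$-forms $\gamma$ on $M$ with $d\gamma|_{\ker dp}>0$ along $p^{-1}(B)$, and for every such $\gamma$ the form $p^*\alpha+\varepsilon\gamma$ is, for all sufficiently small $\varepsilon>0$, a contact form whose contact structure is isotopic to $\ker\eta$. Then: 1. The projection $\pi_0(z_0,\dots,z_n)=(z_1,\dots,z_n)$ restricts to an $a_0$-fold cyclic branched covering $\widetilde\Sigma(a_0,\dots,a_n)\to S^{2n-1}$ branched along $\Sigma(a_1,\dots,a_n)$, and for a suitable contact form $\eta$ on $\widetilde\Sigma(a_0,\dots,a_n)$ it is a contact branched covering of $(S^{2n-1},\ker\beta)$ along $(\Sigma(a_1,\dots,a_n),\beta|)$. 2.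 For every such $\eta$, the contact manifold $(\widetilde\Sigma(a_0,\dots,a_n),\ker\eta)$ is contactomorphic to the Brieskorn manifold $(\Sigma(a_0,\dots,a_n),\ker\alpha_1)$. 3. Hence $(\Sigma(a_0,\dots,a_n),\ker\alpha_1)$ is a contact branched cover of the standard sphere: there are a contactomorphism $g\colon(S^{2n-1},\ker\beta)\to(S^{2n-1},\ker\alpha_{\mathrm{std}})$ and an $a_0$-fold cyclic contact branched covering $F\colon(\Sigma(a_0,\dots,a_n),\ker\alpha_1)\to(S^{2n-1},\ker\alpha_{\mathrm{std}})$ with branching locus $g(\Sigma(a_1,\dots,a_n))$. (Contactomorphisms are taken to preserve the coorientations given by the forms. For $a_0=1$ the covering is a diffeomorphism; for $n=1$ the branching locus is empty.) -/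

import Mathlib

open Set Filter Topology
open scoped ContDiff

noncomputable section

namespace ContactBranched

variable {E F : Type*} [NormedAddCommGroup E] [NormedSpace ℝ E]
  [NormedAddCommGroup F] [NormedSpace ℝ F]

/-! ### Submanifolds of a normed space, smooth maps and differential one-forms on them

A smooth map, or a smooth one-form, on a submanifold `M` of `E` is represented by one that is
defined on `E` and smooth on some open set containing `M`; only its values on `M`, respectively
its restriction to the tangent spaces of `M`, matter. -/

/-- `f` is smooth on an open neighbourhood of `M`. -/
def SmoothNear (M : Set E) (f : E → F) : Prop :=
  ∃ U : Set E, IsOpen U ∧ M ⊆ U ∧ ContDiffOn ℝ ∞ f U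

/-- `M` is an embedded smooth submanifold of codimension `c`: locally the zero set of `c` real
functions with linearly independent differentials. (In a space of dimension less than `c`, only
the empty set has this property.) -/
def IsSubmanifold (c : ℕ) (M : Set E) : Prop :=
  ∀ p ∈ M, ∃ U : Set E, IsOpen U ∧ p ∈ U ∧ ∃ g : E → (Fin c → ℝ),
    ContDiffOn ℝ ∞ g U ∧ Function.Surjective (fderiv ℝ g p) ∧ M ∩ U = {x ∈ U | g x = 0}

/-- The tangent space of `M` at `p`: velocities at time `0` of smooth curves in `M` through `p`. -/
def tangentAt (M : Set E) (p : E) : Set E :=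
  {v | ∃ c : ℝ → E, ContDiffAt ℝ ∞ c 0 ∧ c 0 = p ∧ (∀ᶠ t in 𝓝 (0 : ℝ), c t ∈ M) ∧
    HasDerivAt c v 0}

/-- A one-form on (an open subset of) `E`. -/
abbrev OneForm (E : Type*) [NormedAddCommGroup E] [NormedSpace ℝ E] := E → (E →L[ℝ] ℝ)

/-- The exterior derivative of a one-form, evaluated on two vectors. -/
def dForm (α : OneForm E) (p v w : E) : ℝ :=
  fderiv ℝ α p v w - fderiv ℝ α p w v

lemma dForm_eq_extDeriv (α : OneForm E) (p v w : E) :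
    dForm α p v w =
      extDeriv (fun x => ContinuousAlternatingMap.ofSubsingletonLIE (0 : Fin 1) (α x)) p
        ![v, w] := by
  let L := (ContinuousAlternatingMap.ofSubsingletonLIE (𝕜 := ℝ) (E := E) (F := ℝ)
    (0 : Fin 1)).toContinuousLinearEquiv
  have h : fderiv ℝ (fun x => ContinuousAlternatingMap.ofSubsingletonLIE (0 : Fin 1) (α x)) p
      = L.toContinuousLinearMap.comp (fderiv ℝ α p) := L.comp_fderiv
  rw [extDeriv, h, ContinuousAlternatingMap.alternatizeUncurryFin_apply]
  simp [L, dForm, Fin.sum_univ_two, ContinuousAlternatingMap.ofSubsingletonLIE, Fin.removeNth,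
    sub_eq_add_neg]

/-- The pull-back of a one-form. -/
def pullback (f : E → F) (α : OneForm F) : OneForm E :=
  fun x => (α (f x)).comp (fderiv ℝ f x)

/-- `φ` restricts to a diffeomorphism from `M` onto `N`. -/
def IsDiffeo (φ : E → F) (M : Set E) (N : Set F) : Prop :=
  SmoothNear M φ ∧ MapsTo φ M N ∧
    ∃ ψ : F → E, SmoothNear N ψ ∧ MapsTo ψ N M ∧ InvOn ψ φ M N

/-! ### Contact forms -/

/-- `α` restricts to a contact form on `M`: it vanishes nowhere on `M`, and `dα` is
nondegenerate on the hyperplanes `ker α ∩ TM`. -/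
def IsContactForm (M : Set E) (α : OneForm E) : Prop :=
  SmoothNear M α ∧ ∀ p ∈ M, (∃ v ∈ tangentAt M p, α p v ≠ 0) ∧
    ∀ v ∈ tangentAt M p, α p v = 0 →
      (∀ w ∈ tangentAt M p, α p w = 0 → dForm α p v w = 0) → v = 0

/-- `φ` restricts to a (coorientation preserving) contactomorphism from `(M, ker α)` to
`(N, ker β)`: a diffeomorphism with `φ^* β = h α` on `TM` for a function `h > 0`. -/
def IsContactomorphism (φ : E → F) (M : Set E) (α : OneForm E) (N : Set F) (β : OneForm F) :
    Prop :=
  IsDiffeo φ M N ∧ ∀ p ∈ M, ∃ h : ℝ, 0 < h ∧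
    ∀ v ∈ tangentAt M p, pullback φ β p v = h * α p v

/-- `(M, ker α)` and `(N, ker β)` are contactomorphic. -/
def AreContactomorphic (M : Set E) (α : OneForm E) (N : Set F) (β : OneForm F) : Prop :=
  ∃ φ : E → F, IsContactomorphism φ M α N β

/-- The cooriented contact structures `ker α` and `ker α'` on `M` are isotopic: a smooth isotopy
of `M`, starting at the identity, ends at a contactomorphism between them. -/
def AreIsotopic (M : Set E) (α α' : OneForm E) : Prop :=
  ∃ Φ : ℝ → E → E,
    SmoothNear (Icc (0 : ℝ) 1 ×ˢ M) (fun q : ℝ × E => Φ q.1 q.2) ∧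
    (∀ t ∈ Icc (0 : ℝ) 1, IsDiffeo (Φ t) M M) ∧ (∀ p ∈ M, Φ 0 p = p) ∧
    IsContactomorphism (Φ 1) M α M α'

/-! ### Branched coverings -/

/-- The local model of a `k`-fold branched covering `f : M → N` at a point `p` over the branching
locus `B`: `(w, y)` are local coordinates of `N` at `f p` with `B = {w = 0}`, `(ζ, y ∘ f)` are
local coordinates of `M` at `p`, and `f` reads `(ζ, y) ↦ (ζ ^ k, y)` in them. -/
structure IsBranchChart (k : ℕ) (M : Set E) (N B : Set F) (f : E → F) (p : E) {m : ℕ}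
    (ζ : E → ℂ) (w : F → ℂ) (y : F → (Fin m → ℝ)) : Prop where
  smooth_ζ : SmoothNear {p} ζ
  smooth_w : SmoothNear {f p} w
  smooth_y : SmoothNear {f p} y
  chart_total : BijOn (fun v => (fderiv ℝ ζ p v, fderiv ℝ y (f p) (fderiv ℝ f p v)))
    (tangentAt M p) univ
  chart_base : BijOn (fun v => (fderiv ℝ w (f p) v, fderiv ℝ y (f p) v))
    (tangentAt N (f p)) univ
  branch : ∀ᶠ x in 𝓝[N] (f p), x ∈ B ↔ w x = 0
  model : ∀ᶠ x in 𝓝[M] p, w (f x) = ζ x ^ k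

/-- `f` restricts to a `k`-fold cyclic covering from the manifold `M` onto the manifold `N`,
branched along the codimension two submanifold `B` of `N`. -/
structure IsCyclicBranchedCovering (k : ℕ) (M : Set E) (N B : Set F) (f : E → F) : Prop where
  total_submanifold : ∃ c, IsSubmanifold c M
  base_submanifold : ∃ c, IsSubmanifold c N ∧ IsSubmanifold (c + 2) B
  branch_subset : B ⊆ N
  smooth : SmoothNear M f
  mapsTo : MapsTo f M N
  surjOn : SurjOn f M N
  /-- Away from the branching locus, `f` is a smooth covering. -/
  covering : IsCoveringMapOn (mapsTo.restrict f M N) {x | (x : F) ∉ B}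
  local_diffeo : ∀ p ∈ M, f p ∉ B →
    BijOn (fun v => fderiv ℝ f p v) (tangentAt M p) (tangentAt N (f p))
  /-- The group of deck transformations is cyclic of order `k`; its orbits are the fibres, it acts
  freely away from the branching locus and fixes the points over it. -/
  deck : ∃ τ : E → E, IsDiffeo τ M M ∧ (∀ p ∈ M, f (τ p) = f p) ∧
    (∀ p ∈ M, ∀ q ∈ M, f p = f q → ∃ j : ℕ, τ^[j] p = q) ∧
    (∀ p ∈ M, f p ∉ B → Function.minimalPeriod τ p = k) ∧
    (∀ p ∈ M, f p ∈ B → τ p = p)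
  local_model : ∀ p ∈ M, f p ∈ B → ∃ (m : ℕ) (ζ : E → ℂ) (w : F → ℂ) (y : F → (Fin m → ℝ)),
    IsBranchChart k M N B f p ζ w y

/-! ### Contact branched coverings -/

/-- The complex normal coordinate `w` of `B` in `N` at `b` is compatible with the orientation of
the normal bundle of `B` that is given by the orientations of `N` and `B` as contact manifolds.
This is the orientation by `dα` of the `dα`-orthogonal complement of `ker α ∩ TB`
in `ker α ∩ TN`. -/
def IsPositiveNormal (N B : Set F) (α : OneForm F) (b : F) (w : F → ℂ) : Prop :=
  ∀ u ∈ tangentAt N b, ∀ v ∈ tangentAt N b, α b u = 0 → α b v = 0 →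
    (∀ x ∈ tangentAt B b, α b x = 0 → dForm α b u x = 0 ∧ dForm α b v x = 0) →
    fderiv ℝ w b u = 1 → fderiv ℝ w b v = Complex.I → 0 < dForm α b u v

/-- `v₁, v₂` is a positively oriented basis of `ker df` (restricted to `TM`) at the point `p` over
the branching locus. The orientation of `ker df`, induced by those of `M` (pulled back from `N`) and
of the preimage of `B` (pulled back from `B`), is that of the coordinate `ζ` of a local model in
which `w` is a positive normal coordinate. -/
def IsPositiveKerBasis (k : ℕ) (M : Set E) (N B : Set F) (f : E → F) (α : OneForm F)
    (p v₁ v₂ : E) : Prop :=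
  v₁ ∈ tangentAt M p ∧ v₂ ∈ tangentAt M p ∧ fderiv ℝ f p v₁ = 0 ∧ fderiv ℝ f p v₂ = 0 ∧
    ∃ (m : ℕ) (ζ : E → ℂ) (w : F → ℂ) (y : F → (Fin m → ℝ)),
      IsBranchChart k M N B f p ζ w y ∧ IsPositiveNormal N B α (f p) w ∧
      0 < (star (fderiv ℝ ζ p v₁) * fderiv ℝ ζ p v₂).im

/-- `γ` is a smooth one-form on `M` such that `dγ` is positive on `ker df` along the preimage of
the branching locus. -/
def IsPositivePerturbation (k : ℕ) (M : Set E) (N B : Set F) (f : E → F) (α : OneForm F)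
    (γ : OneForm E) : Prop :=
  SmoothNear M γ ∧ ∀ p ∈ M, f p ∈ B → ∀ v₁ v₂ : E,
    IsPositiveKerBasis k M N B f α p v₁ v₂ → 0 < dForm γ p v₁ v₂

/-- `f : (M, ker η) → (N, ker α)` is a `k`-fold cyclic contact branched covering along
`(B, ker α|_TB)`: a `k`-fold cyclic branched covering, where `η` is a contact form on `M` whose
contact structure is, up to isotopy, the one given by `f^* α + ε γ`, for a one-form `γ` with
`dγ > 0` on `ker df` along the preimage of `B` and small `ε > 0`. Such `γ` exist, and none of the
choices matters. -/
structure IsContactBranchedCovering (k : ℕ) (M : Set E) (N B : Set F) (f : E → F)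
    (α : OneForm F) (η : OneForm E) : Prop where
  branched : IsCyclicBranchedCovering k M N B f
  contact_base : IsContactForm N α
  contact_branch : IsContactForm B α
  contact_total : IsContactForm M η
  exists_perturbation : ∃ γ : OneForm E, IsPositivePerturbation k M N B f α γ
  isotopic : ∀ γ : OneForm E, IsPositivePerturbation k M N B f α γ →
    ∃ ε₀ : ℝ, 0 < ε₀ ∧ ∀ ε : ℝ, 0 < ε → ε < ε₀ →
      IsContactForm M (fun x => pullback f α x + ε • γ x) ∧
      AreIsotopic M (fun x => pullback f α x + ε • γ x) η

/-! ### Brieskorn manifolds -/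

/-- The unit sphere `S^{2n-1}` of `ℂ^n` (for the Euclidean norm). -/
def unitSphere (n : ℕ) : Set (Fin n → ℂ) := {z | ∑ j, ‖z j‖ ^ 2 = 1}

/-- The Brieskorn manifold `Σ(a)` in `ℂ^m`, where `m` is the number of exponents. -/
def brieskorn {m : ℕ} (a : Fin m → ℕ) : Set (Fin m → ℂ) :=
  {z | ∑ j, z j ^ a j = 0 ∧ z ∈ unitSphere m}

/-- The projection `π₀ (z₀, …, z_n) = (z₁, …, z_n)`. -/
def proj₀ {n : ℕ} (z : Fin (n + 1) → ℂ) : Fin n → ℂ := fun j => z j.succ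

/-- The intersection of the variety `∑ z_j ^ a_j = 0` with the cylinder `ℂ × S^{2n-1}`. -/
def cylinderBrieskorn {n : ℕ} (a : Fin (n + 1) → ℕ) : Set (Fin (n + 1) → ℂ) :=
  {z | ∑ j, z j ^ a j = 0 ∧ proj₀ z ∈ unitSphere n}

/-- The one-form `(i/2) ∑ a_j (z_j d\bar z_j - \bar z_j dz_j) = ∑ a_j (x_j dy_j - y_j dx_j)`. -/
def weightedForm {m : ℕ} (a : Fin m → ℕ) : OneForm (Fin m → ℂ) := fun z =>
  ∑ j, (a j : ℝ) • Complex.imCLM.comp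
    ((star (z j)) • (ContinuousLinearMap.proj j : (Fin m → ℂ) →L[ℝ] ℂ))

/-- The standard contact form of the sphere. -/
def stdForm (m : ℕ) : OneForm (Fin m → ℂ) := weightedForm (fun _ => 1)

lemma weightedForm_eq {m : ℕ} (a : Fin m → ℕ) (z v : Fin m → ℂ) :
    ((weightedForm a z v : ℝ) : ℂ) =
      Complex.I / 2 * ∑ j, (a j : ℂ) * (z j * star (v j) - star (z j) * v j) := by
  rw [Finset.mul_sum]
  simp only [weightedForm, sum_apply, Complex.ofReal_sum]
  refine Finset.sum_congr rfl fun j _ => ?_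
  apply Complex.ext
  · simp
    ring
  · simp

end ContactBranched

end

/-! The ellipsoids s²|z₀|² + |z₁|² + ⋯ + |z_n|² = 1, for 0 ≤ s ≤ 1, join the cylinder ℂ × S^{2n-1}
to the unit sphere. The weighted dilations z_j ↦ exp(t/a_j) z_j preserve V_f and are transverse to
every ellipsoid where (z₁, …, z_n) ≠ 0. Moving along them carries the cylinder section of V_f to its
section by any of the ellipsoids (`straighten`). Pulling back ∑ a_j c_j (x_j dy_j - y_j dx_j), with
the weights c = (s², 1, …, 1) of the ellipsoid, gives a smooth path of forms `pathForm a s` on the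
fixed compact manifold M, the cylinder section. It starts at π₀^*β (`pullback_proj₀`) and ends at
the pull-back of α₁ (`pullback_straighten`).

Nondegeneracy is tested by one explicit vector. If v lies in the kernel of the form, then i v,
corrected by multiples of the Euler vector E = (z_j/a_j) and of i E, is again tangent and in the
kernel. Its pairing with v under the exterior derivative is twice a weighted sum of squares ∑ c_j
|v_j - κ (iE)_j|², up to rescaling (`imPair_testVector_eq`, `dForm_pathForm_pathTest`). For v ≠ 0 in
the kernel, the sum vanishes only if s = 0, z₀ = 0, a₀ ≥ 2 and v points along the z₀-axis, that is,
on ker dπ₀ over the branching locus (`eq_single_of_pathSquare_eq_zero`). There the test vector is i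
v, and dγ(v, iv) > 0 by the assumption on γ. Hence `pathForm a s` + (1 - s)εγ is contact for all s
in [0, 1] and all small ε > 0, the bound on ε being uniform by compactness
(`exists_isContactForm_perturbedForm`). Gray stability (`areIsotopic_of_path`) then makes π₀^*β + εγ
isotopic to `pathForm a 1`, which serves as η in the first claim.

Any other admissible η is isotopic to π₀^*β + εγ for the same γ and ε, so it is contactomorphic to
`pathForm a 1` and, through `straighten a 1`, to α₁. The third claim follows by transport: upstairs
along `straighten a 1`, downstairs along the normalized diagonal map with entries √a_j, which pulls
α_std back to a positive multiple of β.

That a positive γ exists requires that the orientation of ker dπ₀ not depend on the local model. To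
leading order, a change of model is a real-linear map v ↦ αv + βv̄ with (αv + βv̄)^k = P v^k + Q
(v^k)¯, where k = a₀. This forces α^k = P and β^k = Q, so the orientation of the normal coordinate w
determines that of ζ (`IsPositiveKerBasis.im_pos`). -/

open Set Filter Topology
open scoped ContDiff NNReal Manifold

noncomputable section

namespace ContactBranched

universe u

/-! ### Smooth dependence of flows on the initial value -/

section ODE

variable {E : Type u} [NormedAddCommGroup E] [NormedSpace ℝ E]

/-- Solutions on all bounded intervals fit together to a solution on the line. -/
lemma exists_global_of_forall_Ioo {f : ℝ → E → E}
    (hL : ∀ T : ℝ, ∃ K : ℝ≥0, ∀ t ∈ Ioo (-T) T, LipschitzWith K (f t)) {x₀ : E}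
    (h : ∀ T : ℝ, 0 < T → ∃ c : ℝ → E, c 0 = x₀ ∧ ∀ t ∈ Ioo (-T) T, HasDerivAt c (f t (c t)) t) :
    ∃ c : ℝ → E, c 0 = x₀ ∧ ∀ t, HasDerivAt c (f t (c t)) t := by
  choose! c hc0 hc using h
  have key : ∀ T T' : ℝ, 0 < T → T ≤ T' → EqOn (c T) (c T') (Ioo (-T) T) := by
    intro T T' hT hTT'
    obtain ⟨K, hK⟩ := hL T
    have h0 : (0 : ℝ) ∈ Ioo (-T) T := ⟨by linarith, hT⟩
    refine ODE_solution_unique_of_mem_Ioo (v := f) (s := fun _ => univ) (K := K)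
      (fun t ht => (hK t ht).lipschitzOnWith) h0 (fun t ht => ⟨hc T hT t ht, mem_univ _⟩)
      (fun t ht => ⟨hc T' (by linarith) t ⟨by linarith [ht.1], by linarith [ht.2]⟩, mem_univ _⟩) ?_
    rw [hc0 T hT, hc0 T' (by linarith)]
  -- At time t the solution on (-T, T) with T = |t| + 1 is used. Near t all these choices agree with
  -- the single solution for T = |t| + 2, which gives differentiability.
  refine ⟨fun t => c (|t| + 1) t, by simpa using hc0 1 one_pos, fun t => ?_⟩
  have ht : t ∈ Ioo (-(|t| + 2)) (|t| + 2) :=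
    ⟨by linarith [neg_abs_le t], by linarith [le_abs_self t]⟩
  have hev : (fun s => c (|s| + 1) s) =ᶠ[𝓝 t] c (|t| + 2) := by
    have : ∀ᶠ s in 𝓝 t, |s| < |t| + 1 :=
      continuous_abs.continuousAt.eventually_lt continuousAt_const (by simp)
    filter_upwards [this] with s hs
    exact key (|s| + 1) (|t| + 2) (by positivity) (by linarith)
      ⟨by linarith [neg_abs_le s], by linarith [le_abs_self s]⟩
  have h2 : c (|t| + 1) t = c (|t| + 2) t := hev.self_of_nhds
  change HasDerivAt _ (f t (c (|t| + 1) t)) t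
  rw [h2]
  exact (hc _ (by positivity) t ht).congr_of_eventuallyEq hev

/-- Global solutions of an ordinary differential equation with a bounded Lipschitz right hand
side. -/
lemma exists_global_of_bounded [CompleteSpace E] {f : ℝ → E → E}
    (hcont : ∀ x, Continuous fun t => f t x)
    (hL : ∀ T : ℝ, ∃ K : ℝ≥0, ∀ t ∈ Icc (-T) T, LipschitzWith K (f t))
    (hb : ∀ T : ℝ, ∃ C : ℝ≥0, ∀ t ∈ Icc (-T) T, ∀ x, ‖f t x‖ ≤ C) (x₀ : E) :
    ∃ c : ℝ → E, c 0 = x₀ ∧ ∀ t, HasDerivAt c (f t (c t)) t := by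
  refine exists_global_of_forall_Ioo
    (fun T => (hL T).imp fun K hK t ht => hK t (Ioo_subset_Icc_self ht)) fun T hT => ?_
  obtain ⟨K, hK⟩ := hL T
  obtain ⟨C, hC⟩ := hb T
  have h0 : (0 : ℝ) ∈ Icc (-T) T := ⟨by linarith, hT.le⟩
  -- The bound C holds on the whole space, so a solution cannot leave the ball of radius C T before
  -- time T. The existence interval is therefore not restricted.
  have hpl : IsPicardLindelof f (tmin := -T) (tmax := T) ⟨0, h0⟩ x₀ (C * T.toNNReal) 0 C K :=
    { lipschitzOnWith := fun t ht => (hK t ht).lipschitzOnWith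
      continuousOn := fun x _ => (hcont x).continuousOn
      norm_le := fun t ht x _ => hC t ht x
      mul_max_le := by simp [hT.le] }
  obtain ⟨c, hc0, hc⟩ := hpl.exists_eq_forall_mem_Icc_hasDerivWithinAt₀
  exact ⟨c, hc0, fun t ht => (hc t (Ioo_subset_Icc_self ht)).hasDerivAt (Icc_mem_nhds ht.1 ht.2)⟩

/-- A bounded Lipschitz map which is the identity on a given ball. -/
lemma exists_lipschitz_cutoff [FiniteDimensional ℝ E] (R : ℝ) :
    ∃ ρ : E → ℝ, ContDiff ℝ ∞ ρ ∧ HasCompactSupport ρ ∧ (∀ x, 0 ≤ ρ x) ∧ (∀ x, ρ x ≤ 1) ∧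
      ∀ x, ‖x‖ ≤ R → ρ x = 1 := by
  let b : ContDiffBump (0 : E) := ⟨|R| + 1, |R| + 2, by positivity, by linarith⟩
  refine ⟨b, b.contDiff, b.hasCompactSupport, fun x => b.nonneg, fun x => b.le_one,
    fun x hx => b.one_of_mem_closedBall ?_⟩
  simp only [mem_closedBall_zero_iff]
  change ‖x‖ ≤ |R| + 1
  linarith [le_abs_self R]

/-- A linear Gronwall estimate in both time directions. -/
lemma norm_le_exp_of_norm_deriv_le {c c' : ℝ → E} {K T : ℝ} (hc : ∀ t, HasDerivAt c (c' t) t)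
    (hK : ∀ t ∈ Icc (-T) T, ‖c' t‖ ≤ K * ‖c t‖) {t : ℝ} (ht : t ∈ Icc (-T) T) :
    ‖c t‖ ≤ ‖c 0‖ * Real.exp (K * |t|) := by
  rcases le_total 0 t with h | h
  · have := norm_le_gronwallBound_of_norm_deriv_right_le (f := c) (f' := c') (δ := ‖c 0‖) (K := K)
      (ε := 0) (a := 0) (b := T) (fun s _ => (hc s).continuousAt.continuousWithinAt)
      (fun s _ => (hc s).hasDerivWithinAt) le_rfl
      (fun s hs => by simpa using hK s ⟨by linarith [hs.1, ht.2], hs.2.le⟩) t ⟨h, ht.2⟩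
    simpa [gronwallBound_ε0, abs_of_nonneg h] using this
  · have := norm_le_gronwallBound_of_norm_deriv_right_le (f := fun s => c (-s))
      (f' := fun s => -c' (-s)) (δ := ‖c 0‖) (K := K) (ε := 0) (a := 0) (b := T)
      (fun s _ => ((hc (-s)).continuousAt.comp continuousAt_neg).continuousWithinAt)
      (fun s _ => by
        have := (hc (-s)).scomp s (hasDerivAt_neg s)
        simpa [Function.comp_def] using this.hasDerivWithinAt) (by simp)
      (fun s hs => by simpa using hK (-s) ⟨by linarith [hs.2], by linarith [hs.1, hs.2]⟩)
      (-t) ⟨by linarith, by linarith [ht.1]⟩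
    simpa [gronwallBound_ε0, abs_of_nonpos h] using this

/-- Global solutions of linear ordinary differential equations. -/
lemma exists_global_linear [FiniteDimensional ℝ E] {A : ℝ → E →L[ℝ] E} (hA : Continuous A)
    (x₀ : E) : ∃ c : ℝ → E, c 0 = x₀ ∧ ∀ t, HasDerivAt c (A t (c t)) t := by
  have hbd : ∀ T : ℝ, ∃ K : ℝ≥0, ∀ t ∈ Icc (-T) T, ‖A t‖ ≤ K := fun T => by
    obtain ⟨K, hK⟩ := (isCompact_Icc (a := -T) (b := T)).exists_bound_of_continuousOn
      hA.continuousOn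
    exact ⟨K.toNNReal, fun t ht => (hK t ht).trans (Real.le_coe_toNNReal K)⟩
  have hlip : ∀ (K : ℝ≥0) t, ‖A t‖ ≤ K → LipschitzWith K (A t) := fun K t h =>
    (A t).lipschitz.weaken h
  refine exists_global_of_forall_Ioo (f := fun t x => A t x)
    (fun T => (hbd T).imp fun K hK t ht => hlip K t (hK t (Ioo_subset_Icc_self ht))) fun T hT => ?_
  obtain ⟨K, hK⟩ := hbd T
  -- The cutoff radius is the Gronwall bound. As 0 ≤ ρ ≤ 1, the truncated equation obeys the same
  -- linear growth bound, so on (-T, T) its solution stays where ρ = 1 and solves the original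
  -- equation.
  obtain ⟨ρ, hρ, hρc, hρ0, hρ1, hρR⟩ :=
    exists_lipschitz_cutoff (E := E) (‖x₀‖ * Real.exp (K * T))
  have hsm : ContDiff ℝ ∞ fun x => ρ x • x := hρ.smul contDiff_id
  have hcs : HasCompactSupport fun x => ρ x • x := hρc.smul_right
  obtain ⟨Cl, hCl⟩ := hsm.lipschitzWith_of_hasCompactSupport hcs (by simp)
  obtain ⟨Cb, hCb⟩ := hcs.exists_bound_of_continuous hsm.continuous
  obtain ⟨c, hc0, hc⟩ := exists_global_of_bounded (f := fun t x => A t (ρ x • x))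
    (fun x => hA.clm_apply continuous_const)
    (fun S => (hbd S).elim fun K' hK' =>
      ⟨K' * Cl, fun t ht => (hlip K' t (hK' t ht)).comp hCl⟩)
    (fun S => (hbd S).elim fun K' hK' => ⟨K' * Cb.toNNReal, fun t ht x =>
      ((A t).le_opNorm _).trans (mul_le_mul (hK' t ht)
        ((hCb x).trans (Real.le_coe_toNNReal Cb)) (norm_nonneg _) K'.2)⟩) x₀
  refine ⟨c, hc0, fun t ht => ?_⟩
  have hest : ‖c t‖ ≤ ‖x₀‖ * Real.exp (K * T) := by
    have := norm_le_exp_of_norm_deriv_le (K := K) (T := T) hc (fun s hs => by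
      refine ((A s).le_opNorm _).trans (mul_le_mul (hK s hs) ?_ (norm_nonneg _) K.2)
      rw [norm_smul, Real.norm_of_nonneg (hρ0 _)]
      exact mul_le_of_le_one_left (norm_nonneg _) (hρ1 _)) (Ioo_subset_Icc_self ht)
    rw [hc0] at this
    refine this.trans (mul_le_mul_of_nonneg_left (Real.exp_le_exp.2 ?_) (norm_nonneg _))
    exact mul_le_mul_of_nonneg_left (abs_le.2 ⟨ht.1.le, ht.2.le⟩) K.2
  have := hc t
  rwa [hρR _ hest, one_smul] at this

/-- `φ` is a global flow of the vector field `X`. -/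
structure IsFlow (X : E → E) (φ : ℝ → E → E) : Prop where
  zero : ∀ x, φ 0 x = x
  deriv : ∀ t x, HasDerivAt (fun s => φ s x) (X (φ t x)) t

lemma exists_norm_le_of_continuousOn {E : Type*} [NormedAddCommGroup E] {c : ℝ → E} {a b : ℝ}
    (h : ContinuousOn c (Icc a b)) :
    ∃ R : ℝ, ∀ t ∈ Icc a b, ‖c t‖ ≤ R :=
  isCompact_Icc.exists_bound_of_continuousOn h

/-- Uniqueness of integral curves. -/
lemma integralCurve_unique [FiniteDimensional ℝ E] {X : E → E} (hX : ContDiff ℝ ∞ X)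
    {c₁ c₂ : ℝ → E} {T : ℝ} (hT : 0 < T)
    (h₁ : ∀ t ∈ Icc (-T) T, HasDerivAt c₁ (X (c₁ t)) t)
    (h₂ : ∀ t ∈ Icc (-T) T, HasDerivAt c₂ (X (c₂ t)) t) (h : c₁ 0 = c₂ 0) :
    EqOn c₁ c₂ (Icc (-T) T) := by
  have hc₁ : ContinuousOn c₁ (Icc (-T) T) :=
    fun t ht => (h₁ t ht).continuousAt.continuousWithinAt
  have hc₂ : ContinuousOn c₂ (Icc (-T) T) :=
    fun t ht => (h₂ t ht).continuousAt.continuousWithinAt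
  obtain ⟨R₁, hR₁⟩ := exists_norm_le_of_continuousOn hc₁
  obtain ⟨R₂, hR₂⟩ := exists_norm_le_of_continuousOn hc₂
  obtain ⟨K, hK⟩ := (hX.contDiffOn (s := Metric.closedBall 0 (max R₁ R₂))).exists_lipschitzOnWith
    (by simp) (convex_closedBall _ _) (isCompact_closedBall _ _)
  refine ODE_solution_unique_of_mem_Icc (v := fun _ => X)
    (s := fun _ => Metric.closedBall 0 (max R₁ R₂)) (fun _ _ => hK) (t₀ := 0)
    ⟨by linarith, hT⟩ hc₁ (fun t ht => h₁ t (Ioo_subset_Icc_self ht)) (fun t ht => ?_)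
    hc₂ (fun t ht => h₂ t (Ioo_subset_Icc_self ht)) (fun t ht => ?_) h
  · simpa using Or.inl (hR₁ t (Ioo_subset_Icc_self ht))
  · simpa using Or.inr (hR₂ t (Ioo_subset_Icc_self ht))

lemma IsFlow.eq_of_integralCurve [FiniteDimensional ℝ E] {X : E → E} (hX : ContDiff ℝ ∞ X)
    {φ : ℝ → E → E} (hφ : IsFlow X φ) {c : ℝ → E} (hc : ∀ t, HasDerivAt c (X (c t)) t) (t : ℝ) :
    φ t (c 0) = c t :=
  integralCurve_unique hX (T := |t| + 1) (by positivity) (fun s _ => hφ.deriv s (c 0))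
    (fun s _ => hc s) (hφ.zero _) ⟨by linarith [neg_abs_le t], by linarith [le_abs_self t]⟩

lemma exists_isFlow_of_bounded [CompleteSpace E] {X : E → E} {K : ℝ≥0} (hK : LipschitzWith K X)
    {C : ℝ} (hC : ∀ x, ‖X x‖ ≤ C) : ∃ φ, IsFlow X φ := by
  choose c h0 h1 using exists_global_of_bounded (f := fun _ => X) (fun _ => continuous_const)
    (fun _ => ⟨K, fun _ _ => hK⟩)
    (fun _ => ⟨C.toNNReal, fun _ _ x => (hC x).trans (Real.le_coe_toNNReal C)⟩)
  exact ⟨fun t x => c x t, h0, fun t x => h1 x t⟩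

lemma exists_isFlow_of_hasCompactSupport [FiniteDimensional ℝ E] {X : E → E}
    (hX : ContDiff ℝ ∞ X) (hc : HasCompactSupport X) : ∃ φ, IsFlow X φ := by
  obtain ⟨K, hK⟩ := hX.lipschitzWith_of_hasCompactSupport hc (by simp)
  obtain ⟨C, hC⟩ := hc.exists_bound_of_continuous hX.continuous
  have : CompleteSpace E := FiniteDimensional.complete ℝ E
  exact exists_isFlow_of_bounded hK hC

/-- Flows are continuous. -/
lemma IsFlow.continuous [FiniteDimensional ℝ E] {X : E → E} (hX : ContDiff ℝ ∞ X)
    {φ : ℝ → E → E} (hφ : IsFlow X φ) : Continuous fun q : ℝ × E => φ q.1 q.2 := by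
  rw [continuous_iff_continuousAt]
  rintro ⟨t₀, x₀⟩
  set T := |t₀| + 1 with hT
  have hTpos : 0 < T := by positivity
  obtain ⟨R, hR⟩ := exists_norm_le_of_continuousOn (c := fun t => φ t x₀) (a := -T) (b := T)
    fun t _ => (hφ.deriv t x₀).continuousAt.continuousWithinAt
  -- The truncated field agrees with X on a ball whose radius exceeds that of the orbit of x₀ by
  -- one. Its flow ψ is Lipschitz in the initial value, so nearby orbits stay in this ball up to
  -- time T and are orbits of X.
  obtain ⟨ρ, hρ, hρc, hρ0, hρ1, hρR⟩ := exists_lipschitz_cutoff (E := E) (R + 1)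
  have hsm : ContDiff ℝ ∞ fun x => ρ x • X x := hρ.smul hX
  have hcs : HasCompactSupport fun x => ρ x • X x := hρc.smul_right
  obtain ⟨ψ, hψ⟩ := exists_isFlow_of_hasCompactSupport hsm hcs
  obtain ⟨K, hK⟩ := hsm.lipschitzWith_of_hasCompactSupport hcs (by simp)
  have heq : ∀ x, ‖x‖ ≤ R + 1 → ρ x • X x = X x := fun x hx => by rw [hρR x hx, one_smul]
  have hlip : ∀ x, ∀ t ∈ Icc (-T) T, ‖ψ t x - ψ t x₀‖ ≤ ‖x - x₀‖ * Real.exp (K * T) := by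
    intro x t ht
    have := norm_le_exp_of_norm_deriv_le (c := fun t => ψ t x - ψ t x₀) (K := K) (T := T)
      (fun t => (hψ.deriv t x).sub (hψ.deriv t x₀)) (fun s _ => by
        simpa [dist_eq_norm] using hK.dist_le_mul (ψ s x) (ψ s x₀)) ht
    simp only [hψ.zero] at this
    refine this.trans (mul_le_mul_of_nonneg_left (Real.exp_le_exp.2 ?_) (norm_nonneg _))
    exact mul_le_mul_of_nonneg_left (abs_le.2 ht) K.2
  have hbase : EqOn (fun t => ψ t x₀) (fun t => φ t x₀) (Icc (-T) T) :=
    integralCurve_unique hsm hTpos (fun t _ => hψ.deriv t x₀) (fun t ht => by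
      rw [heq _ ((hR t ht).trans (by linarith))]; exact hφ.deriv t x₀) (by simp [hψ.zero, hφ.zero])
  have hnear : ∀ x, ‖x - x₀‖ * Real.exp (K * T) ≤ 1 →
      EqOn (fun t => ψ t x) (fun t => φ t x) (Icc (-T) T) := by
    intro x hx
    refine integralCurve_unique hX hTpos (fun t ht => ?_) (fun t _ => hφ.deriv t x)
      (by simp [hψ.zero, hφ.zero])
    have h1 := hψ.deriv t x
    have h2 : ‖ψ t x‖ ≤ R + 1 := by
      have h3 : ψ t x₀ = φ t x₀ := hbase ht
      have h4 := norm_le_norm_add_norm_sub' (ψ t x) (ψ t x₀)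
      rw [h3] at h4
      have h5 := hlip x t ht
      rw [h3] at h5
      linarith [hR t ht]
    rwa [heq _ h2] at h1
  have hx0 : ∀ᶠ x in 𝓝 x₀, ‖x - x₀‖ * Real.exp (K * T) ≤ 1 := by
    have : ContinuousAt (fun x : E => ‖x - x₀‖ * Real.exp (K * T)) x₀ := by fun_prop
    filter_upwards [this.eventually_lt continuousAt_const (by simp : _ < (1 : ℝ))] with x hx
    exact hx.le
  have ht0 : ∀ᶠ t in 𝓝 t₀, t ∈ Icc (-T) T :=
    Icc_mem_nhds (by linarith [neg_abs_le t₀]) (by linarith [le_abs_self t₀])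
  rw [ContinuousAt, tendsto_iff_norm_sub_tendsto_zero]
  have hlim : Tendsto (fun q : ℝ × E => ‖q.2 - x₀‖ * Real.exp (K * T) + ‖φ q.1 x₀ - φ t₀ x₀‖)
      (𝓝 (t₀, x₀)) (𝓝 0) := by
    have h1 : ContinuousAt (fun q : ℝ × E => φ q.1 x₀) (t₀, x₀) :=
      ContinuousAt.comp (f := Prod.fst) (g := fun t => φ t x₀)
        (hφ.deriv t₀ x₀).continuousAt continuousAt_fst
    have : ContinuousAt (fun q : ℝ × E => ‖q.2 - x₀‖ * Real.exp (K * T) + ‖φ q.1 x₀ - φ t₀ x₀‖)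
      (t₀, x₀) := ContinuousAt.add (by fun_prop) (h1.sub continuousAt_const).norm
    simpa [ContinuousAt] using this
  refine squeeze_zero' (Eventually.of_forall fun _ => norm_nonneg _) ?_ hlim
  filter_upwards [ht0.prod_nhds hx0] with q hq
  have h1 : ψ q.1 q.2 = φ q.1 q.2 := hnear q.2 hq.2 hq.1
  have h2 : ψ q.1 x₀ = φ q.1 x₀ := hbase hq.1
  have h3 := hlip q.2 q.1 hq.1
  rw [h1, h2] at h3
  calc ‖φ q.1 q.2 - φ t₀ x₀‖ ≤ ‖φ q.1 q.2 - φ q.1 x₀‖ + ‖φ q.1 x₀ - φ t₀ x₀‖ :=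
        norm_sub_le_norm_sub_add_norm_sub _ _ _
    _ ≤ _ := by linarith

/-- Integrals of smooth functions depend smoothly on parameters. -/
lemma contDiff_integral_of_contDiff {P : Type u} [NormedAddCommGroup P] [NormedSpace ℝ P]
    [FiniteDimensional ℝ P] (n : ℕ) :
    ∀ {F : Type u} [NormedAddCommGroup F] [NormedSpace ℝ F] [CompleteSpace F]
    {g : P → ℝ → F}, ContDiff ℝ ∞ (fun q : P × ℝ => g q.1 q.2) →
    ContDiff ℝ n fun p => ∫ s in (0 : ℝ)..1, g p s := by
  -- The target space is quantified inside the induction, because the derivative is again a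
  -- parameter integral, now with values in P →L[ℝ] F.
  induction n with
  | zero =>
    intro F _ _ _ g hg
    exact contDiff_zero.2
      (intervalIntegral.continuous_parametric_intervalIntegral_of_continuous' hg.continuous _ _)
  | succ n ih =>
    intro F _ _ _ g hg
    have hgs : ∀ s, ContDiff ℝ ∞ fun p => g p s := fun s =>
      hg.comp (contDiff_id.prodMk contDiff_const)
    have hg' : ContDiff ℝ ∞ fun q : P × ℝ => fderiv ℝ (fun p => g p q.2) q.1 := by
      refine ContDiff.fderiv (f := fun (q : P × ℝ) p => g p q.2) (n := ∞) (m := ∞) ?_ contDiff_fst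
        (by simp)
      exact hg.comp (contDiff_snd.prodMk (contDiff_snd.comp contDiff_fst))
    refine contDiff_succ_iff_hasFDerivAt.2
      ⟨fun p => ∫ s in (0 : ℝ)..1, fderiv ℝ (fun p => g p s) p, ih hg', fun p₀ => ?_⟩
    obtain ⟨C, hC⟩ := ((isCompact_closedBall p₀ 1).prod
      (isCompact_Icc (a := (0 : ℝ)) (b := 1))).exists_bound_of_continuousOn
      hg'.continuous.continuousOn
    refine intervalIntegral.hasFDerivAt_integral_of_dominated_of_fderiv_le (bound := fun _ => C)
      (F' := fun p s => fderiv ℝ (fun p => g p s) p)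
      (Metric.closedBall_mem_nhds p₀ one_pos)
      (Eventually.of_forall fun p => (Continuous.aestronglyMeasurable (by
        exact hg.continuous.comp (Continuous.prodMk_right p))))
      ((hg.continuous.comp (Continuous.prodMk_right p₀)).intervalIntegrable _ _)
      (Continuous.aestronglyMeasurable (by
        exact hg'.continuous.comp (Continuous.prodMk_right p₀)))
      (Eventually.of_forall fun s hs p hp => hC (p, s) ⟨hp, ?_⟩)
      intervalIntegrable_const
      (Eventually.of_forall fun s _ p _ =>
        ((hgs s).differentiable (by simp)).differentiableAt.hasFDerivAt)
    rw [uIoc_of_le zero_le_one] at hs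
    exact Ioc_subset_Icc_self hs

/-- A smooth factorization of the increments of a smooth map. -/
lemma exists_contDiff_factor [FiniteDimensional ℝ E] {X : E → E} (hX : ContDiff ℝ ∞ X) :
    ∃ H : E × E → E →L[ℝ] E, ContDiff ℝ ∞ H ∧ ∀ a b, X b - X a = H (a, b) (b - a) := by
  have hD : ContDiff ℝ ∞ (fderiv ℝ X) := hX.fderiv_right (by simp)
  have hg : ContDiff ℝ ∞ fun q : (E × E) × ℝ => fderiv ℝ X (q.1.1 + q.2 • (q.1.2 - q.1.1)) :=
    hD.comp (by fun_prop)
  -- Hadamard's lemma: H is the average of the derivative of X over the segment from a to b.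
  refine ⟨fun p => ∫ s in (0 : ℝ)..1, fderiv ℝ X (p.1 + s • (p.2 - p.1)),
    contDiff_infty.2 fun n => contDiff_integral_of_contDiff n
      (g := fun (p : E × E) s => fderiv ℝ X (p.1 + s • (p.2 - p.1))) hg, fun a b => ?_⟩
  have hcont : Continuous fun s : ℝ => fderiv ℝ X (a + s • (b - a)) :=
    hD.continuous.comp (by fun_prop)
  rw [ContinuousLinearMap.intervalIntegral_apply (hcont.intervalIntegrable _ _)]
  have hd : ∀ s : ℝ, HasDerivAt (fun s : ℝ => X (a + s • (b - a)))
      (fderiv ℝ X (a + s • (b - a)) (b - a)) s := fun s => by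
    have h1 : HasDerivAt (fun s : ℝ => a + s • (b - a)) (b - a) s := by
      simpa using ((hasDerivAt_id s).smul_const (b - a)).const_add a
    exact ((hX.differentiable (by simp)).differentiableAt.hasFDerivAt).comp_hasDerivAt s h1
  rw [intervalIntegral.integral_eq_sub_of_hasDerivAt (fun s _ => hd s)
    ((hcont.clm_apply continuous_const).intervalIntegrable _ _)]
  simp

/-- The flow of a smooth vector field is smooth. -/
theorem IsFlow.contDiff_nat (n : ℕ) : ∀ {E : Type u} [NormedAddCommGroup E] [NormedSpace ℝ E]
    [FiniteDimensional ℝ E] {X : E → E} {φ : ℝ → E → E}, ContDiff ℝ ∞ X → IsFlow X φ →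
    ContDiff ℝ n fun q : ℝ × E => φ q.1 q.2 := by
  -- E is quantified inside the induction, because the hypothesis for n is applied to a flow on the
  -- larger space E × E × (E →L[ℝ] E).
  induction n with
  | zero => intro E _ _ _ X φ hX hφ; exact contDiff_zero.2 (hφ.continuous hX)
  | succ n ih =>
    intro E _ _ _ X φ hX hφ
    -- The increment φ_t b - φ_t a solves the linear equation c' = H(φ_t a, φ_t b) c. Hence it is
    -- V(b - a), where V is the solution operator with V = id at time 0. Differentiability of the
    -- flow thereby reduces to regularity of V.
    obtain ⟨H, hH, hXH⟩ := exists_contDiff_factor hX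
    have hφc : ∀ x, Continuous fun t => φ t x := fun x =>
      continuous_iff_continuousAt.2 fun t => (hφ.deriv t x).continuousAt
    have hlin : ∀ (a b : E) (L : E →L[ℝ] E), ∃ c : ℝ → (E →L[ℝ] E), c 0 = L ∧
        ∀ t, HasDerivAt c ((H (φ t a, φ t b)).comp (c t)) t := fun a b L => by
      refine exists_global_linear
        (A := fun t => ContinuousLinearMap.compL ℝ E E E (H (φ t a, φ t b))) ?_ L
      exact (ContinuousLinearMap.compL ℝ E E E).continuous.comp
        (hH.continuous.comp ((hφc a).prodMk (hφc b)))
    choose V hV0 hV using hlin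
    -- The triple (φ_t a, φ_t b, V) is the flow of the smooth autonomous field Y, so V is of class
    -- Cⁿ by induction.
    let Y : E × E × (E →L[ℝ] E) → E × E × (E →L[ℝ] E) := fun q =>
      (X q.1, X q.2.1, (H (q.1, q.2.1)).comp q.2.2)
    have hY : ContDiff ℝ ∞ Y := by
      refine (hX.comp contDiff_fst).prodMk ((hX.comp (contDiff_fst.comp contDiff_snd)).prodMk ?_)
      exact (hH.comp (contDiff_fst.prodMk (contDiff_fst.comp contDiff_snd))).clm_comp
        (contDiff_snd.comp contDiff_snd)
    have hΨ : IsFlow Y fun t q => (φ t q.1, φ t q.2.1, V q.1 q.2.1 q.2.2 t) :=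
      ⟨fun q => by simp [hφ.zero, hV0],
        fun t q => (hφ.deriv t q.1).prodMk ((hφ.deriv t q.2.1).prodMk (hV _ _ _ t))⟩
    have hΨn := ih hY hΨ
    have hW : ContDiff ℝ n fun q : ℝ × E × E =>
        V q.2.1 q.2.2 (ContinuousLinearMap.id ℝ E) q.1 := by
      have h1 := (contDiff_snd.comp contDiff_snd).comp (hΨn.comp
        (g := fun q : ℝ × E × E × (E →L[ℝ] E) => _)
        (f := fun q : ℝ × E × E => (q.1, q.2.1, q.2.2, ContinuousLinearMap.id ℝ E)) (by fun_prop))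
      exact h1
    have hφn : ContDiff ℝ n fun q : ℝ × E => φ q.1 q.2 := ih hX hφ
    -- Both sides solve the same linear equation and vanish together at time 0; Gronwall bounds
    -- their difference by zero.
    have hinc : ∀ a b t, φ t b - φ t a = V a b (ContinuousLinearMap.id ℝ E) t (b - a) := by
      intro a b t
      obtain ⟨K, hK⟩ := (isCompact_Icc (a := -|t|) (b := |t|)).exists_bound_of_continuousOn
        (hH.continuous.comp ((hφc a).prodMk (hφc b))).continuousOn
      have := norm_le_exp_of_norm_deriv_le (K := K) (T := |t|) (t := t)
        (c := fun t => φ t b - φ t a - V a b (ContinuousLinearMap.id ℝ E) t (b - a))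
        (fun t => ((hφ.deriv t b).sub (hφ.deriv t a)).sub
          ((hV a b _ t).clm_apply (hasDerivAt_const t (b - a)))) (fun s hs => by
          have h1 : X (φ s b) - X (φ s a)
              - ((H (φ s a, φ s b)).comp (V a b (ContinuousLinearMap.id ℝ E) s) (b - a)
                + V a b (ContinuousLinearMap.id ℝ E) s 0)
              = H (φ s a, φ s b)
                (φ s b - φ s a - V a b (ContinuousLinearMap.id ℝ E) s (b - a)) := by
            rw [hXH]; simp
          rw [h1]
          exact ((H _).le_opNorm _).trans
            (mul_le_mul_of_nonneg_right (hK s hs) (norm_nonneg _)))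
        ⟨neg_abs_le t, le_abs_self t⟩
      simp only [hφ.zero, hV0, ContinuousLinearMap.id_apply, sub_self, norm_zero, zero_mul] at this
      exact sub_eq_zero.1 (norm_le_zero_iff.1 this)
    -- The spatial derivative at x is V on the diagonal a = b = x. The candidate derivative is of
    -- class Cⁿ, so the flow is of class Cⁿ⁺¹.
    refine contDiff_succ_iff_hasFDerivAt.2 ⟨fun q =>
      (ContinuousLinearMap.fst ℝ ℝ E).smulRight (X (φ q.1 q.2)) +
        (V q.2 q.2 (ContinuousLinearMap.id ℝ E) q.1).comp (ContinuousLinearMap.snd ℝ ℝ E), ?_, ?_⟩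
    · refine (contDiff_const.smulRight ((hX.of_le (by exact_mod_cast le_top)).comp hφn)).add
        (ContDiff.clm_comp ?_ contDiff_const)
      exact hW.comp (g := fun q : ℝ × E × E => _) (f := fun q : ℝ × E => (q.1, q.2, q.2))
        (by fun_prop)
    · rintro ⟨t, x⟩
      have h1 : HasFDerivAt (fun q : ℝ × E => φ q.1 x)
          ((ContinuousLinearMap.fst ℝ ℝ E).smulRight (X (φ t x))) (t, x) := by
        have := (hφ.deriv t x).hasFDerivAt.comp (t, x) (hasFDerivAt_fst (𝕜 := ℝ) (p := (t, x)))
        refine this.congr_fderiv ?_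
        ext <;> simp
      have h2 : HasFDerivAt (fun q : ℝ × E => φ q.1 q.2 - φ q.1 x)
          ((V x x (ContinuousLinearMap.id ℝ E) t).comp (ContinuousLinearMap.snd ℝ ℝ E)) (t, x) := by
        refine HasFDerivAt.of_isLittleO ?_
        have hWc : Tendsto (fun q : ℝ × E => V x q.2 (ContinuousLinearMap.id ℝ E) q.1 -
            V x x (ContinuousLinearMap.id ℝ E) t) (𝓝 (t, x)) (𝓝 0) := by
          have : Continuous fun q : ℝ × E => V x q.2 (ContinuousLinearMap.id ℝ E) q.1 -
            V x x (ContinuousLinearMap.id ℝ E) t :=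
            (hW.continuous.comp (f := fun q : ℝ × E => (q.1, x, q.2)) (by fun_prop)).sub
              continuous_const
          simpa using this.tendsto (t, x)
        have h3 : (fun q : ℝ × E => (V x q.2 (ContinuousLinearMap.id ℝ E) q.1 -
            V x x (ContinuousLinearMap.id ℝ E) t) (q.2 - x)) =o[𝓝 (t, x)] fun q => q - (t, x) := by
          rw [Asymptotics.isLittleO_iff]
          intro ε hε
          filter_upwards [hWc.norm.eventually (gt_mem_nhds (by simpa using hε))] with q hq
          refine (ContinuousLinearMap.le_opNorm _ _).trans
            (mul_le_mul hq.le ?_ (norm_nonneg _) hε.le)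
          exact norm_snd_le (q - (t, x))
        refine h3.congr_left fun q => ?_
        simp [hinc]
      exact (h1.add h2).congr_of_eventuallyEq (Eventually.of_forall fun q => by simp)

theorem IsFlow.contDiff [FiniteDimensional ℝ E] {X : E → E} {φ : ℝ → E → E}
    (hφ : IsFlow X φ) (hX : ContDiff ℝ ∞ X) : ContDiff ℝ ∞ fun q : ℝ × E => φ q.1 q.2 :=
  contDiff_infty.2 fun n => IsFlow.contDiff_nat n hX hφ

lemma minSmoothness_two_le : minSmoothness ℝ 2 ≤ ∞ := by
  rw [minSmoothness_of_isRCLikeNormedField]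
  exact WithTop.coe_le_coe.2 (le_top : (2 : ℕ∞) ≤ ⊤)

/-- The derivative of a flow solves the linearized equation. -/
lemma IsFlow.hasDerivAt_fderiv [FiniteDimensional ℝ E] {X : E → E} {φ : ℝ → E → E}
    (hφ : IsFlow X φ) (hX : ContDiff ℝ ∞ X) (x v : E) (t : ℝ) :
    HasDerivAt (fun s => fderiv ℝ (φ s) x v) (fderiv ℝ X (φ t x) (fderiv ℝ (φ t) x v)) t := by
  set Φ : ℝ × E → E := fun q => φ q.1 q.2 with hΦ
  have hΦs : ContDiff ℝ ∞ Φ := hφ.contDiff hX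
  have hΦd : Differentiable ℝ Φ := hΦs.differentiable (by simp)
  have hD : Differentiable ℝ (fderiv ℝ Φ) :=
    (hΦs.fderiv_right (m := ∞) (by simp)).differentiable (by simp)
  have hspace : ∀ s, fderiv ℝ (φ s) x v = fderiv ℝ Φ (s, x) (0, v) := fun s => by
    have h := (hΦd (s, x)).hasFDerivAt.comp x ((hasFDerivAt_const s x).prodMk (hasFDerivAt_id x))
    have h2 : HasFDerivAt (φ s) _ x := h
    rw [h2.fderiv]
    simp
  have htime : ∀ q : ℝ × E, fderiv ℝ Φ q (1, 0) = X (Φ q) := fun q => by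
    have h := (hΦd q).hasFDerivAt.comp_hasDerivAt q.1
      ((hasDerivAt_id q.1).prodMk (hasDerivAt_const q.1 q.2))
    exact h.unique (hφ.deriv q.1 q.2)
  -- The linearized equation is the symmetry of the mixed second derivatives in t and x, combined
  -- with ∂_t Φ = X ∘ Φ.
  have hsymm : fderiv ℝ (fderiv ℝ Φ) (t, x) (1, 0) (0, v) =
      fderiv ℝ (fderiv ℝ Φ) (t, x) (0, v) (1, 0) :=
    (hΦs.contDiffAt.isSymmSndFDerivAt minSmoothness_two_le).eq _ _
  have h1 : HasDerivAt (fun s => fderiv ℝ Φ (s, x) (0, v))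
      (fderiv ℝ (fderiv ℝ Φ) (t, x) (1, 0) (0, v)) t := by
    have h := (hD (t, x)).hasFDerivAt.comp_hasDerivAt t
      ((hasDerivAt_id t).prodMk (hasDerivAt_const t x))
    simpa using h.clm_apply (hasDerivAt_const t ((0 : ℝ), v))
  have h2 : fderiv ℝ (fderiv ℝ Φ) (t, x) (0, v) (1, 0) =
      fderiv ℝ X (φ t x) (fderiv ℝ Φ (t, x) (0, v)) := by
    have h3 : HasFDerivAt (fun q => fderiv ℝ Φ q (1, 0))
        ((fderiv ℝ X (Φ (t, x))).comp (fderiv ℝ Φ (t, x))) (t, x) := by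
      simp only [htime]
      exact ((hX.differentiable (by simp)) _).hasFDerivAt.comp _ (hΦd _).hasFDerivAt
    have h4 := (hD (t, x)).hasFDerivAt.clm_apply (hasFDerivAt_const ((1 : ℝ), (0 : E)) (t, x))
    have := DFunLike.congr_fun (h4.unique h3) (0, v)
    simpa using this
  simp only [hspace]
  rw [← h2, ← hsymm]
  exact h1

end ODE

section Submanifolds

variable {E F G : Type*} [NormedAddCommGroup E] [NormedSpace ℝ E]
  [NormedAddCommGroup F] [NormedSpace ℝ F] [NormedAddCommGroup G] [NormedSpace ℝ G]

/-! ### Smooth maps near a set -/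

/-- The points near which f is smooth form an open set, so smoothness near M can be checked point by
point. The closure properties below are proved in this form. -/
lemma smoothNear_iff {M : Set E} {f : E → F} :
    SmoothNear M f ↔ ∀ p ∈ M, ∀ᶠ x in 𝓝 p, ContDiffAt ℝ ∞ f x := by
  constructor
  · rintro ⟨U, hU, hMU, hf⟩ p hp
    filter_upwards [hU.mem_nhds (hMU hp)] with x hx
    exact (hf x hx).contDiffAt (hU.mem_nhds hx)
  · intro h
    refine ⟨{x | ∀ᶠ y in 𝓝 x, ContDiffAt ℝ ∞ f y}, isOpen_setOfPred_eventually_nhds, h, ?_⟩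
    intro x hx
    exact (hx.self_of_nhds : ContDiffAt ℝ ∞ f x).contDiffWithinAt

lemma SmoothNear.contDiffAt {M : Set E} {f : E → F} (h : SmoothNear M f) {p : E} (hp : p ∈ M) :
    ContDiffAt ℝ ∞ f p := (smoothNear_iff.1 h p hp).self_of_nhds

lemma SmoothNear.differentiableAt {M : Set E} {f : E → F} (h : SmoothNear M f) {p : E}
    (hp : p ∈ M) : DifferentiableAt ℝ f p := (h.contDiffAt hp).differentiableAt (by simp)

lemma smoothNear_of_contDiff {f : E → F} (h : ContDiff ℝ ∞ f) (M : Set E) : SmoothNear M f :=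
  ⟨univ, isOpen_univ, subset_univ _, h.contDiffOn⟩

lemma SmoothNear.mono {M M' : Set E} {f : E → F} (h : SmoothNear M f) (hM : M' ⊆ M) :
    SmoothNear M' f := by
  obtain ⟨U, hU, hMU, hf⟩ := h
  exact ⟨U, hU, hM.trans hMU, hf⟩

lemma SmoothNear.comp {M : Set E} {N : Set F} {g : F → G} {f : E → F} (hg : SmoothNear N g)
    (hf : SmoothNear M f) (h : MapsTo f M N) : SmoothNear M (g ∘ f) := by
  rw [smoothNear_iff] at *
  intro p hp
  have hc : ContinuousAt f p := (hf p hp).self_of_nhds.continuousAt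
  filter_upwards [hf p hp, hc.eventually (hg (f p) (h hp))] with x h1 h2
  exact h2.comp x h1

lemma SmoothNear.map₂ {M : Set E} {f : E → F} {g : E → G} {H : Type*} [NormedAddCommGroup H]
    [NormedSpace ℝ H] {B : F × G → H} (hB : ContDiff ℝ ∞ B) (hf : SmoothNear M f)
    (hg : SmoothNear M g) : SmoothNear M fun x => B (f x, g x) := by
  rw [smoothNear_iff] at *
  intro p hp
  filter_upwards [hf p hp, hg p hp] with x h1 h2
  exact hB.contDiffAt.comp x (h1.prodMk h2)

lemma SmoothNear.add {M : Set E} {f g : E → F} (hf : SmoothNear M f) (hg : SmoothNear M g) :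
    SmoothNear M fun x => f x + g x :=
  SmoothNear.map₂ (B := fun q : F × F => q.1 + q.2) (by fun_prop) hf hg

lemma SmoothNear.smul {M : Set E} {f : E → ℝ} {g : E → F} (hf : SmoothNear M f)
    (hg : SmoothNear M g) : SmoothNear M fun x => f x • g x :=
  SmoothNear.map₂ (B := fun q : ℝ × F => q.1 • q.2) (by fun_prop) hf hg

lemma SmoothNear.const_smul {M : Set E} {g : E → F} (c : ℝ) (hg : SmoothNear M g) :
    SmoothNear M fun x => c • g x :=
  (smoothNear_of_contDiff (contDiff_const (c := c)) M).smul hg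

lemma SmoothNear.fderiv {M : Set E} {f : E → F} (hf : SmoothNear M f) :
    SmoothNear M (fderiv ℝ f) := by
  rw [smoothNear_iff] at *
  intro p hp
  filter_upwards [hf p hp] with x h1
  exact h1.fderiv_right (by simp)

lemma SmoothNear.pullback {M : Set E} {N : Set F} {f : E → F} {α : OneForm F}
    (hf : SmoothNear M f) (h : MapsTo f M N) (hα : SmoothNear N α) :
    SmoothNear M (pullback f α) :=
  SmoothNear.map₂ (B := fun q : (F →L[ℝ] ℝ) × (E →L[ℝ] F) => q.1.comp q.2) (by fun_prop)
    (hα.comp hf h) hf.fderiv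

/-! ### Tangent vectors -/

lemma fderiv_mem_tangentAt {M : Set E} {N : Set F} {f : E → F} {p v : E}
    (hf : ContDiffAt ℝ ∞ f p) (h : MapsTo f M N) (hv : v ∈ tangentAt M p) :
    fderiv ℝ f p v ∈ tangentAt N (f p) := by
  obtain ⟨c, hc, rfl, hcM, hcv⟩ := hv
  refine ⟨f ∘ c, hf.comp 0 hc, rfl, hcM.mono fun t ht => h ht, ?_⟩
  exact (hf.differentiableAt (by simp)).hasFDerivAt.comp_hasDerivAt 0 hcv

/-- Here v is arbitrary, since f composed with the straight line p + t v is a curve in N. For a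
retraction this shows that its derivative maps the whole space into the tangent space. -/
lemma fderiv_mem_tangentAt_of_eventually_mem {N : Set F} {f : E → F} {p : E}
    (hf : ContDiffAt ℝ ∞ f p) (h : ∀ᶠ x in 𝓝 p, f x ∈ N) (v : E) :
    fderiv ℝ f p v ∈ tangentAt N (f p) := by
  have h0 : p + (0 : ℝ) • v = p := by simp
  have hl : HasDerivAt (fun t : ℝ => p + t • v) v 0 := by
    simpa using ((hasDerivAt_id (0 : ℝ)).smul_const v).const_add p
  have hls : ContDiffAt ℝ ∞ (fun t : ℝ => p + t • v) 0 := by fun_prop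
  refine ⟨fun t => f (p + t • v), ?_, by simp, ?_, ?_⟩
  · exact ContDiffAt.comp (g := f) 0 (by rw [h0]; exact hf) hls
  · have h1 : Tendsto (fun t : ℝ => p + t • v) (𝓝 0) (𝓝 p) := by
      simpa only [h0] using hls.continuousAt.tendsto
    exact h1.eventually h
  · exact HasFDerivAt.comp_hasDerivAt (l := f) 0
      (by rw [h0]; exact (hf.differentiableAt (by simp)).hasFDerivAt) hl

lemma tangentAt_mono {M N : Set E} (h : M ⊆ N) (p : E) : tangentAt M p ⊆ tangentAt N p := by
  rintro v ⟨c, hc, h0, hcM, hcv⟩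
  exact ⟨c, hc, h0, hcM.mono fun t ht => h ht, hcv⟩

/-- Maps on M are represented by ambient extensions; derivatives in tangent directions do not depend
on the extension. -/
lemma fderiv_eq_of_eventually_eqOn {M : Set E} {f g : E → F} {p v : E}
    (hf : DifferentiableAt ℝ f p) (hg : DifferentiableAt ℝ g p)
    (h : ∀ᶠ x in 𝓝[M] p, f x = g x) (hp : p ∈ M) (hv : v ∈ tangentAt M p) :
    fderiv ℝ f p v = fderiv ℝ g p v := by
  obtain ⟨c, hc, rfl, hcM, hcv⟩ := hv
  have h1 := hf.hasFDerivAt.comp_hasDerivAt 0 hcv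
  have h2 := hg.hasFDerivAt.comp_hasDerivAt 0 hcv
  have h3 : Tendsto c (𝓝 0) (𝓝[M] (c 0)) :=
    tendsto_nhdsWithin_iff.2 ⟨hcv.continuousAt, hcM⟩
  exact h1.unique (h2.congr_of_eventuallyEq (h3.eventually h))

lemma fderiv_eq_of_eqOn {M : Set E} {f g : E → F} {p v : E}
    (hf : DifferentiableAt ℝ f p) (hg : DifferentiableAt ℝ g p)
    (h : EqOn f g M) (hp : p ∈ M) (hv : v ∈ tangentAt M p) :
    fderiv ℝ f p v = fderiv ℝ g p v :=
  fderiv_eq_of_eventually_eqOn hf hg (eventually_nhdsWithin_of_forall h) hp hv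

/-- `r` is a smooth retraction onto `M` of a neighbourhood of `p`. -/
structure IsLocalRetraction (M : Set E) (p : E) (r : E → E) : Prop where
  smooth : ∀ᶠ x in 𝓝 p, ContDiffAt ℝ ∞ r x
  mem : ∀ᶠ x in 𝓝 p, r x ∈ M
  fix : ∀ᶠ x in 𝓝 p, x ∈ M → r x = x

namespace IsLocalRetraction

variable {M : Set E} {p : E} {r : E → E}

lemma eventually (h : IsLocalRetraction M p r) : ∀ᶠ x in 𝓝 p, IsLocalRetraction M x r := by
  filter_upwards [h.smooth.eventually_nhds, h.mem.eventually_nhds, h.fix.eventually_nhds]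
    with x h1 h2 h3 using ⟨h1, h2, h3⟩

lemma contDiffAt (h : IsLocalRetraction M p r) : ContDiffAt ℝ ∞ r p := h.smooth.self_of_nhds

lemma differentiableAt (h : IsLocalRetraction M p r) : DifferentiableAt ℝ r p :=
  h.contDiffAt.differentiableAt (by simp)

lemma apply (h : IsLocalRetraction M p r) (hp : p ∈ M) : r p = p := h.fix.self_of_nhds hp

lemma fderiv_mem (h : IsLocalRetraction M p r) (hp : p ∈ M) (v : E) :
    fderiv ℝ r p v ∈ tangentAt M p := by
  have := fderiv_mem_tangentAt_of_eventually_mem h.contDiffAt h.mem v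
  rwa [h.apply hp] at this

lemma fderiv_eq_self (h : IsLocalRetraction M p r) (hp : p ∈ M) {v : E}
    (hv : v ∈ tangentAt M p) : fderiv ℝ r p v = v := by
  have := fderiv_eq_of_eventually_eqOn (g := id) h.differentiableAt differentiableAt_id
    (eventually_nhdsWithin_iff.2 h.fix) hp hv
  simpa using this

/-- Tangent vectors are defined by curves, so linearity of the tangent space is not evident. It
follows from this description as the fixed space of a linear map. -/
lemma mem_tangentAt_iff (h : IsLocalRetraction M p r) (hp : p ∈ M) {v : E} :
    v ∈ tangentAt M p ↔ fderiv ℝ r p v = v :=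
  ⟨h.fderiv_eq_self hp, fun hv => hv ▸ h.fderiv_mem hp v⟩

end IsLocalRetraction

/-- Let L be a right inverse of D = Dg(p) and Q = 1 - LD the projection onto ker D. The map Ψ = Q +
L ∘ g has derivative the identity at p and satisfies D ∘ Ψ = g, so it straightens M to the range of
Q. The retraction is Ψ⁻¹ ∘ Q ∘ Ψ. -/
lemma exists_localRetraction [FiniteDimensional ℝ E] [FiniteDimensional ℝ G] {M U : Set E}
    {p : E} {g : E → G} (hp : p ∈ M) (hU : IsOpen U) (hpU : p ∈ U) (hg : ContDiffOn ℝ ∞ g U)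
    (hsurj : Function.Surjective (fderiv ℝ g p)) (hM : M ∩ U = {x ∈ U | g x = 0}) :
    ∃ r, IsLocalRetraction M p r ∧ ∀ v, fderiv ℝ g p v = 0 → fderiv ℝ r p v = v := by
  have : CompleteSpace E := FiniteDimensional.complete ℝ E
  set D := fderiv ℝ g p with hD
  obtain ⟨L₀, hL₀⟩ := (D : E →ₗ[ℝ] G).exists_rightInverse_of_surjective
    (LinearMap.range_eq_top.2 hsurj)
  let L : G →L[ℝ] E := LinearMap.toContinuousLinearMap L₀
  have hL : ∀ y, D (L y) = y := fun y => LinearMap.congr_fun hL₀ y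
  let Q : E →L[ℝ] E := ContinuousLinearMap.id ℝ E - L.comp D
  let Ψ : E → E := fun x => Q x + L (g x)
  have hDQ : ∀ x, D (Q x) = 0 := fun x => by simp [Q, hL]
  have hDΨ : ∀ x, D (Ψ x) = g x := fun x => by simp [Ψ, hDQ, hL]
  have hΨs : ContDiffOn ℝ ∞ Ψ U :=
    Q.contDiff.contDiffOn.add (L.contDiff.comp_contDiffOn hg)
  have hΨat : ∀ x ∈ U, ContDiffAt ℝ ∞ Ψ x := fun x hx => (hΨs x hx).contDiffAt (hU.mem_nhds hx)
  have hgp : HasFDerivAt g D p :=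
    (((hg p hpU).contDiffAt (hU.mem_nhds hpU)).differentiableAt (by simp)).hasFDerivAt
  have hΨp : HasFDerivAt Ψ ((ContinuousLinearEquiv.refl ℝ E : E ≃L[ℝ] E) : E →L[ℝ] E) p := by
    have := Q.hasFDerivAt.add (L.hasFDerivAt.comp p hgp)
    refine this.congr_fderiv ?_
    ext x
    simp [Q]
  let e := (hΨat p hpU).toOpenPartialHomeomorph Ψ hΨp (by simp)
  have hpe : p ∈ e.source := (hΨat p hpU).mem_toOpenPartialHomeomorph_source hΨp (by simp)
  have hee : ∀ x, e x = Ψ x := fun x => rfl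
  have hgp0 : g p = 0 := by
    have : p ∈ {x ∈ U | g x = 0} := hM ▸ ⟨hp, hpU⟩
    exact this.2
  have hQΨ : Q (Ψ p) = Ψ p := by
    simp only [Q, sub_apply, ContinuousLinearMap.id_apply,
      ContinuousLinearMap.comp_apply, hDΨ, hgp0, map_zero, sub_zero]
  have hsymmp : e.symm (Ψ p) = p := e.left_inv hpe
  -- the inverse is smooth near `Ψ p`
  have hinv : ∀ᶠ y in 𝓝 (Ψ p), ContDiffAt ℝ ∞ e.symm y := by
    have hc : ContinuousAt e.symm (Ψ p) := e.continuousAt_symm (e.map_source hpe)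
    have h1 : ∀ᶠ x in 𝓝 p, x ∈ U ∧
        fderiv ℝ Ψ x ∈ range ((↑) : (E ≃L[ℝ] E) → E →L[ℝ] E) := by
      refine Eventually.and (hU.mem_nhds hpU) ?_
      have hcd : ContinuousAt (fderiv ℝ Ψ) p :=
        ((hΨat p hpU).fderiv_right (m := ∞) (by simp)).continuousAt
      refine hcd.eventually ?_
      rw [hΨp.fderiv]
      exact ContinuousLinearEquiv.nhds _
    rw [← hsymmp] at h1
    filter_upwards [hc.eventually h1, e.open_target.mem_nhds (e.map_source hpe)] with y hy hyt
    obtain ⟨hyU, e', he'⟩ := hy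
    refine e.contDiffAt_symm hyt (f₀' := e') ?_ (hΨat _ hyU)
    rw [he']
    exact ((hΨat _ hyU).differentiableAt (by simp)).hasFDerivAt
  let r : E → E := fun x => e.symm (Q (Ψ x))
  have hcont : ContinuousAt (fun x => Q (Ψ x)) p :=
    Q.continuous.continuousAt.comp (hΨat p hpU).continuousAt
  have hcont' : Tendsto (fun x => Q (Ψ x)) (𝓝 p) (𝓝 (Ψ p)) := by
    have := hcont.tendsto
    rwa [hQΨ] at this
  have hrs : ∀ᶠ x in 𝓝 p, ContDiffAt ℝ ∞ r x := by
    filter_upwards [hcont'.eventually hinv, hU.mem_nhds hpU] with x h1 h2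
    exact h1.comp x (Q.contDiff.contDiffAt.comp x (hΨat x h2))
  have hrp : r p = p := by simp only [r, hQΨ, hsymmp]
  refine ⟨r, ⟨hrs, ?_, ?_⟩, ?_⟩
  · have hrc : Tendsto r (𝓝 p) (𝓝 p) := by
      have := hrs.self_of_nhds.continuousAt.tendsto
      rwa [hrp] at this
    filter_upwards [hrc.eventually (hU.mem_nhds hpU),
      hcont'.eventually (e.open_target.mem_nhds (e.map_source hpe))] with x h1 h2
    have h3 : Ψ (r x) = Q (Ψ x) := e.right_inv h2
    have h4 : g (r x) = 0 := by rw [← hDΨ, h3, hDQ]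
    have : r x ∈ {x ∈ U | g x = 0} := ⟨h1, h4⟩
    rw [← hM] at this
    exact this.1
  · filter_upwards [hU.mem_nhds hpU, e.open_source.mem_nhds hpe] with x h1 h2 h3
    have h4 : x ∈ {x ∈ U | g x = 0} := hM ▸ ⟨h3, h1⟩
    have h5 : Q (Ψ x) = Ψ x := by
      simp only [Q, sub_apply, ContinuousLinearMap.id_apply,
        ContinuousLinearMap.comp_apply, hDΨ, h4.2, map_zero, sub_zero]
    simp only [r, h5]
    exact e.left_inv h2
  · intro v hv
    have h1 : HasFDerivAt e.symm (ContinuousLinearMap.id ℝ E) (Ψ p) := by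
      have h2 := e.hasFDerivAt_symm (f' := ContinuousLinearEquiv.refl ℝ E) (e.map_source hpe)
        (by rw [hee, hsymmp]; exact hΨp)
      exact h2
    have h2 : HasFDerivAt r _ p := HasFDerivAt.comp (g := e.symm) p
      (by rw [hQΨ]; exact h1) (Q.hasFDerivAt.comp p hΨp)
    rw [h2.fderiv]
    simp [Q, hv]

lemma IsSubmanifold.exists_localRetraction [FiniteDimensional ℝ E] {c : ℕ} {M : Set E}
    (h : IsSubmanifold c M) {p : E} (hp : p ∈ M) : ∃ r, IsLocalRetraction M p r := by
  obtain ⟨U, hU, hpU, g, hg, hs, hM⟩ := h p hp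
  obtain ⟨r, hr, -⟩ := ContactBranched.exists_localRetraction hp hU hpU hg hs hM
  exact ⟨r, hr⟩

/-- The curves needed for the inclusion of the kernel are supplied by the retraction, whose
derivative fixes the kernel of Dg(p). -/
lemma tangentAt_eq_ker [FiniteDimensional ℝ E] [FiniteDimensional ℝ G] {M U : Set E}
    {p : E} {g : E → G} (hp : p ∈ M) (hU : IsOpen U) (hpU : p ∈ U) (hg : ContDiffOn ℝ ∞ g U)
    (hsurj : Function.Surjective (fderiv ℝ g p)) (hM : M ∩ U = {x ∈ U | g x = 0}) :
    tangentAt M p = {v | fderiv ℝ g p v = 0} := by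
  obtain ⟨r, hr, hrg⟩ := exists_localRetraction hp hU hpU hg hsurj hM
  ext v
  refine ⟨fun hv => ?_, fun hv => (hr.mem_tangentAt_iff hp).2 (hrg v hv)⟩
  have h0 : ∀ᶠ x in 𝓝[M] p, g x = (fun _ => (0 : G)) x := by
    rw [eventually_nhdsWithin_iff]
    filter_upwards [hU.mem_nhds hpU] with x h1 h2
    have : x ∈ {x ∈ U | g x = 0} := hM ▸ ⟨h2, h1⟩
    exact this.2
  have := fderiv_eq_of_eventually_eqOn
    (((hg p hpU).contDiffAt (hU.mem_nhds hpU)).differentiableAt (by simp))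
    (differentiableAt_const (0 : G)) h0 hp hv
  simpa using this

/-- A zero set with values in an arbitrary space of dimension `c`. -/
lemma isSubmanifold_of_zero_set [FiniteDimensional ℝ G] {c : ℕ} (hc : Module.finrank ℝ G = c)
    {M : Set E} (h : ∀ p ∈ M, ∃ U : Set E, IsOpen U ∧ p ∈ U ∧ ∃ g : E → G,
      ContDiffOn ℝ ∞ g U ∧ Function.Surjective (fderiv ℝ g p) ∧ M ∩ U = {x ∈ U | g x = 0}) :
    IsSubmanifold c M := by
  intro p hp
  obtain ⟨U, hU, hpU, g, hg, hs, hM⟩ := h p hp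
  let e : G ≃L[ℝ] (Fin c → ℝ) := ContinuousLinearEquiv.ofFinrankEq (by simp [hc])
  refine ⟨U, hU, hpU, fun x => e (g x), e.contDiff.comp_contDiffOn hg, ?_, ?_⟩
  · have h1 : HasFDerivAt (fun x => e (g x)) ((e : G →L[ℝ] (Fin c → ℝ)).comp (fderiv ℝ g p)) p :=
      e.hasFDerivAt.comp p
        (((hg p hpU).contDiffAt (hU.mem_nhds hpU)).differentiableAt (by simp)).hasFDerivAt
    rw [h1.fderiv]
    exact e.surjective.comp hs
  · simpa using hM

/-! ### Exterior derivatives -/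

/-- The second derivative of f enters symmetrically in v and w and cancels. -/
lemma dForm_pullback {f : E → F} {α : OneForm F} {p : E} (hf : ContDiffAt ℝ ∞ f p)
    (hα : DifferentiableAt ℝ α (f p)) (v w : E) :
    dForm (pullback f α) p v w = dForm α (f p) (fderiv ℝ f p v) (fderiv ℝ f p w) := by
  have hfd : DifferentiableAt ℝ f p := hf.differentiableAt (by simp)
  have hD : DifferentiableAt ℝ (fderiv ℝ f) p :=
    (hf.fderiv_right (m := ∞) (by simp)).differentiableAt (by simp)
  have hsymm := (hf.isSymmSndFDerivAt minSmoothness_two_le).eq v w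
  have hcomp : HasFDerivAt (fun x => α (f x)) ((fderiv ℝ α (f p)).comp (fderiv ℝ f p)) p :=
    hα.hasFDerivAt.comp p hfd.hasFDerivAt
  have h : HasFDerivAt (pullback f α) _ p := hcomp.clm_comp hD.hasFDerivAt
  simp only [dForm, h.fderiv]
  simp [hsymm]

lemma dForm_congr {α β : OneForm E} {p : E} (h : α =ᶠ[𝓝 p] β) (v w : E) :
    dForm α p v w = dForm β p v w := by
  simp only [dForm, h.fderiv_eq]

lemma dForm_smul {h : E → ℝ} {α : OneForm E} {p : E} (hh : DifferentiableAt ℝ h p)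
    (hα : DifferentiableAt ℝ α p) (v w : E) :
    dForm (fun x => h x • α x) p v w =
      h p * dForm α p v w + (fderiv ℝ h p v * α p w - fderiv ℝ h p w * α p v) := by
  have h1 : HasFDerivAt (fun x => h x • α x) _ p := hh.hasFDerivAt.smul hα.hasFDerivAt
  simp only [dForm, h1.fderiv]
  simp
  ring

lemma dForm_add {α β : OneForm E} {p : E} (hα : DifferentiableAt ℝ α p)
    (hβ : DifferentiableAt ℝ β p) (v w : E) :
    dForm (fun x => α x + β x) p v w = dForm α p v w + dForm β p v w := by
  have h1 : HasFDerivAt (fun x => α x + β x) _ p := hα.hasFDerivAt.add hβ.hasFDerivAt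
  simp only [dForm, h1.fderiv]
  simp
  ring

lemma dForm_const_smul {c : ℝ} {α : OneForm E} {p : E} (hα : DifferentiableAt ℝ α p) (v w : E) :
    dForm (fun x => c • α x) p v w = c * dForm α p v w := by
  have := dForm_smul (h := fun _ => c) (differentiableAt_const _) hα v w
  simpa using this

/-- On tangent vectors of `M`, the exterior derivative depends only on the restriction of the form
to `M`. -/
lemma IsLocalRetraction.dForm_eq {M : Set E} {p : E} {r : E → E} (hr : IsLocalRetraction M p r)
    (hp : p ∈ M) {α β : OneForm E} (hα : DifferentiableAt ℝ α p) (hβ : DifferentiableAt ℝ β p)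
    (h : ∀ᶠ x in 𝓝[M] p, ∀ v ∈ tangentAt M x, α x v = β x v) {v w : E}
    (hv : v ∈ tangentAt M p) (hw : w ∈ tangentAt M p) : dForm α p v w = dForm β p v w := by
  have hrp := hr.apply hp
  -- On tangent vectors dα agrees with d(r^*α), and r^*α only involves the restriction of α to M
  -- because r has values in M.
  have h1 : pullback r α =ᶠ[𝓝 p] pullback r β := by
    have hc : Tendsto r (𝓝 p) (𝓝[M] p) := by
      refine tendsto_nhdsWithin_iff.2 ⟨?_, hr.mem⟩
      have := hr.contDiffAt.continuousAt.tendsto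
      rwa [hrp] at this
    filter_upwards [hr.smooth, hr.mem.eventually_nhds, hc.eventually h] with x h2 h3 h4
    ext v
    simp only [pullback, ContinuousLinearMap.comp_apply]
    exact h4 _ (fderiv_mem_tangentAt_of_eventually_mem h2 h3 v)
  have h2 := dForm_congr h1 v w
  rw [dForm_pullback hr.contDiffAt (by rwa [hrp]), dForm_pullback hr.contDiffAt (by rwa [hrp]),
    hr.fderiv_eq_self hp hv, hr.fderiv_eq_self hp hw, hrp] at h2
  exact h2

/-- The exterior derivative of a form that is proportional to `α` on `M`. -/
lemma IsLocalRetraction.dForm_of_proportional {M : Set E} {p : E} {r : E → E}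
    (hr : IsLocalRetraction M p r) (hp : p ∈ M) {α β : OneForm E} (hα : DifferentiableAt ℝ α p)
    (hβ : DifferentiableAt ℝ β p) {h : E → ℝ}
    (hh : ∀ᶠ x in 𝓝[M] p, ∀ v ∈ tangentAt M x, β x v = h x * α x v) {e : E}
    (he : e ∈ tangentAt M p) (hαe : α p e ≠ 0) {v w : E} (hv : v ∈ tangentAt M p)
    (hw : w ∈ tangentAt M p) (hαv : α p v = 0) (hαw : α p w = 0) :
    dForm β p v w = h p * dForm α p v w := by
  have hDr : DifferentiableAt ℝ (fderiv ℝ r) p :=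
    (hr.contDiffAt.fderiv_right (m := ∞) (by simp)).differentiableAt (by simp)
  have hDe : DifferentiableAt ℝ (fun x => fderiv ℝ r x e) p :=
    hDr.clm_apply (differentiableAt_const e)
  have hre : fderiv ℝ r p e = e := hr.fderiv_eq_self hp he
  -- The factor h is given pointwise and need not be regular. Its values on M are recovered by the
  -- quotient k of the two forms on the tangent field Dr(x)e, which is differentiable at p.
  let k : E → ℝ := fun x => β x (fderiv ℝ r x e) / α x (fderiv ℝ r x e)
  have hne : α p (fderiv ℝ r p e) ≠ 0 := by rwa [hre]
  have hk : DifferentiableAt ℝ k p := by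
    have h1 := hβ.clm_apply hDe
    have h2 := hα.clm_apply hDe
    simp only [k, div_eq_mul_inv]
    exact h1.mul (h2.fun_inv hne)
  have hev : ∀ᶠ x in 𝓝[M] p, ∀ v ∈ tangentAt M x, β x v = (k x • α x) v := by
    have h1 : ∀ᶠ x in 𝓝 p, α x (fderiv ℝ r x e) ≠ 0 :=
      (hα.clm_apply hDe).continuousAt.eventually_ne hne
    filter_upwards [hh, h1.filter_mono nhdsWithin_le_nhds,
      hr.eventually.filter_mono nhdsWithin_le_nhds, self_mem_nhdsWithin] with x h2 h3 h4 h5 v hv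
    simp only [k, h2 v hv, h2 _ (h4.fderiv_mem h5 e), smul_apply, smul_eq_mul]
    field_simp
  have hkp : k p = h p := by
    have := hh.self_of_nhdsWithin hp e he
    simp only [k, hre, this]
    field_simp
  rw [hr.dForm_eq (β := fun x => k x • α x) hp hβ (hk.smul hα) hev hv hw]
  have := dForm_smul hk hα v w
  rw [this, hαv, hαw, hkp]
  ring

end Submanifolds

section Contactomorphisms

variable {E F G : Type*} [NormedAddCommGroup E] [NormedSpace ℝ E]
  [NormedAddCommGroup F] [NormedSpace ℝ F] [NormedAddCommGroup G] [NormedSpace ℝ G]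

/-! ### Contactomorphisms -/

lemma fderiv_comp_apply {f : E → F} {g : F → G} {p : E} (hg : DifferentiableAt ℝ g (f p))
    (hf : DifferentiableAt ℝ f p) (v : E) :
    fderiv ℝ (g ∘ f) p v = fderiv ℝ g (f p) (fderiv ℝ f p v) := by
  rw [fderiv_comp p hg hf]; rfl

lemma fderiv_leftInvOn {M : Set E} {φ : E → F} {ψ : F → E} {p v : E}
    (hψ : DifferentiableAt ℝ ψ (φ p)) (hφ : DifferentiableAt ℝ φ p) (h : LeftInvOn ψ φ M)
    (hp : p ∈ M) (hv : v ∈ tangentAt M p) : fderiv ℝ ψ (φ p) (fderiv ℝ φ p v) = v := by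
  rw [← fderiv_comp_apply hψ hφ]
  have := fderiv_eq_of_eqOn (g := id) (hψ.comp p hφ) differentiableAt_id (fun x hx => h hx) hp hv
  simpa using this

lemma pullback_comp_apply {f : E → F} {g : F → G} {α : OneForm G} {p : E}
    (hg : DifferentiableAt ℝ g (f p)) (hf : DifferentiableAt ℝ f p) (v : E) :
    pullback (g ∘ f) α p v = pullback g α (f p) (fderiv ℝ f p v) := by
  simp only [pullback, ContinuousLinearMap.comp_apply, fderiv_comp_apply hg hf,
    Function.comp_apply]

lemma pullback_apply (f : E → F) (α : OneForm F) (p v : E) :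
    pullback f α p v = α (f p) (fderiv ℝ f p v) := rfl

lemma IsDiffeo.trans {M : Set E} {N : Set F} {K : Set G} {φ : E → F} {χ : F → G}
    (hφ : IsDiffeo φ M N) (hχ : IsDiffeo χ N K) : IsDiffeo (χ ∘ φ) M K := by
  obtain ⟨h1, h2, ψ, h3, h4, h5⟩ := hφ
  obtain ⟨k1, k2, ξ, k3, k4, k5⟩ := hχ
  refine ⟨k1.comp h1 h2, k2.comp h2, ψ ∘ ξ, h3.comp k3 k4, h4.comp k4, ?_⟩
  exact InvOn.comp h5 k5 h2 k4

lemma IsContactomorphism.trans {M : Set E} {N : Set F} {K : Set G} {φ : E → F} {χ : F → G}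
    {α : OneForm E} {β : OneForm F} {γ : OneForm G} (hφ : IsContactomorphism φ M α N β)
    (hχ : IsContactomorphism χ N β K γ) : IsContactomorphism (χ ∘ φ) M α K γ := by
  refine ⟨hφ.1.trans hχ.1, fun p hp => ?_⟩
  obtain ⟨c, hc, h1⟩ := hφ.2 p hp
  obtain ⟨d, hd, h2⟩ := hχ.2 (φ p) (hφ.1.2.1 hp)
  refine ⟨d * c, mul_pos hd hc, fun v hv => ?_⟩
  rw [pullback_comp_apply (hχ.1.1.differentiableAt (hφ.1.2.1 hp)) (hφ.1.1.differentiableAt hp),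
    h2 _ (fderiv_mem_tangentAt (hφ.1.1.contDiffAt hp) hφ.1.2.1 hv), mul_assoc, ← h1 v hv,
    pullback_apply]

lemma IsContactomorphism.symm {M : Set E} {N : Set F} {φ : E → F} {ψ : F → E}
    {α : OneForm E} {β : OneForm F} (hφ : IsContactomorphism φ M α N β) (hψ : SmoothNear N ψ)
    (hψN : MapsTo ψ N M) (hinv : InvOn ψ φ M N) : IsContactomorphism ψ N β M α := by
  refine ⟨⟨hψ, hψN, φ, hφ.1.1, hφ.1.2.1, hinv.symm⟩, fun q hq => ?_⟩
  obtain ⟨c, hc, h1⟩ := hφ.2 (ψ q) (hψN hq)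
  refine ⟨c⁻¹, inv_pos.2 hc, fun v hv => ?_⟩
  have h2 := h1 _ (fderiv_mem_tangentAt (hψ.contDiffAt hq) hψN hv)
  rw [pullback_apply, fderiv_leftInvOn (hφ.1.1.differentiableAt (hψN hq))
    (hψ.differentiableAt hq) hinv.2 hq hv, hinv.2 hq] at h2
  rw [pullback_apply, h2]
  field_simp

lemma IsContactomorphism.exists_symm {M : Set E} {N : Set F} {φ : E → F}
    {α : OneForm E} {β : OneForm F} (hφ : IsContactomorphism φ M α N β) :
    ∃ ψ, IsContactomorphism ψ N β M α := by
  obtain ⟨ψ, h1, h2, h3⟩ := hφ.1.2.2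
  exact ⟨ψ, hφ.symm h1 h2 h3⟩

/-- The image of a contact form under a contactomorphism is a contact form. -/
lemma IsContactForm.of_contactomorphism {M : Set E} {N : Set F} {φ : E → F}
    {α : OneForm E} {β : OneForm F} (hα : IsContactForm M α)
    (hM : ∀ p ∈ M, ∃ r, IsLocalRetraction M p r)
    (hφ : IsContactomorphism φ M α N β) (hβ : SmoothNear N β) : IsContactForm N β := by
  obtain ⟨ψ, hψ, hψN, hinv⟩ := hφ.1.2.2
  refine ⟨hβ, fun q hq => ?_⟩
  have hp : ψ q ∈ M := hψN hq
  have hφψ : φ (ψ q) = q := hinv.2 hq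
  obtain ⟨c, hc, h1⟩ := hφ.2 (ψ q) hp
  obtain ⟨⟨e, he, hαe⟩, hnd⟩ := hα.2 (ψ q) hp
  have hφs := hφ.1.1.contDiffAt hp
  have hT : ∀ v ∈ tangentAt M (ψ q), fderiv ℝ φ (ψ q) v ∈ tangentAt N q := fun v hv => by
    have := fderiv_mem_tangentAt hφs hφ.1.2.1 hv
    rwa [hφψ] at this
  refine ⟨⟨_, hT e he, ?_⟩, fun v hv hβv hw => ?_⟩
  · have := h1 e he
    rw [pullback_apply, hφψ] at this
    rw [this]
    exact mul_ne_zero hc.ne' hαe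
  · set u := fderiv ℝ ψ q v with hu
    have huT : u ∈ tangentAt M (ψ q) := fderiv_mem_tangentAt (hψ.contDiffAt hq) hψN hv
    have huv : fderiv ℝ φ (ψ q) u = v :=
      fderiv_leftInvOn (hφ.1.1.differentiableAt hp) (hψ.differentiableAt hq) hinv.2 hq hv
    have hαu : α (ψ q) u = 0 := by
      have := h1 u huT
      rw [pullback_apply, hφψ, huv, hβv] at this
      exact (mul_eq_zero.1 this.symm).resolve_left hc.ne'
    have hu0 : u = 0 := by
      refine hnd u huT hαu fun w hwT hαw => ?_
      obtain ⟨r, hr⟩ := hM _ hp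
      -- The conformal factors are chosen point by point; `dForm_of_proportional` asks for no
      -- regularity of the resulting function.
      choose! k hk hk' using hφ.2
      have hpb : SmoothNear M (pullback φ β) := hφ.1.1.pullback hφ.1.2.1 hβ
      have h2 := hr.dForm_of_proportional hp (hα.1.differentiableAt hp)
        (hpb.differentiableAt hp) (h := k)
        (eventually_nhdsWithin_of_forall fun x hx v hv => hk' x hx v hv) he hαe huT hwT hαu hαw
      rw [dForm_pullback hφs (by rw [hφψ]; exact hβ.differentiableAt hq), huv, hφψ,
        hw _ (hT w hwT)] at h2
      · exact (mul_eq_zero.1 h2.symm).resolve_left (hk _ hp).ne'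
      · have := h1 w hwT
        rw [pullback_apply, hφψ] at this
        rw [this, hαw, mul_zero]
    rw [← huv, hu0, map_zero]

/-- Isotopies can be transported by diffeomorphisms. -/
lemma AreIsotopic.conj {M : Set E} {N : Set F} {α α' : OneForm E} {β β' : OneForm F}
    (h : AreIsotopic M α α') {φ : E → F} {ψ : F → E} (hψ : SmoothNear N ψ) (hψN : MapsTo ψ N M)
    (hinv : InvOn ψ φ M N) (hφ : IsContactomorphism φ M α N β)
    (hφ' : IsContactomorphism φ M α' N β') : AreIsotopic N β β' := by
  obtain ⟨Φ, h1, h2, h3, h4⟩ := h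
  have hψd : IsDiffeo ψ N M := (hφ.symm hψ hψN hinv).1
  refine ⟨fun t => φ ∘ Φ t ∘ ψ, ?_, fun t ht => (hψd.trans (h2 t ht)).trans hφ.1,
    fun p hp => ?_, ((hφ.symm hψ hψN hinv).trans h4).trans hφ'⟩
  · have hmap : MapsTo (fun q : ℝ × F => (q.1, ψ q.2)) (Icc 0 1 ×ˢ N) (Icc 0 1 ×ˢ M) :=
      fun q hq => ⟨hq.1, hψN hq.2⟩
    have hs : SmoothNear (Icc (0 : ℝ) 1 ×ˢ N) (fun q : ℝ × F => (q.1, ψ q.2)) := by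
      refine SmoothNear.map₂ (B := fun q : ℝ × E => q) contDiff_id
        (smoothNear_of_contDiff contDiff_fst _) ?_
      exact hψ.comp (smoothNear_of_contDiff contDiff_snd _) fun q hq => hq.2
    exact hφ.1.1.comp (h1.comp hs hmap)
      (fun q hq => (h2 q.1 hq.1).2.1 (hψN hq.2))
  · simp only [Function.comp_apply, h3 _ (hψN hp)]
    exact hinv.2 hp

end Contactomorphisms

/-! ### Gray stability -/

section LinearAlgebra

variable {E : Type*} [NormedAddCommGroup E] [NormedSpace ℝ E] [FiniteDimensional ℝ E]

/-- The bilinear form `σ + a ⊗ a` on the range of the projection `P`, extended by a scalar product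
on its kernel. -/
def gaugedForm (P : E →L[ℝ] E) (a : E →L[ℝ] ℝ) (σ : E →L[ℝ] E →L[ℝ] ℝ) : E →L[ℝ] E →L[ℝ] ℝ :=
  σ.bilinearComp P P + (a.comp P).smulRight (a.comp P) +
    (isBoundedBilinearMap_inner (𝕜 := ℝ)
        (E := EuclideanSpace ℝ (Fin (Module.finrank ℝ E)))).toContinuousLinearMap.bilinearComp
      ((toEuclidean : E ≃L[ℝ] _).toContinuousLinearMap.comp (ContinuousLinearMap.id ℝ E - P))
      ((toEuclidean : E ≃L[ℝ] _).toContinuousLinearMap.comp (ContinuousLinearMap.id ℝ E - P))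

lemma gaugedForm_apply (P : E →L[ℝ] E) (a : E →L[ℝ] ℝ) (σ : E →L[ℝ] E →L[ℝ] ℝ) (v w : E) :
    gaugedForm P a σ v w = σ (P v) (P w) + a (P v) * a (P w) +
      inner ℝ (toEuclidean (v - P v)) (toEuclidean (w - P w)) := by
  simp [gaugedForm, inner_sub_left]

variable {P : E →L[ℝ] E} {a : E →L[ℝ] ℝ} {σ : E →L[ℝ] E →L[ℝ] ℝ}

/-- Testing on v - P v isolates the scalar product and forces v into the range of P. The gauge term
turns an equation on a varying subspace into one for an operator on the fixed space E. -/
lemma gaugedForm_solution (hP : ∀ v, P (P v) = P v) {ℓ : E →L[ℝ] ℝ} {v : E}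
    (hv : gaugedForm P a σ v = ℓ.comp P) :
    P v = v ∧ ∀ w, P w = w → σ v w + a v * a w = ℓ w := by
  have h1 := DFunLike.congr_fun hv (v - P v)
  rw [gaugedForm_apply] at h1
  simp only [ContinuousLinearMap.comp_apply, map_sub P, hP, sub_self, map_zero, mul_zero,
    sub_zero, zero_add, add_zero] at h1
  have h2 : v - P v = 0 := by
    exact (toEuclidean (E := E)).map_eq_zero_iff.1 (inner_self_eq_zero.1 h1)
  have h3 : P v = v := (sub_eq_zero.1 h2).symm
  refine ⟨h3, fun w hw => ?_⟩
  have h4 := DFunLike.congr_fun hv w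
  rw [gaugedForm_apply] at h4
  simpa [h3, hw] using h4

/-- Pairing a null vector v with itself kills σ and leaves a(v)² = 0. Then v lies in ker a, where σ
is nondegenerate. Equality of dimensions turns injectivity into invertibility. -/
lemma gaugedForm_isInvertible (hP : ∀ v, P (P v) = P v) (hσ : ∀ v, σ v v = 0)
    (hnd : ∀ v, P v = v → a v = 0 → (∀ w, P w = w → a w = 0 → σ v w = 0) → v = 0) :
    (gaugedForm P a σ).IsInvertible := by
  have hinj : Function.Injective (gaugedForm P a σ) := by
    rw [injective_iff_map_eq_zero]
    intro v hv
    obtain ⟨h1, h2⟩ := gaugedForm_solution (ℓ := 0) hP (hv.trans (by simp))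
    have h3 : a v = 0 := by
      have := h2 v h1
      simpa [hσ] using this
    refine hnd v h1 h3 fun w hw _ => ?_
    have := h2 w hw
    simpa [h3] using this
  have hfin : Module.finrank ℝ E = Module.finrank ℝ (E →L[ℝ] ℝ) := by
    rw [← (LinearMap.toContinuousLinearMap (𝕜 := ℝ) (E := E) (F' := ℝ)).finrank_eq]
    exact Subspace.dual_finrank_eq.symm
  let e := LinearEquiv.ofInjectiveOfFinrankEq (gaugedForm P a σ : E →ₗ[ℝ] E →L[ℝ] ℝ) hinj hfin
  refine ⟨e.toContinuousLinearEquiv, ?_⟩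
  ext v w
  rfl

/-- R is the Reeb vector. Pairing its equation with R gives a(R)² = a(R), and a(R) = 0 would force R
= 0 by nondegeneracy, contradicting the equation at e. -/
lemma gaugedForm_reeb (hP : ∀ v, P (P v) = P v) (hσ : ∀ v, σ v v = 0)
    (hnd : ∀ v, P v = v → a v = 0 → (∀ w, P w = w → a w = 0 → σ v w = 0) → v = 0)
    (he : ∃ e, P e = e ∧ a e ≠ 0) {R : E}
    (hR : gaugedForm P a σ R = a.comp P) :
    P R = R ∧ a R = 1 ∧ ∀ w, P w = w → σ R w = 0 := by
  obtain ⟨h1, h2⟩ := gaugedForm_solution hP hR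
  have h3 : a R * a R = a R := by simpa [hσ] using h2 R h1
  have h4 : a R = 1 := by
    by_contra hne
    have h0 : a R = 0 := by
      rcases mul_eq_zero.1 (show a R * (a R - 1) = 0 by linarith) with h | h
      · exact h
      · exact absurd (by linarith) hne
    have hR0 : R = 0 := hnd R h1 h0 fun w hw haw => by
      have := h2 w hw
      simpa [h0, haw] using this
    obtain ⟨e, hPe, hae⟩ := he
    have := h2 e hPe
    rw [hR0] at this
    simp at this
    exact hae this.symm
  refine ⟨h1, h4, fun w hw => ?_⟩
  have := h2 w hw
  rw [h4] at this
  linarith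

end LinearAlgebra

section Gray

variable {E : Type*} [NormedAddCommGroup E] [NormedSpace ℝ E]

/-- The exterior derivative in the space directions of a family of one-forms. -/
def spaceD (𝒜 : ℝ × E → E →L[ℝ] ℝ) (q : ℝ × E) : E →L[ℝ] E →L[ℝ] ℝ :=
  (fderiv ℝ 𝒜 q).comp (ContinuousLinearMap.inr ℝ ℝ E) -
    ((fderiv ℝ 𝒜 q).comp (ContinuousLinearMap.inr ℝ ℝ E)).flip

lemma spaceD_apply (𝒜 : ℝ × E → E →L[ℝ] ℝ) (q : ℝ × E) (v w : E) :
    spaceD 𝒜 q v w = fderiv ℝ 𝒜 q (0, v) w - fderiv ℝ 𝒜 q (0, w) v := by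
  simp [spaceD]

lemma fderiv_slice {F : Type*} [NormedAddCommGroup F] [NormedSpace ℝ F] {f : ℝ × E → F} {t : ℝ}
    {x : E} (hf : DifferentiableAt ℝ f (t, x)) (v : E) :
    fderiv ℝ (fun y => f (t, y)) x v = fderiv ℝ f (t, x) (0, v) := by
  have h := hf.hasFDerivAt.comp x ((hasFDerivAt_const t x).prodMk (hasFDerivAt_id x))
  have h2 : HasFDerivAt (fun y => f (t, y)) _ x := h
  rw [h2.fderiv]
  simp

lemma dForm_slice {𝒜 : ℝ × E → E →L[ℝ] ℝ} {t : ℝ} {x : E}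
    (h : DifferentiableAt ℝ 𝒜 (t, x)) (v w : E) :
    dForm (fun y => 𝒜 (t, y)) x v w = spaceD 𝒜 (t, x) v w := by
  rw [dForm, spaceD_apply, fderiv_slice h, fderiv_slice h]

/-- The pairs of a vector `X` that solves the equation of Gray's stability theorem, and a tangent
vector `R` on which the contact form is `1`. -/
def graySet (M : Set E) (𝒜 : ℝ × E → E →L[ℝ] ℝ) (q : ℝ × E) : Set (E × E) :=
  {z | z.1 ∈ tangentAt M q.2 ∧ z.2 ∈ tangentAt M q.2 ∧ 𝒜 q z.1 = 0 ∧ 𝒜 q z.2 = 1 ∧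
    ∀ w ∈ tangentAt M q.2, 𝒜 q w = 0 →
      spaceD 𝒜 q z.1 w = - fderiv ℝ 𝒜 q (1, 0) w}

/-- All conditions are affine in the pair (X, R), which permits gluing local solutions by a
partition of unity. For this it suffices that R has value 1; it need not be the Reeb vector. -/
lemma convex_graySet {M : Set E} {𝒜 : ℝ × E → E →L[ℝ] ℝ} {q : ℝ × E} (hq : q.2 ∈ M)
    {r : E → E} (hr : IsLocalRetraction M q.2 r) : Convex ℝ (graySet M 𝒜 q) := by
  rintro ⟨X, R⟩ ⟨h1, h2, h3, h4, h5⟩ ⟨X', R'⟩ ⟨k1, k2, k3, k4, k5⟩ s t hs ht hst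
  rw [hr.mem_tangentAt_iff hq] at h1 h2 k1 k2
  refine ⟨(hr.mem_tangentAt_iff hq).2 ?_, (hr.mem_tangentAt_iff hq).2 ?_, ?_, ?_,
    fun w hw hw0 => ?_⟩
  · change fderiv ℝ r q.2 (s • X + t • X') = s • X + t • X'
    simp only at h1 k1
    simp [h1, k1]
  · change fderiv ℝ r q.2 (s • R + t • R') = s • R + t • R'
    simp only at h2 k2
    simp [h2, k2]
  · change 𝒜 q (s • X + t • X') = 0
    simp only at h3 k3
    simp [h3, k3]
  · change 𝒜 q (s • R + t • R') = 1
    simp only at h4 k4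
    simp [h4, k4, hst]
  · change spaceD 𝒜 q (s • X + t • X') w = _
    have h6 := h5 w hw hw0
    have k6 := k5 w hw hw0
    simp only at h6 k6
    simp only [map_add, map_smul, add_apply, smul_apply, h6, k6, smul_eq_mul]
    linear_combination (-(fderiv ℝ 𝒜 q (1, 0)) w) * hst

/-- With P = Dr, invertibility of the gauged form at q₀ persists nearby and its inverse varies
smoothly. If Z solves the gauged equation with right-hand side -∂_t 𝒜, then Z - 𝒜(Z)R lies in the
contact hyperplane. It still solves Gray's equation, because the Reeb vector R pairs to zero with
tangent vectors. -/
lemma exists_local_graySet [FiniteDimensional ℝ E] {M : Set E} {𝒜 : ℝ × E → E →L[ℝ] ℝ}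
    (h𝒜 : SmoothNear (Icc (0 : ℝ) 1 ×ˢ M) 𝒜)
    (hc : ∀ t ∈ Icc (0 : ℝ) 1, IsContactForm M fun x => 𝒜 (t, x)) {q₀ : ℝ × E}
    (ht₀ : q₀.1 ∈ Icc (0 : ℝ) 1) (hq₀ : q₀.2 ∈ M) {r : E → E} (hr : IsLocalRetraction M q₀.2 r) :
    ∃ U ∈ 𝓝 q₀, ∃ g : ℝ × E → E × E, ContDiffOn ℝ ∞ g U ∧
      ∀ q ∈ U, q.1 ∈ Icc (0 : ℝ) 1 → q.2 ∈ M → g q ∈ graySet M 𝒜 q := by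
  have : CompleteSpace E := FiniteDimensional.complete ℝ E
  let P : ℝ × E → E →L[ℝ] E := fun q => fderiv ℝ r q.2
  let b : ℝ × E → E →L[ℝ] E →L[ℝ] ℝ := fun q => gaugedForm (P q) (𝒜 q) (spaceD 𝒜 q)
  have hgood : ∀ᶠ q in 𝓝 q₀, ContDiffAt ℝ ∞ 𝒜 q ∧ IsLocalRetraction M q.2 r :=
    (smoothNear_iff.1 h𝒜 q₀ ⟨ht₀, hq₀⟩).and
      (continuousAt_snd.eventually hr.eventually)
  obtain ⟨V, hV, hVo, hqV⟩ := eventually_nhds_iff.1 hgood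
  have h𝒜V : ContDiffOn ℝ ∞ 𝒜 V := fun q hq => (hV q hq).1.contDiffWithinAt
  have hPV : ContDiffOn ℝ ∞ P V := fun q hq =>
    (((hV q hq).2.contDiffAt.fderiv_right (m := ∞) (by simp)).comp q
      contDiffAt_snd).contDiffWithinAt
  have hDV : ContDiffOn ℝ ∞ (fderiv ℝ 𝒜) V := fun q hq =>
    ((hV q hq).1.fderiv_right (m := ∞) (by simp)).contDiffWithinAt
  have hbV : ContDiffOn ℝ ∞ b V := by
    rw [contDiffOn_clm_apply]
    intro v
    rw [contDiffOn_clm_apply]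
    intro w
    simp only [b, gaugedForm_apply, spaceD_apply]
    have hPv : ∀ v, ContDiffOn ℝ ∞ (fun q => P q v) V := fun v => hPV.clm_apply contDiffOn_const
    have hd : ∀ v w, ContDiffOn ℝ ∞ (fun q => fderiv ℝ 𝒜 q (0, P q v) (P q w)) V := fun v w =>
      (hDV.clm_apply (contDiffOn_const.prodMk (hPv v))).clm_apply (hPv w)
    have ha : ∀ v, ContDiffOn ℝ ∞ (fun q => 𝒜 q (P q v)) V := fun v => h𝒜V.clm_apply (hPv v)
    have he : ∀ v, ContDiffOn ℝ ∞ (fun q => toEuclidean (v - P q v)) V := fun v =>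
      (toEuclidean (E := E)).contDiff.comp_contDiffOn (contDiffOn_const.sub (hPv v))
    exact (((hd v w).sub (hd w v)).add ((ha v).mul (ha w))).add ((he v).inner ℝ (he w))
  have hlin : ∀ q ∈ V, q.1 ∈ Icc (0 : ℝ) 1 → q.2 ∈ M →
      (∀ v, P q (P q v) = P q v) ∧ (∀ v, spaceD 𝒜 q v v = 0) ∧
      (∀ v, P q v = v → 𝒜 q v = 0 → (∀ w, P q w = w → 𝒜 q w = 0 → spaceD 𝒜 q v w = 0) → v = 0) ∧
      (∃ e, P q e = e ∧ 𝒜 q e ≠ 0) := by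
    rintro ⟨t, x⟩ hq ht hx
    have hrx : IsLocalRetraction M x r := (hV _ hq).2
    have hd : DifferentiableAt ℝ 𝒜 (t, x) := (hV _ hq).1.differentiableAt (by simp)
    have hT : ∀ v, P (t, x) v = v ↔ v ∈ tangentAt M x := fun v =>
      (hrx.mem_tangentAt_iff hx).symm
    obtain ⟨⟨e, he, hae⟩, hnd⟩ := (hc t ht).2 x hx
    refine ⟨fun v => (hT _).2 (hrx.fderiv_mem hx v), fun v => by rw [spaceD_apply, sub_self],
      fun v hv hav hw => hnd v ((hT v).1 hv) hav fun w hw' haw => ?_, e, (hT e).2 he, hae⟩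
    rw [dForm_slice hd]
    exact hw w ((hT w).2 hw') haw
  have hb₀ : (b q₀).IsInvertible := by
    obtain ⟨h1, h2, h3, -⟩ := hlin q₀ hqV ht₀ hq₀
    exact gaugedForm_isInvertible h1 h2 h3
  have hinv : ∀ᶠ q in 𝓝 q₀, (b q).IsInvertible := by
    obtain ⟨e, he⟩ := hb₀
    have hbc : ContinuousAt b q₀ := (hbV.continuousOn).continuousAt (hVo.mem_nhds hqV)
    have := hbc.eventually (he ▸ ContinuousLinearEquiv.nhds e)
    filter_upwards [this] with q hq
    exact hq
  have hU : V ∩ {q | (b q).IsInvertible} ∈ 𝓝 q₀ := inter_mem (hVo.mem_nhds hqV) hinv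
  let R : ℝ × E → E := fun q => (b q).inverse ((𝒜 q).comp (P q))
  let Z : ℝ × E → E := fun q => (b q).inverse ((-(fderiv ℝ 𝒜 q (1, 0))).comp (P q))
  refine ⟨_, hU, fun q => (Z q - 𝒜 q (Z q) • R q, R q), ?_, ?_⟩
  · have hbinv : ContDiffOn ℝ ∞ (fun q => (b q).inverse) (V ∩ {q | (b q).IsInvertible}) :=
      fun q hq => (hq.2.contDiffAt_map_inverse.comp_contDiffWithinAt q
        ((hbV q hq.1).mono inter_subset_left))
    have h𝒜' := h𝒜V.mono (inter_subset_left (t := {q | (b q).IsInvertible}))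
    have hP' := hPV.mono (inter_subset_left (t := {q | (b q).IsInvertible}))
    have hD' := hDV.mono (inter_subset_left (t := {q | (b q).IsInvertible}))
    have hR : ContDiffOn ℝ ∞ R (V ∩ {q | (b q).IsInvertible}) :=
      hbinv.clm_apply (h𝒜'.clm_comp hP')
    have hZ : ContDiffOn ℝ ∞ Z (V ∩ {q | (b q).IsInvertible}) :=
      hbinv.clm_apply ((hD'.clm_apply contDiffOn_const).neg.clm_comp hP')
    exact (hZ.sub ((h𝒜'.clm_apply hZ).smul hR)).prodMk hR
  · rintro q ⟨hqV', hqi⟩ ht hx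
    obtain ⟨h1, h2, h3, h4⟩ := hlin q hqV' ht hx
    have hT : ∀ v, P q v = v ↔ v ∈ tangentAt M q.2 := fun v =>
      ((hV q hqV').2.mem_tangentAt_iff hx).symm
    obtain ⟨k1, k2, k3⟩ := gaugedForm_reeb h1 h2 h3 h4 (R := R q) (hqi.self_apply_inverse _)
    obtain ⟨m1, m2⟩ := gaugedForm_solution h1 (v := Z q) (hqi.self_apply_inverse _)
    refine ⟨(hT _).1 ?_, (hT _).1 k1, ?_, k2, fun w hw hw0 => ?_⟩
    · rw [map_sub, map_smul, m1, k1]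
    · simp [k2]
    · have := m2 w ((hT w).2 hw)
      rw [hw0, mul_zero, add_zero] at this
      simp [this, k3 w ((hT w).2 hw)]

end Gray

section Gray

variable {E : Type*} [NormedAddCommGroup E] [NormedSpace ℝ E]

/-- A curve whose velocity is given by a vector field tangent to the closed submanifold `M` stays
in `M`. -/
lemma mem_of_tangent {M : Set E} (hM : IsClosed M) (hret : ∀ p ∈ M, ∃ r, IsLocalRetraction M p r)
    {Z : ℝ × E → E} (hZ : ContDiff ℝ ∞ Z) {a b : ℝ}
    (hT : ∀ s ∈ Icc a b, ∀ x ∈ M, Z (s, x) ∈ tangentAt M x) {c : ℝ → E}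
    (hc : ∀ s, HasDerivAt c (Z (s, c s)) s) (ha : c a ∈ M) : ∀ s ∈ Icc a b, c s ∈ M := by
  have hcc : Continuous c := continuous_iff_continuousAt.2 fun s => (hc s).continuousAt
  refine IsClosed.Icc_subset_of_forall_mem_nhdsWithin (s := c ⁻¹' M)
    ((hM.preimage hcc).inter isClosed_Icc) ha ?_
  rintro s₀ ⟨hs₀, hs₀ab⟩
  obtain ⟨r, hr⟩ := hret (c s₀) hs₀
  -- H is the normal part of Z: it vanishes on M and is locally Lipschitz. The distance vector u = c
  -- - r(c) has u' = H(s, c), hence |u'| ≤ K |u|, and u stays zero for a short time after s₀.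
  let H : ℝ × E → E := fun q => Z q - fderiv ℝ r q.2 (Z q)
  have hH : ContDiffAt ℝ ∞ H (s₀, c s₀) := by
    refine hZ.contDiffAt.sub (ContDiffAt.clm_apply ?_ hZ.contDiffAt)
    exact ContDiffAt.comp (g := fderiv ℝ r) (f := Prod.snd) (s₀, c s₀)
      (hr.contDiffAt.fderiv_right (by simp)) contDiffAt_snd
  obtain ⟨K, W, hW, hK⟩ := (hH.of_le (by exact_mod_cast le_top)).exists_lipschitzOnWith
  have hrc : Tendsto (fun s => r (c s)) (𝓝 s₀) (𝓝 (c s₀)) := by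
    have h := ContinuousAt.comp (g := r) hr.contDiffAt.continuousAt hcc.continuousAt
    have h' : Tendsto (fun s => r (c s)) (𝓝 s₀) (𝓝 (r (c s₀))) := h.tendsto
    rwa [hr.apply hs₀] at h'
  have hev : ∀ᶠ s in 𝓝 s₀, (s, c s) ∈ W ∧ (s, r (c s)) ∈ W ∧ r (c s) ∈ M ∧
      IsLocalRetraction M (c s) r ∧ IsLocalRetraction M (r (c s)) r ∧ s < b := by
    filter_upwards [(tendsto_id.prodMk_nhds hcc.continuousAt.tendsto).eventually hW,
      (tendsto_id.prodMk_nhds hrc).eventually hW, hcc.continuousAt.eventually hr.mem,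
      hcc.continuousAt.eventually hr.eventually, hrc.eventually hr.eventually,
      gt_mem_nhds hs₀ab.2] with s h1 h2 h3 h4 h5 h6 using ⟨h1, h2, h3, h4, h5, h6⟩
  obtain ⟨δ, hδ, hball⟩ := Metric.eventually_nhds_iff.1 hev
  have hgood : ∀ s ∈ Icc s₀ (s₀ + δ / 2), (s, c s) ∈ W ∧ (s, r (c s)) ∈ W ∧ r (c s) ∈ M ∧
      IsLocalRetraction M (c s) r ∧ IsLocalRetraction M (r (c s)) r ∧ s < b := fun s hs =>
    hball (by rw [Real.dist_eq, abs_of_nonneg (by linarith [hs.1])]; linarith [hs.2])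
  have hu : ∀ s ∈ Icc s₀ (s₀ + δ / 2),
      HasDerivAt (fun s => c s - r (c s)) (H (s, c s)) s := fun s hs => by
    exact (hc s).sub ((hgood s hs).2.2.2.1.differentiableAt.hasFDerivAt.comp_hasDerivAt s (hc s))
  have hzero := eq_zero_of_abs_deriv_le_mul_abs_self_of_eq_zero_right (K := K)
    (fun s hs => (hu s hs).continuousAt.continuousWithinAt)
    (fun s hs => (hu s (Ico_subset_Icc_self hs)).hasDerivWithinAt)
    (by simp [hr.apply hs₀]) (fun s hs => by
      obtain ⟨h1, h2, h3, -, h5, h6⟩ := hgood s (Ico_subset_Icc_self hs)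
      have h7 : H (s, r (c s)) = 0 := by
        have := h5.fderiv_eq_self h3 (hT s ⟨hs₀ab.1.trans hs.1, h6.le⟩ _ h3)
        simp [H, this]
      have h8 := hK.dist_le_mul _ h1 _ h2
      rw [h7, dist_zero_right] at h8
      refine h8.trans_eq ?_
      rw [Prod.dist_eq, dist_self, dist_eq_norm, max_eq_right (norm_nonneg _)])
  refine mem_of_superset (Ioo_mem_nhdsGT (show s₀ < s₀ + δ / 2 by linarith)) fun s hs => ?_
  have h1 := hzero s (Ioo_subset_Icc_self hs)
  have h2 : c s = r (c s) := sub_eq_zero.1 h1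
  change c s ∈ M
  rw [h2]
  exact (hgood s (Ioo_subset_Icc_self hs)).2.2.1

/-- No condition is imposed off the compact set [0, 1] × M, so the local solutions there can be
taken to be zero. The final cutoff, equal to 1 on this set, makes X compactly supported and thus
complete. -/
lemma exists_gray_field [FiniteDimensional ℝ E] {M : Set E} (hMc : IsCompact M)
    (hret : ∀ p ∈ M, ∃ r, IsLocalRetraction M p r) {𝒜 : ℝ × E → E →L[ℝ] ℝ}
    (h𝒜 : SmoothNear (Icc (0 : ℝ) 1 ×ˢ M) 𝒜)
    (hc : ∀ t ∈ Icc (0 : ℝ) 1, IsContactForm M fun x => 𝒜 (t, x)) :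
    ∃ X R : ℝ × E → E, ContDiff ℝ ∞ X ∧ HasCompactSupport X ∧ ContDiff ℝ ∞ R ∧
      ∀ q ∈ Icc (0 : ℝ) 1 ×ˢ M, (X q, R q) ∈ graySet M 𝒜 q := by
  classical
  have hMM : IsCompact (Icc (0 : ℝ) 1 ×ˢ M) := isCompact_Icc.prod hMc
  let S : ℝ × E → Set (E × E) := fun q =>
    if q ∈ Icc (0 : ℝ) 1 ×ˢ M then graySet M 𝒜 q else univ
  obtain ⟨g, hg⟩ : ∃ g : ContMDiffMap 𝓘(ℝ, ℝ × E) 𝓘(ℝ, E × E) (ℝ × E) (E × E) ∞,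
      ∀ q, g q ∈ S q := by
    refine exists_contMDiffMap_forall_mem_convex_of_local (n := ⊤) 𝓘(ℝ, ℝ × E) (fun q => ?_)
      fun q => ?_
    · by_cases h : q ∈ Icc (0 : ℝ) 1 ×ˢ M
      · simp only [S, if_pos h]
        obtain ⟨r, hr⟩ := hret q.2 h.2
        exact convex_graySet h.2 hr
      · simp only [S, if_neg h]
        exact convex_univ
    · by_cases h : q ∈ Icc (0 : ℝ) 1 ×ˢ M
      · obtain ⟨r, hr⟩ := hret q.2 h.2
        obtain ⟨U, hU, g, hg, hgU⟩ := exists_local_graySet h𝒜 hc h.1 h.2 hr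
        refine ⟨U, hU, g, contMDiffOn_iff_contDiffOn.2 hg, fun y hy => ?_⟩
        by_cases hy' : y ∈ Icc (0 : ℝ) 1 ×ˢ M
        · simp only [S, if_pos hy']
          exact hgU y hy hy'.1 hy'.2
        · simp only [S, if_neg hy', mem_univ]
      · refine ⟨_, hMM.isClosed.isOpen_compl.mem_nhds h, fun _ => 0, contMDiffOn_const,
          fun y hy => ?_⟩
        have hy' : y ∉ Icc (0 : ℝ) 1 ×ˢ M := hy
        simp only [S, if_neg hy', mem_univ]
  have hgs : ContDiff ℝ ∞ g := contMDiff_iff_contDiff.1 g.contMDiff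
  obtain ⟨C, hC⟩ := hMM.isBounded.exists_norm_le
  obtain ⟨ρ, hρ, hρc, -, -, hρ1⟩ := exists_lipschitz_cutoff (E := ℝ × E) C
  refine ⟨fun q => ρ q • (g q).1, fun q => (g q).2, hρ.smul (contDiff_fst.comp hgs),
    hρc.smul_right, contDiff_snd.comp hgs, fun q hq => ?_⟩
  have := hg q
  simp only [S, if_pos hq] at this
  simpa only [hρ1 q (hC q hq), one_smul] using this

end Gray

section Gray

variable {E : Type*} [NormedAddCommGroup E] [NormedSpace ℝ E]

lemma IsLocalRetraction.exists_submodule {M : Set E} {p : E} {r : E → E}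
    (h : IsLocalRetraction M p r) (hp : p ∈ M) :
    ∃ W : Submodule ℝ E, ∀ v, v ∈ tangentAt M p ↔ v ∈ W := by
  refine ⟨LinearMap.ker ((fderiv ℝ r p : E →ₗ[ℝ] E) - LinearMap.id), fun v => ?_⟩
  rw [h.mem_tangentAt_iff hp, LinearMap.mem_ker]
  simp [sub_eq_zero]

/-- The group property of a flow. -/
lemma IsFlow.group [FiniteDimensional ℝ E] {X : E → E} (hX : ContDiff ℝ ∞ X) {φ : ℝ → E → E}
    (hφ : IsFlow X φ) (s t : ℝ) (x : E) : φ s (φ t x) = φ (s + t) x := by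
  have hc : ∀ s, HasDerivAt (fun s => φ (s + t) x) (X (φ (s + t) x)) s := fun s => by
    exact (hφ.deriv (s + t) x).comp_add_const s t
  have := hφ.eq_of_integralCurve hX hc s
  simpa using this

/-- The suspension (1, X) makes a time-dependent field autonomous; its first coordinate is a clock.
-/
lemma IsFlow.fst_eq {X : ℝ × E → E} {Ψ : ℝ → ℝ × E → ℝ × E}
    (hΨ : IsFlow (fun q => ((1 : ℝ), X q)) Ψ) (s : ℝ) (q : ℝ × E) : (Ψ s q).1 = q.1 + s := by
  have h : ∀ s, HasDerivAt (fun s => (Ψ s q).1 - s) 0 s := fun s => by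
    have h1 := (hasFDerivAt_fst (𝕜 := ℝ)).comp_hasDerivAt s (hΨ.deriv s q)
    have h2 : HasDerivAt (fun s => (Ψ s q).1) 1 s := h1
    exact (h2.sub (hasDerivAt_id s)).congr_deriv (sub_self 1)
  have := is_const_of_deriv_eq_zero (fun s => (h s).differentiableAt) (fun s => (h s).deriv) s 0
  simp only [hΨ.zero, sub_zero] at this
  linarith

/-- A solution of `y' = μ y` on `[0, 1]`. -/
lemma eq_exp_integral_mul {y μ : ℝ → ℝ} (hμ : ContinuousOn μ (Icc 0 1))
    (hy : ∀ t ∈ Icc (0 : ℝ) 1, HasDerivAt y (μ t * y t) t) :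
    y 1 =
      Real.exp (∫ t in (0 : ℝ)..1, IccExtend (zero_le_one' ℝ) ((Icc 0 1).domRestrict μ) t) * y 0 := by
  -- The coefficient is only known to be continuous on [0, 1]. The constant extension has a
  -- primitive that is differentiable at the end points as well.
  set ν := IccExtend (zero_le_one' ℝ) ((Icc (0 : ℝ) 1).domRestrict μ) with hν
  have hνc : Continuous ν := (continuousOn_iff_continuous_domRestrict.1 hμ).Icc_extend'
  have hνμ : ∀ t ∈ Icc (0 : ℝ) 1, ν t = μ t := fun t ht => by
    rw [hν, IccExtend_of_mem _ _ ht]; rfl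
  set m : ℝ → ℝ := fun t => ∫ s in (0 : ℝ)..t, ν s with hm
  have hmd : ∀ t, HasDerivAt m (ν t) t := fun t => hνc.integral_hasStrictDerivAt 0 t |>.hasDerivAt
  have hd : ∀ t ∈ Icc (0 : ℝ) 1, HasDerivAt (fun t => Real.exp (-m t) * y t) 0 t := fun t ht => by
    have := (hmd t).neg.exp.mul (hy t ht)
    refine this.congr_deriv ?_
    rw [hνμ t ht]
    ring
  have := constant_of_has_deriv_right_zero
    (fun t ht => (hd t ht).continuousAt.continuousWithinAt)
    (fun t ht => (hd t (Ico_subset_Icc_self ht)).hasDerivWithinAt) 1 ⟨zero_le_one, le_rfl⟩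
  have hm0 : m 0 = 0 := by simp [hm]
  simp only [hm0, neg_zero, Real.exp_zero, one_mul] at this
  change y 1 = Real.exp (m 1) * y 0
  rw [← this, ← mul_assoc, ← Real.exp_add]
  simp

/-- Gray's stability theorem for a family of contact forms on a compact submanifold. -/
theorem areIsotopic_of_path [FiniteDimensional ℝ E] {M : Set E} (hMc : IsCompact M)
    (hret : ∀ p ∈ M, ∃ r, IsLocalRetraction M p r) {𝒜 : ℝ × E → E →L[ℝ] ℝ}
    (h𝒜 : SmoothNear (Icc (0 : ℝ) 1 ×ˢ M) 𝒜)
    (hc : ∀ t ∈ Icc (0 : ℝ) 1, IsContactForm M fun x => 𝒜 (t, x)) :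
    AreIsotopic M (fun x => 𝒜 (0, x)) (fun x => 𝒜 (1, x)) := by
  have : CompleteSpace E := FiniteDimensional.complete ℝ E
  obtain ⟨X, R, hX, hXc, hR, hXR⟩ := exists_gray_field hMc hret h𝒜 hc
  set Y : ℝ × E → ℝ × E := fun q => (1, X q) with hYdef
  have hY : ContDiff ℝ ∞ Y := contDiff_const.prodMk hX
  obtain ⟨K, hK⟩ := hX.lipschitzWith_of_hasCompactSupport hXc (by simp)
  obtain ⟨C, hC⟩ := hXc.exists_bound_of_continuous hX.continuous
  obtain ⟨Ψ, hΨ⟩ : ∃ Ψ, IsFlow Y Ψ := by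
    refine exists_isFlow_of_bounded (K := max 0 K) (LipschitzWith.prodMk (LipschitzWith.const 1) hK)
      (C := max 1 C) fun q => ?_
    rw [Prod.norm_def]
    exact max_le_max (by simp [hYdef]) (hC q)
  have hΨs := hΨ.contDiff hY
  have hfst := fun s q => IsFlow.fst_eq hΨ s q
  set Φ : ℝ → E → E := fun t x => (Ψ t (0, x)).2 with hΦ
  have hΨΦ : ∀ t x, Ψ t (0, x) = (t, Φ t x) := fun t x => by
    ext
    · simp [hfst]
    · rfl
  have hΦs : ContDiff ℝ ∞ fun q : ℝ × E => Φ q.1 q.2 :=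
    contDiff_snd.comp (hΨs.comp (contDiff_fst.prodMk (contDiff_const.prodMk contDiff_snd)))
  have hΦt : ∀ t, ContDiff ℝ ∞ (Φ t) := fun t => hΦs.comp (contDiff_const.prodMk contDiff_id)
  have hsnd : ∀ s q, HasDerivAt (fun s => (Ψ s q).2) (X (Ψ s q)) s := fun s q => by
    have h := (hasFDerivAt_snd (𝕜 := ℝ)).comp_hasDerivAt s (hΨ.deriv s q)
    exact h
  have hΦd : ∀ t x, HasDerivAt (fun s => Φ s x) (X (t, Φ t x)) t := fun t x => by
    simpa only [hΨΦ] using hsnd t (0, x)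
  have hΦM : ∀ t ∈ Icc (0 : ℝ) 1, MapsTo (Φ t) M M := fun t ht x hx =>
    mem_of_tangent hMc.isClosed hret hX (a := 0) (b := 1)
      (fun s hs y hy => (hXR (s, y) ⟨hs, hy⟩).1) (fun s => hΦd s x)
      (by simpa [hΦ, hΨ.zero] using hx) t ht
  -- The inverse of the time-t map runs the suspended flow backwards from (t, y). It preserves M
  -- because the reversed field -X(t - s, ·) is tangent to M for s in [0, t].
  set B : ℝ → E → E := fun t y => (Ψ (-t) (t, y)).2 with hB
  have hBM : ∀ t ∈ Icc (0 : ℝ) 1, MapsTo (B t) M M := fun t ht y hy => by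
    refine mem_of_tangent hMc.isClosed hret (Z := fun q => -X (t - q.1, q.2)) (a := 0) (b := t)
      (hX.comp ((contDiff_const.sub contDiff_fst).prodMk contDiff_snd)).neg
      (fun s hs z hz => ?_) (c := fun s => (Ψ (-s) (t, y)).2) (fun s => ?_) ?_ t ⟨ht.1, le_rfl⟩
    · obtain ⟨r, hr⟩ := hret z hz
      obtain ⟨W, hW⟩ := hr.exists_submodule hz
      have := (hXR (t - s, z) ⟨⟨by linarith [hs.2], by linarith [hs.1, ht.2]⟩, hz⟩).1
      rw [hW] at this ⊢
      exact W.neg_mem this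
    · have h1 := (hsnd (-s) (t, y)).scomp s (hasDerivAt_neg s)
      have h2 : Ψ (-s) (t, y) = (t - s, (Ψ (-s) (t, y)).2) := by
        ext
        · simp [hfst, sub_eq_add_neg]
        · rfl
      refine h1.congr_deriv ?_
      rw [← h2, neg_one_smul]
    · simpa [hΨ.zero] using hy
  have hBs : ∀ t, ContDiff ℝ ∞ (B t) := fun t =>
    contDiff_snd.comp (hΨs.comp (contDiff_const.prodMk (contDiff_const.prodMk contDiff_id)))
  have hBΦ : ∀ t x, B t (Φ t x) = x := fun t x => by
    simp only [hB, ← hΨΦ, hΨ.group hY, neg_add_cancel, hΨ.zero]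
  have hΦB : ∀ t x, Φ t (B t x) = x := fun t x => by
    have h2 : Ψ (-t) (t, x) = (0, B t x) := by
      ext
      · simp [hfst]
      · rfl
    simp only [hΦ, ← h2, hΨ.group hY, add_neg_cancel, hΨ.zero]
  have hdiffeo : ∀ t ∈ Icc (0 : ℝ) 1, IsDiffeo (Φ t) M M := fun t ht =>
    ⟨smoothNear_of_contDiff (hΦt t) M, hΦM t ht, B t, smoothNear_of_contDiff (hBs t) M, hBM t ht,
      fun x _ => hBΦ t x, fun x _ => hΦB t x⟩
  refine ⟨Φ, smoothNear_of_contDiff hΦs _, hdiffeo, fun p _ => by simp [hΦ, hΨ.zero],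
    hdiffeo 1 ⟨zero_le_one, le_rfl⟩, fun p hp => ?_⟩
  -- Along the isotopy, 𝒜 evaluated on a transported tangent vector solves y' = μ y. Gray's equation
  -- says that the Lie derivative is proportional to 𝒜; the factor μ is read off by evaluating on R,
  -- where 𝒜 is 1.
  set μ : ℝ → ℝ := fun t => fderiv ℝ 𝒜 (t, Φ t p) (1, 0) (R (t, Φ t p)) +
    spaceD 𝒜 (t, Φ t p) (X (t, Φ t p)) (R (t, Φ t p)) with hμ
  have hmem : ∀ t ∈ Icc (0 : ℝ) 1, (t, Φ t p) ∈ Icc (0 : ℝ) 1 ×ˢ M := fun t ht =>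
    ⟨ht, hΦM t ht hp⟩
  have hcurve : Continuous fun t => (t, Φ t p) :=
    continuous_id.prodMk (continuous_iff_continuousAt.2 fun t => (hΦd t p).continuousAt)
  have hμc : ContinuousOn μ (Icc 0 1) := by
    intro t ht
    have hD : ContinuousAt (fun s => fderiv ℝ 𝒜 (s, Φ s p)) t :=
      ContinuousAt.comp (g := fderiv ℝ 𝒜) (h𝒜.fderiv.contDiffAt (hmem t ht)).continuousAt
        hcurve.continuousAt
    have hXt : ContinuousAt (fun s => X (s, Φ s p)) t :=
      (hX.continuous.comp hcurve).continuousAt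
    have hRt : ContinuousAt (fun s => R (s, Φ s p)) t :=
      (hR.continuous.comp hcurve).continuousAt
    simp only [hμ, spaceD_apply]
    refine ContinuousAt.continuousWithinAt ?_
    exact ((hD.clm_apply continuousAt_const).clm_apply hRt).add
      (((hD.clm_apply (continuousAt_const.prodMk hXt)).clm_apply hRt).sub
        ((hD.clm_apply (continuousAt_const.prodMk hRt)).clm_apply hXt))
  refine ⟨Real.exp (∫ t in (0 : ℝ)..1, IccExtend (zero_le_one' ℝ) ((Icc 0 1).domRestrict μ) t),
    Real.exp_pos _, fun v hv => ?_⟩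
  have hVd : ∀ t, fderiv ℝ (Ψ t) (0, p) (0, v) = (0, fderiv ℝ (Φ t) p v) := fun t => by
    have hΨt : ContDiff ℝ ∞ (Ψ t) := hΨs.comp (contDiff_const.prodMk contDiff_id)
    rw [← fderiv_slice (f := Ψ t) (hΨt.differentiable (by simp) _)]
    have h1 : (fun y => Ψ t (0, y)) = fun y => (t, Φ t y) := funext fun y => hΨΦ t y
    rw [h1]
    have h2 : HasFDerivAt (fun y => (t, Φ t y)) _ p := (hasFDerivAt_const t p).prodMk
      ((hΦt t).differentiable (by simp) p).hasFDerivAt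
    rw [h2.fderiv]
    rfl
  have hV : ∀ t, HasDerivAt (fun s => fderiv ℝ (Φ s) p v)
      (fderiv ℝ X (t, Φ t p) (0, fderiv ℝ (Φ t) p v)) t := fun t => by
    have h1 := (hasFDerivAt_snd (𝕜 := ℝ)).comp_hasDerivAt t
      (hΨ.hasDerivAt_fderiv hY (0, p) (0, v) t)
    have h2 : HasFDerivAt Y _ (t, Φ t p) := (hasFDerivAt_const (1 : ℝ) (t, Φ t p)).prodMk
      (hX.differentiable (by simp) (t, Φ t p)).hasFDerivAt
    rw [hΨΦ, hVd, h2.fderiv] at h1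
    refine HasDerivAt.congr_of_eventuallyEq (h1.congr_deriv (by simp)) ?_
    exact Eventually.of_forall fun s => by simp [hVd]
  have key := eq_exp_integral_mul (y := fun t => 𝒜 (t, Φ t p) (fderiv ℝ (Φ t) p v)) hμc
    fun t ht => ?_
  · rw [pullback_apply, key]
    have : Φ 0 = id := funext fun x => by simp [hΦ, hΨ.zero]
    simp [this]
  · set q := (t, Φ t p) with hq
    set V := fderiv ℝ (Φ t) p v
    have hVT : V ∈ tangentAt M (Φ t p) := fderiv_mem_tangentAt (hΦt t).contDiffAt (hΦM t ht) hv
    have h𝒜q : DifferentiableAt ℝ 𝒜 q := h𝒜.differentiableAt (hmem t ht)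
    have h1 : HasDerivAt (fun s => 𝒜 (s, Φ s p)) (fderiv ℝ 𝒜 q (1, X q)) t :=
      HasFDerivAt.comp_hasDerivAt (f := fun s => (s, Φ s p)) t h𝒜q.hasFDerivAt
        ((hasDerivAt_id t).prodMk (hΦd t p))
    have h2 := h1.clm_apply (hV t)
    have hXq : DifferentiableAt ℝ X q := hX.differentiable (by simp) q
    -- This is 𝒜(X) = 0 on M, differentiated in the tangent direction V.
    have h3 : fderiv ℝ 𝒜 q (0, V) (X q) + 𝒜 q (fderiv ℝ X q (0, V)) = 0 := by
      have hd : HasFDerivAt (fun z : ℝ × E => 𝒜 z (X z)) _ q :=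
        h𝒜q.hasFDerivAt.clm_apply hXq.hasFDerivAt
      have h4 := fderiv_slice (f := fun z : ℝ × E => 𝒜 z (X z)) (t := t) (x := Φ t p)
        hd.differentiableAt V
      have hsl : DifferentiableAt ℝ (fun y => 𝒜 (t, y) (X (t, y))) (Φ t p) :=
        DifferentiableAt.comp (g := fun z : ℝ × E => 𝒜 z (X z)) (f := fun y => (t, y)) (Φ t p)
          hd.differentiableAt ((differentiableAt_const t).prodMk differentiableAt_id)
      have h5 := fderiv_eq_of_eqOn (M := M) (g := fun _ => (0 : ℝ)) hsl (differentiableAt_const _)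
        (fun y hy => (hXR (t, y) ⟨ht, hy⟩).2.2.1) (hΦM t ht hp) hVT
      rw [h4, ← hq, hd.fderiv] at h5
      simpa [add_comm] using h5
    obtain ⟨-, hRT, -, hAR, hG⟩ := hXR q (hmem t ht)
    obtain ⟨r, hr⟩ := hret _ (hΦM t ht hp)
    obtain ⟨W, hW⟩ := hr.exists_submodule (hΦM t ht hp)
    -- Gray's equation only holds on the contact hyperplane, so the component along R is removed
    -- first.
    have h6 := hG (V - 𝒜 q V • R q)
      ((hW _).2 (W.sub_mem ((hW _).1 hVT) (W.smul_mem _ ((hW _).1 hRT)))) (by simp [hAR])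
    refine h2.congr_deriv ?_
    have h7 : ((1 : ℝ), X q) = (1, 0) + (0, X q) := by simp
    rw [h7, map_add]
    simp only [map_sub, map_smul, smul_eq_mul] at h6
    rw [spaceD_apply 𝒜 q (X q) V] at h6
    simp only [add_apply, hμ]
    rw [← hq]
    linarith

end Gray

/-! ### Weighted Hermitian pairings and the test vector -/

section Pairing

variable {m : ℕ}

/-- The real part of the Hermitian form with weights `c`. -/
def rePair (c : Fin m → ℝ) (z v : Fin m → ℂ) : ℝ :=
  ∑ j, c j * (star (z j) * v j).re

/-- The imaginary part of the Hermitian form with weights `c`. -/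
def imPair (c : Fin m → ℝ) (z v : Fin m → ℂ) : ℝ :=
  ∑ j, c j * (star (z j) * v j).im

variable (c : Fin m → ℝ) (z v w : Fin m → ℂ)

lemma rePair_add : rePair c z (v + w) = rePair c z v + rePair c z w := by
  simp only [rePair, ← Finset.sum_add_distrib]
  exact Finset.sum_congr rfl fun j _ => by simp; ring

lemma imPair_add : imPair c z (v + w) = imPair c z v + imPair c z w := by
  simp only [imPair, ← Finset.sum_add_distrib]
  exact Finset.sum_congr rfl fun j _ => by simp; ring

lemma rePair_smul (t : ℝ) : rePair c z (t • v) = t * rePair c z v := by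
  simp only [rePair, Finset.mul_sum]
  exact Finset.sum_congr rfl fun j _ => by simp; ring

lemma imPair_smul (t : ℝ) : imPair c z (t • v) = t * imPair c z v := by
  simp only [imPair, Finset.mul_sum]
  exact Finset.sum_congr rfl fun j _ => by simp; ring

lemma rePair_I_smul : rePair c z (Complex.I • v) = - imPair c z v := by
  simp only [rePair, imPair, ← Finset.sum_neg_distrib]
  exact Finset.sum_congr rfl fun j _ => by simp; ring

lemma imPair_I_smul : imPair c z (Complex.I • v) = rePair c z v := by
  simp only [rePair, imPair]
  exact Finset.sum_congr rfl fun j _ => by simp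

lemma rePair_comm : rePair c z v = rePair c v z := by
  simp only [rePair]
  exact Finset.sum_congr rfl fun j _ => by simp [mul_comm]

lemma imPair_comm : imPair c z v = - imPair c v z := by
  simp only [imPair, ← Finset.sum_neg_distrib]
  exact Finset.sum_congr rfl fun j _ => by simp; ring

lemma rePair_self : rePair c z z = ∑ j, c j * ‖z j‖ ^ 2 := by
  simp only [rePair]
  refine Finset.sum_congr rfl fun j _ => ?_
  rw [← Complex.normSq_eq_norm_sq, Complex.normSq_apply]
  simp

lemma imPair_self : imPair c z z = 0 := by
  have := imPair_comm c z z
  linarith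

/-- The generator `(z_j / a_j)` of the weighted dilations. -/
def euler (a : Fin m → ℕ) (z : Fin m → ℂ) : Fin m → ℂ := fun j => ((a j : ℝ)⁻¹ : ℝ) • z j

lemma rePair_euler (a : Fin m → ℕ) : rePair c v (euler a z) = rePair (fun j => c j / a j) v z := by
  simp only [rePair, euler]
  exact Finset.sum_congr rfl fun j _ => by simp; ring

lemma imPair_euler (a : Fin m → ℕ) : imPair c v (euler a z) = imPair (fun j => c j / a j) v z := by
  simp only [imPair, euler]
  exact Finset.sum_congr rfl fun j _ => by simp; ring

/-- The multiple of `euler a z` to be subtracted from `I • v` in order to make it tangent. -/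
def testCoeff (a : Fin m → ℕ) : ℝ :=
  imPair (fun j => c j / a j) z v / rePair (fun j => c j / a j / a j) z z

/-- The test vector that shows that a contact structure is nondegenerate. -/
def testVector (a : Fin m → ℕ) (τ : ℝ) : Fin m → ℂ :=
  Complex.I • v + testCoeff c z v a • euler a z + (-τ) • (Complex.I • euler a z)

variable {c z v} {a : Fin m → ℕ}

lemma rePair_self_pos (hc : ∀ j, 0 ≤ c j) {j : Fin m} (hj : 0 < c j) (hz : z j ≠ 0) :
    0 < rePair c z z := by
  rw [rePair_self]
  refine Finset.sum_pos' (fun i _ => mul_nonneg (hc i) (by positivity)) ⟨j, Finset.mem_univ j, ?_⟩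
  positivity

lemma exists_of_rePair_self_pos (hc : ∀ j, 0 ≤ c j) (h : 0 < rePair c z z) :
    ∃ j, 0 < c j ∧ z j ≠ 0 := by
  by_contra! h0
  refine h.ne' ?_
  rw [rePair_self]
  refine Finset.sum_eq_zero fun j _ => ?_
  rcases (hc j).eq_or_lt with h1 | h1
  · simp [← h1]
  · simp [h0 j h1]

lemma rePair_div_pos (ha : ∀ j, 0 < a j) (hc : ∀ j, 0 ≤ c j) (h : 0 < rePair c z z) :
    0 < rePair (fun j => c j / a j) z z := by
  obtain ⟨j, hj, hz⟩ := exists_of_rePair_self_pos hc h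
  exact rePair_self_pos (fun i => div_nonneg (hc i) (Nat.cast_nonneg _))
    (div_pos hj (Nat.cast_pos.2 (ha j))) hz

/-- This is tangency to the ellipsoid with weights c_j/a_j. The multiple of `euler a z` cancels the
radial component of i v, and i times `euler a z` is already tangent. -/
lemma rePair_testVector (ha : ∀ j, 0 < a j) (hc : ∀ j, 0 ≤ c j)
    (h : 0 < rePair (fun j => c j / a j) z z) (τ : ℝ) :
    rePair (fun j => c j / a j) z (testVector c z v a τ) = 0 := by
  have hQ := rePair_div_pos ha (fun j => div_nonneg (hc j) (Nat.cast_nonneg (a j))) h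
  rw [testVector, rePair_add, rePair_add, rePair_smul, rePair_smul, rePair_I_smul, rePair_I_smul,
    rePair_euler, imPair_euler, imPair_self, testCoeff, div_mul_cancel₀ _ hQ.ne']
  ring

/-- The parameter τ shifts the value of the one-form on the test vector, so it can be chosen to land
in the kernel. -/
lemma imPair_testVector (τ : ℝ) :
    imPair c z (testVector c z v a τ) =
      rePair c z v - τ * rePair (fun j => c j / a j) z z := by
  rw [testVector, imPair_add, imPair_add, imPair_smul, imPair_smul, imPair_I_smul, imPair_I_smul,
    rePair_euler, imPair_euler, imPair_self]
  ring

/-- Completing the square: `testCoeff` is the κ that minimizes ∑ c_j |v_j - κ (iE)_j|², where E is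
`euler a z`. The term with τ drops out because v is tangent to the ellipsoid. -/
lemma imPair_testVector_eq (ha : ∀ j, 0 < a j) (hc : ∀ j, 0 ≤ c j)
    (h : 0 < rePair (fun j => c j / a j) z z) (hv : rePair (fun j => c j / a j) z v = 0) (τ : ℝ) :
    imPair c v (testVector c z v a τ) =
      ∑ j, c j * ‖v j - testCoeff c z v a • (Complex.I • euler a z) j‖ ^ 2 := by
  have hQ := rePair_div_pos ha (fun j => div_nonneg (hc j) (Nat.cast_nonneg (a j))) h
  set κ := testCoeff c z v a with hκ
  have h1 : ∑ j, c j * ‖v j - κ • (Complex.I • euler a z) j‖ ^ 2 =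
      rePair c v v - 2 * κ * imPair (fun j => c j / a j) z v +
        κ ^ 2 * rePair (fun j => c j / a j / a j) z z := by
    simp only [rePair, imPair, Finset.mul_sum, ← Finset.sum_sub_distrib, ← Finset.sum_add_distrib]
    refine Finset.sum_congr rfl fun j _ => ?_
    rw [← Complex.normSq_eq_norm_sq, Complex.normSq_apply]
    simp [euler]
    field_simp
    ring
  have h2 : κ * rePair (fun j => c j / a j / a j) z z = imPair (fun j => c j / a j) z v := by
    rw [hκ, testCoeff, div_mul_cancel₀ _ hQ.ne']
  rw [h1, testVector, imPair_add, imPair_add, imPair_smul, imPair_smul, imPair_I_smul,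
    imPair_I_smul, rePair_euler, imPair_euler, ← hκ, rePair_comm _ v z, hv, imPair_comm _ v z]
  linear_combination -κ * h2

end Pairing

/-! ### The forms x_j dy_j - y_j dx_j and their exterior derivatives -/

section Forms

variable {m : ℕ}

/-- The one-form `x_j dy_j - y_j dx_j`, as a linear function of the point. -/
def theta (j : Fin m) : (Fin m → ℂ) →L[ℝ] (Fin m → ℂ) →L[ℝ] ℝ :=
  LinearMap.toContinuousLinearMap
    { toFun := fun z => Complex.imCLM.comp
        ((star (z j)) • (ContinuousLinearMap.proj j : (Fin m → ℂ) →L[ℝ] ℂ))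
      map_add' := fun z w => by
        ext v
        simp
        ring
      map_smul' := fun t z => by
        ext v
        simp
        ring }

lemma theta_apply (j : Fin m) (z v : Fin m → ℂ) : theta j z v = (star (z j) * v j).im := by
  simp [theta]

lemma theta_comm (j : Fin m) (z v : Fin m → ℂ) : theta j z v = - theta j v z := by
  simp [theta_apply]
  ring

lemma weightedForm_eq_sum (a : Fin m → ℕ) (z : Fin m → ℂ) :
    weightedForm a z = ∑ j, (a j : ℝ) • theta j z := by
  simp [weightedForm, theta]

lemma weightedForm_apply (a : Fin m → ℕ) (z v : Fin m → ℂ) :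
    weightedForm a z v = imPair (fun j => a j) z v := by
  rw [weightedForm_eq_sum]
  simp [imPair, theta_apply]

lemma contDiff_weightedForm (a : Fin m → ℕ) : ContDiff ℝ ∞ (weightedForm a) := by
  rw [show weightedForm a = fun z => ∑ j, (a j : ℝ) • theta j z from
    funext (weightedForm_eq_sum a)]
  exact ContDiff.sum fun j _ => (theta j).contDiff.const_smul (a j : ℝ)

/-- The exterior derivative of a combination of the forms `x_j dy_j - y_j dx_j`. -/
lemma dForm_sum_smul_theta {C : Fin m → (Fin m → ℂ) → ℝ} {z : Fin m → ℂ}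
    (hC : ∀ j, DifferentiableAt ℝ (C j) z) (v w : Fin m → ℂ) :
    dForm (fun x => ∑ j, C j x • theta j x) z v w =
      ∑ j, (2 * (C j z * theta j v w) +
        (fderiv ℝ (C j) z v * theta j z w - fderiv ℝ (C j) z w * theta j z v)) := by
  have h : HasFDerivAt (fun x => ∑ j, C j x • theta j x) _ z :=
    HasFDerivAt.fun_sum fun j _ => (hC j).hasFDerivAt.smul (theta j).hasFDerivAt
  rw [dForm, h.fderiv]
  simp only [sum_apply, ← Finset.sum_sub_distrib]
  refine Finset.sum_congr rfl fun j _ => ?_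
  simp only [add_apply, smul_apply, ContinuousLinearMap.smulRight_apply, smul_eq_mul]
  rw [theta_comm j w v]
  ring

lemma dForm_weightedForm (a : Fin m → ℕ) (z v w : Fin m → ℂ) :
    dForm (weightedForm a) z v w = 2 * imPair (fun j => a j) v w := by
  rw [show weightedForm a = fun z => ∑ j, (fun _ : Fin m → ℂ => (a j : ℝ)) z • theta j z from
    funext (weightedForm_eq_sum a), dForm_sum_smul_theta fun j => differentiableAt_const _]
  simp [imPair, theta_apply, Finset.mul_sum]

end Forms

/-! ### Sections of the variety by ellipsoids, and the unit sphere -/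

section Levels

variable {m : ℕ}

/-- The derivative of `∑ z_j ^ a_j`. -/
def brDeriv (a : Fin m → ℕ) (z : Fin m → ℂ) : (Fin m → ℂ) →L[ℝ] ℂ :=
  ∑ j, ((a j : ℂ) * z j ^ (a j - 1)) • (ContinuousLinearMap.proj j : (Fin m → ℂ) →L[ℝ] ℂ)

lemma brDeriv_apply (a : Fin m → ℕ) (z v : Fin m → ℂ) :
    brDeriv a z v = ∑ j, (a j : ℂ) * z j ^ (a j - 1) * v j := by
  simp [brDeriv]

lemma brDeriv_smul (a : Fin m → ℕ) (z v : Fin m → ℂ) (t : ℂ) :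
    brDeriv a z (t • v) = t * brDeriv a z v := by
  simp only [brDeriv_apply, Finset.mul_sum]
  exact Finset.sum_congr rfl fun j _ => by simp; ring

lemma brDeriv_euler {a : Fin m → ℕ} (ha : ∀ j, 0 < a j) (z : Fin m → ℂ) :
    brDeriv a z (euler a z) = ∑ j, z j ^ a j := by
  rw [brDeriv_apply]
  refine Finset.sum_congr rfl fun j _ => ?_
  have h : (a j : ℂ) ≠ 0 := Nat.cast_ne_zero.2 (ha j).ne'
  have h2 : z j ^ a j = z j ^ (a j - 1) * z j := by
    rw [← pow_succ, Nat.sub_add_cancel (ha j)]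
  simp only [euler, Complex.real_smul, Complex.ofReal_inv, Complex.ofReal_natCast, h2]
  field_simp

/-- The derivative of ∑ z_j ^ a_j is complex linear, and by Euler's relation it annihilates `euler a
z` on the variety. The corrections of i v therefore stay tangent. -/
lemma brDeriv_testVector {a : Fin m → ℕ} (ha : ∀ j, 0 < a j) {z v : Fin m → ℂ}
    (hz : ∑ j, z j ^ a j = 0) (hv : brDeriv a z v = 0) (c : Fin m → ℝ) (τ : ℝ) :
    brDeriv a z (testVector c z v a τ) = 0 := by
  rw [testVector, map_add, map_add, brDeriv_smul, (brDeriv a z).map_smul, (brDeriv a z).map_smul,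
    brDeriv_smul, brDeriv_euler ha, hz, hv]
  simp

lemma exists_brDeriv_eq {a : Fin m → ℕ} (ha : ∀ j, 0 < a j) {z : Fin m → ℂ} {j : Fin m}
    (hj : z j ≠ 0) (t : ℂ) : ∃ v, brDeriv a z v = t := by
  refine ⟨Pi.single j (t / (a j * z j ^ (a j - 1))), ?_⟩
  rw [brDeriv_apply, Finset.sum_eq_single j]
  · have h : (a j : ℂ) ≠ 0 := Nat.cast_ne_zero.2 (ha j).ne'
    simp
    field_simp
  · intro i _ hi
    simp [hi]
  · simp

lemma hasFDerivAt_sum_pow (a : Fin m → ℕ) (z : Fin m → ℂ) :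
    HasFDerivAt (fun z : Fin m → ℂ => ∑ j, z j ^ a j) (brDeriv a z) z := by
  refine (HasFDerivAt.fun_sum fun j _ => ((ContinuousLinearMap.proj (R := ℝ) j :
    (Fin m → ℂ) →L[ℝ] ℂ).hasFDerivAt (x := z)).pow (a j)).congr_fderiv ?_
  ext v
  simp [brDeriv]

lemma contDiff_sum_pow (a : Fin m → ℕ) :
    ContDiff ℝ ∞ (fun z : Fin m → ℂ => ∑ j, z j ^ a j) :=
  ContDiff.sum fun j _ => (contDiff_apply ℝ ℂ j).pow _

/-- The derivative of `∑ e_j |z_j|²`. -/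
def radDeriv (e : Fin m → ℝ) (z : Fin m → ℂ) : (Fin m → ℂ) →L[ℝ] ℝ :=
  ∑ j, (2 * e j) • Complex.reCLM.comp
    ((star (z j)) • (ContinuousLinearMap.proj j : (Fin m → ℂ) →L[ℝ] ℂ))

lemma radDeriv_apply (e : Fin m → ℝ) (z v : Fin m → ℂ) : radDeriv e z v = 2 * rePair e z v := by
  simp [radDeriv, rePair, Finset.mul_sum, mul_assoc]

lemma hasFDerivAt_sum_norm_sq (e : Fin m → ℝ) (z : Fin m → ℂ) :
    HasFDerivAt (fun z : Fin m → ℂ => ∑ j, e j * ‖z j‖ ^ 2) (radDeriv e z) z := by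
  refine (HasFDerivAt.fun_sum fun j _ => (((ContinuousLinearMap.proj (R := ℝ) j :
    (Fin m → ℂ) →L[ℝ] ℂ).hasFDerivAt (x := z)).norm_sq).const_mul (e j)).congr_fderiv ?_
  ext v
  simp [radDeriv, Complex.inner]
  refine Finset.sum_congr rfl fun j _ => ?_
  ring

lemma contDiff_sum_norm_sq (e : Fin m → ℝ) :
    ContDiff ℝ ∞ (fun z : Fin m → ℂ => ∑ j, e j * ‖z j‖ ^ 2) :=
  ContDiff.sum fun j _ => contDiff_const.mul ((contDiff_apply ℝ ℂ j).norm_sq ℝ)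

/-- The part of the variety `∑ z_j ^ a_j = 0` on the ellipsoid `∑ e_j |z_j|² = 1`. -/
def level (a : Fin m → ℕ) (e : Fin m → ℝ) : Set (Fin m → ℂ) :=
  {z | ∑ j, z j ^ a j = 0 ∧ ∑ j, e j * ‖z j‖ ^ 2 = 1}

lemma brieskorn_eq_level (a : Fin m → ℕ) : brieskorn a = level a fun _ => 1 := by
  simp [brieskorn, level, unitSphere]

/-- The defining equation of `level a e`. -/
def levelMap (a : Fin m → ℕ) (e : Fin m → ℝ) (z : Fin m → ℂ) : ℂ × ℝ :=
  (∑ j, z j ^ a j, ∑ j, e j * ‖z j‖ ^ 2 - 1)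

lemma contDiff_levelMap (a : Fin m → ℕ) (e : Fin m → ℝ) : ContDiff ℝ ∞ (levelMap a e) :=
  (contDiff_sum_pow a).prodMk ((contDiff_sum_norm_sq e).sub contDiff_const)

lemma fderiv_levelMap (a : Fin m → ℕ) (e : Fin m → ℝ) (z v : Fin m → ℂ) :
    fderiv ℝ (levelMap a e) z v = (brDeriv a z v, 2 * rePair e z v) := by
  have h : HasFDerivAt (levelMap a e) _ z :=
    (hasFDerivAt_sum_pow a z).prodMk ((hasFDerivAt_sum_norm_sq e z).sub_const 1)
  rw [h.fderiv]
  simp [radDeriv_apply]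

lemma level_eq (a : Fin m → ℕ) (e : Fin m → ℝ) : level a e = {z | levelMap a e z = 0} := by
  ext z
  simp [level, levelMap, sub_eq_zero]

/-- The Euler vector is tangent to the variety and transverse to the ellipsoid. The complex equation
is solved first, and the real one is then corrected along the Euler vector. Weights may vanish, as
they do for the cylinder. -/
lemma surjective_fderiv_levelMap {a : Fin m → ℕ} (ha : ∀ j, 0 < a j) {e : Fin m → ℝ}
    (he : ∀ j, 0 ≤ e j) {z : Fin m → ℂ} (hz : z ∈ level a e) :
    Function.Surjective (fderiv ℝ (levelMap a e) z) := by
  rintro ⟨t, s⟩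
  have h1 : rePair e z z = 1 := by rw [rePair_self]; exact hz.2
  have h0 : 0 < rePair e z z := by rw [h1]; exact one_pos
  have h2 : 0 < rePair e z (euler a z) := by
    rw [rePair_euler]
    exact rePair_div_pos ha he h0
  obtain ⟨j, -, hj⟩ := exists_of_rePair_self_pos he h0
  obtain ⟨v, hv⟩ := exists_brDeriv_eq ha hj t
  refine ⟨v + ((s / 2 - rePair e z v) / rePair e z (euler a z)) • euler a z, ?_⟩
  rw [fderiv_levelMap, map_add, map_smul, brDeriv_euler ha, hz.1, hv, rePair_add, rePair_smul,
    div_mul_cancel₀ _ h2.ne']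
  simp
  ring

lemma isSubmanifold_level {a : Fin m → ℕ} (ha : ∀ j, 0 < a j) {e : Fin m → ℝ}
    (he : ∀ j, 0 ≤ e j) : IsSubmanifold 3 (level a e) := by
  refine isSubmanifold_of_zero_set (G := ℂ × ℝ) (by simp) fun p hp =>
    ⟨univ, isOpen_univ, mem_univ p, levelMap a e, (contDiff_levelMap a e).contDiffOn,
      surjective_fderiv_levelMap ha he hp, ?_⟩
  rw [level_eq]
  simp

lemma mem_tangentAt_level {a : Fin m → ℕ} (ha : ∀ j, 0 < a j) {e : Fin m → ℝ}
    (he : ∀ j, 0 ≤ e j) {z : Fin m → ℂ} (hz : z ∈ level a e) {v : Fin m → ℂ} :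
    v ∈ tangentAt (level a e) z ↔ brDeriv a z v = 0 ∧ rePair e z v = 0 := by
  rw [tangentAt_eq_ker hz isOpen_univ (mem_univ z) (contDiff_levelMap a e).contDiffOn
    (surjective_fderiv_levelMap ha he hz) (by rw [level_eq]; simp)]
  simp [fderiv_levelMap]

lemma isClosed_level (a : Fin m → ℕ) (e : Fin m → ℝ) : IsClosed (level a e) := by
  rw [level_eq]
  exact isClosed_eq (contDiff_levelMap a e).continuous continuous_const

lemma fderiv_sphere (z v : Fin m → ℂ) :
    fderiv ℝ (fun z : Fin m → ℂ => ∑ j, (1 : ℝ) * ‖z j‖ ^ 2 - 1) z v =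
      2 * rePair (fun _ => 1) z v := by
  rw [((hasFDerivAt_sum_norm_sq (fun _ => 1) z).sub_const 1).fderiv, radDeriv_apply]

lemma unitSphere_eq (m : ℕ) :
    unitSphere m = {z | ∑ j, (1 : ℝ) * ‖z j‖ ^ 2 - 1 = 0} := by
  ext z
  simp [unitSphere, sub_eq_zero]

lemma rePair_of_mem_unitSphere {z : Fin m → ℂ} (hz : z ∈ unitSphere m) :
    rePair (fun _ => 1) z z = 1 := by
  rw [rePair_self]
  simpa [unitSphere] using hz

lemma contDiff_sphere : ContDiff ℝ ∞ fun z : Fin m → ℂ => ∑ j, (1 : ℝ) * ‖z j‖ ^ 2 - 1 :=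
  (contDiff_sum_norm_sq (fun _ => 1)).sub contDiff_const

lemma surjective_fderiv_sphere {z : Fin m → ℂ} (hz : z ∈ unitSphere m) :
    Function.Surjective (fderiv ℝ (fun z : Fin m → ℂ => ∑ j, (1 : ℝ) * ‖z j‖ ^ 2 - 1) z) := by
  intro s
  refine ⟨(s / 2) • z, ?_⟩
  rw [fderiv_sphere, rePair_smul, rePair_of_mem_unitSphere hz]
  ring

lemma isSubmanifold_unitSphere (m : ℕ) : IsSubmanifold 1 (unitSphere m) := by
  refine isSubmanifold_of_zero_set (G := ℝ) (by simp) fun p hp =>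
    ⟨univ, isOpen_univ, mem_univ p, _, contDiff_sphere.contDiffOn,
      surjective_fderiv_sphere hp, ?_⟩
  rw [unitSphere_eq]
  simp

lemma mem_tangentAt_unitSphere {z : Fin m → ℂ} (hz : z ∈ unitSphere m) {v : Fin m → ℂ} :
    v ∈ tangentAt (unitSphere m) z ↔ rePair (fun _ => 1) z v = 0 := by
  rw [tangentAt_eq_ker hz isOpen_univ (mem_univ z) contDiff_sphere.contDiffOn
    (surjective_fderiv_sphere hz) (by rw [unitSphere_eq]; simp)]
  rw [mem_ofPred_eq, fderiv_sphere]
  simp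

end Levels

/-! ### Weighted contact forms on spheres and Brieskorn manifolds -/

section Contact

variable {m : ℕ} {a : Fin m → ℕ}

lemma natCast_div_self_eq (ha : ∀ j, 0 < a j) :
    (fun j => (a j : ℝ) / (a j : ℝ)) = fun _ : Fin m => (1 : ℝ) :=
  funext fun j => div_self (Nat.cast_ne_zero.2 (ha j).ne')

/-- A degenerate v makes the sum of squares in `imPair_testVector_eq` vanish, so v is a multiple κ
of i times the Euler vector. The form equals 1 on that vector, so v in the kernel has κ = 0. The
tangency hypotheses cover the sphere and the Brieskorn manifold at once. -/
lemma isContactForm_weightedForm (ha : ∀ j, 0 < a j) {M : Set (Fin m → ℂ)}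
    (hM : M ⊆ unitSphere m) (h1 : ∀ z ∈ M, Complex.I • euler a z ∈ tangentAt M z)
    (h2 : ∀ z ∈ M, ∀ v ∈ tangentAt M z, ∀ τ,
      testVector (fun j => (a j : ℝ)) z v a τ ∈ tangentAt M z) :
    IsContactForm M (weightedForm a) := by
  have hdiv := natCast_div_self_eq ha
  refine ⟨smoothNear_of_contDiff (contDiff_weightedForm a) M, fun z hz => ?_⟩
  have hz1 := rePair_of_mem_unitSphere (hM hz)
  refine ⟨⟨_, h1 z hz, ?_⟩, fun v hv hv0 hnd => ?_⟩
  · rw [weightedForm_apply, imPair_I_smul, rePair_euler, hdiv, hz1]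
    exact one_ne_zero
  · have hvr : rePair (fun _ => 1) z v = 0 :=
      (mem_tangentAt_unitSphere (hM hz)).1 (tangentAt_mono hM z hv)
    -- By `imPair_testVector` and the normalization on the unit sphere, this τ puts the test vector
    -- into the kernel.
    set τ := rePair (fun j => (a j : ℝ)) z v
    have h3 := hnd _ (h2 z hz v hv τ) (by
      rw [weightedForm_apply, imPair_testVector, hdiv, hz1]
      ring)
    rw [dForm_weightedForm, imPair_testVector_eq ha (fun j => Nat.cast_nonneg _)
      (by rw [hdiv, hz1]; exact one_pos) (by rw [hdiv]; exact hvr)] at h3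
    set κ := testCoeff (fun j => (a j : ℝ)) z v a
    have h4 : v = κ • (Complex.I • euler a z) := by
      have h5 : ∑ j, (a j : ℝ) * ‖v j - κ • (Complex.I • euler a z) j‖ ^ 2
      = 0 := by linarith
      rw [Finset.sum_eq_zero_iff_of_nonneg fun j _ => by positivity] at h5
      ext1 j
      have h6 := h5 j (Finset.mem_univ j)
      have h7 : (a j : ℝ) ≠ 0 := Nat.cast_ne_zero.2 (ha j).ne'
      simpa [h7, sub_eq_zero] using h6
    rw [weightedForm_apply, h4, imPair_smul, imPair_I_smul, rePair_euler, hdiv, hz1,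
      mul_one] at hv0
    rw [h4, hv0, zero_smul]

lemma isContactForm_unitSphere (ha : ∀ j, 0 < a j) :
    IsContactForm (unitSphere m) (weightedForm a) := by
  refine isContactForm_weightedForm ha subset_rfl (fun z hz => ?_) fun z hz v hv τ => ?_
  · rw [mem_tangentAt_unitSphere hz, rePair_I_smul, imPair_euler]
    simp only [imPair, one_div]
    rw [neg_eq_zero]
    exact imPair_self _ z
  · rw [mem_tangentAt_unitSphere hz]
    have hdiv := natCast_div_self_eq ha
    have := rePair_testVector (v := v) ha (c := fun j => (a j : ℝ)) (fun j => Nat.cast_nonneg _)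
      (by rw [hdiv, rePair_of_mem_unitSphere hz]; exact one_pos) τ
    rwa [hdiv] at this

lemma brieskorn_subset_unitSphere (a : Fin m → ℕ) : brieskorn a ⊆ unitSphere m := fun _ h => h.2

lemma isSubmanifold_brieskorn (ha : ∀ j, 0 < a j) : IsSubmanifold 3 (brieskorn a) := by
  rw [brieskorn_eq_level]
  exact isSubmanifold_level ha fun _ => zero_le_one

lemma mem_tangentAt_brieskorn (ha : ∀ j, 0 < a j) {z : Fin m → ℂ} (hz : z ∈ brieskorn a)
    {v : Fin m → ℂ} :
    v ∈ tangentAt (brieskorn a) z ↔ brDeriv a z v = 0 ∧ rePair (fun _ => 1) z v = 0 := by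
  rw [brieskorn_eq_level] at hz ⊢
  exact mem_tangentAt_level ha (fun _ => zero_le_one) hz

lemma isContactForm_brieskorn (ha : ∀ j, 0 < a j) :
    IsContactForm (brieskorn a) (weightedForm a) := by
  refine isContactForm_weightedForm ha (brieskorn_subset_unitSphere a) (fun z hz => ?_)
    fun z hz v hv τ => ?_
  · rw [mem_tangentAt_brieskorn ha hz, brDeriv_smul, brDeriv_euler ha, hz.1, rePair_I_smul,
      imPair_euler, imPair_self]
    simp
  · rw [mem_tangentAt_brieskorn ha hz] at hv ⊢
    refine ⟨brDeriv_testVector ha hz.1 hv.1 _ τ, ?_⟩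
    have hdiv := natCast_div_self_eq ha
    have := rePair_testVector (v := v) ha (c := fun j => (a j : ℝ)) (fun j => Nat.cast_nonneg _)
      (by rw [hdiv, rePair_of_mem_unitSphere hz.2]; exact one_pos) τ
    rwa [hdiv] at this

end Contact

/-- A function that is determined by an implicit equation is smooth. -/
lemma contDiffAt_of_implicit {P : Type*} [NormedAddCommGroup P] [NormedSpace ℝ P]
    [CompleteSpace P] {f : P × ℝ → ℝ} (hf : ContDiff ℝ ∞ f) {T : P → ℝ} {p : P} {d : ℝ}
    (hd : HasDerivAt (fun t => f (p, t)) d (T p)) (hd0 : d ≠ 0)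
    (huniq : ∀ᶠ x in 𝓝 p, ∀ t, f (x, t) = f (p, T p) → t = T x) :
    ContDiffAt ℝ ∞ T p := by
  have hcd : ContDiffAt ℝ ∞ f (p, T p) := hf.contDiffAt
  have hval : (fderiv ℝ f (p, T p) ∘L .inr ℝ P ℝ) = ContinuousLinearMap.toSpanSingleton ℝ d := by
    ext
    have h1 : HasDerivAt (fun t => f (p, t)) (fderiv ℝ f (p, T p) (0, 1)) (T p) :=
      HasFDerivAt.comp_hasDerivAt (f := fun t => (p, t)) (T p)
        (hcd.differentiableAt (by simp)).hasFDerivAt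
        ((hasDerivAt_const _ p).prodMk (hasDerivAt_id _))
    simp [hd.unique h1]
  have hinv : (fderiv ℝ f (p, T p) ∘L .inr ℝ P ℝ).IsInvertible := by
    rw [hval]
    refine ⟨ContinuousLinearEquiv.unitsEquivAut ℝ (Units.mk0 d hd0), ?_⟩
    ext
    simp
  refine (hcd.contDiffAt_implicitFunction (by simp) hinv).congr_of_eventuallyEq ?_
  filter_upwards [huniq, hcd.eventually_apply_implicitFunction (by simp) hinv] with x h1 h2
  exact (h1 _ h2).symm

/-! ### Weighted dilations between the cylinder and the sphere -/

section Dilation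

variable {n : ℕ}

/-- The weights of the ellipsoids `s² |z₀|² + |z₁|² + ⋯ + |z_n|² = 1`. -/
def cylWeight (s : ℝ) : Fin (n + 1) → ℝ := Fin.cons (s ^ 2) fun _ => 1

@[simp] lemma cylWeight_zero (s : ℝ) : cylWeight (n := n) s 0 = s ^ 2 := rfl

@[simp] lemma cylWeight_succ (s : ℝ) (j : Fin n) : cylWeight s j.succ = 1 := rfl

lemma cylWeight_nonneg (s : ℝ) (j : Fin (n + 1)) : 0 ≤ cylWeight s j := by
  refine Fin.cases ?_ (fun i => ?_) j
  · simp [sq_nonneg]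
  · simp

lemma contDiff_cylWeight (j : Fin (n + 1)) : ContDiff ℝ ∞ fun s => cylWeight s j := by
  refine Fin.cases ?_ (fun i => ?_) j
  · simp only [cylWeight_zero]
    fun_prop
  · simp only [cylWeight_succ]
    fun_prop

lemma cylinderBrieskorn_eq_level (a : Fin (n + 1) → ℕ) :
    cylinderBrieskorn a = level a (cylWeight 0) := by
  ext z
  simp [cylinderBrieskorn, level, unitSphere, proj₀, Fin.sum_univ_succ]

lemma brieskorn_eq_level_cylWeight (a : Fin (n + 1) → ℕ) :
    brieskorn a = level a (cylWeight 1) := by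
  ext z
  simp [brieskorn, level, unitSphere, Fin.sum_univ_succ]

/-- The weighted dilations. -/
def dilate (a : Fin (n + 1) → ℕ) (t : ℝ) (z : Fin (n + 1) → ℂ) : Fin (n + 1) → ℂ :=
  fun j => Real.exp (t / a j) • z j

lemma dilate_zero (a : Fin (n + 1) → ℕ) (z : Fin (n + 1) → ℂ) : dilate a 0 z = z := by
  ext1 j
  simp [dilate]

lemma dilate_dilate (a : Fin (n + 1) → ℕ) (s t : ℝ) (z : Fin (n + 1) → ℂ) :
    dilate a s (dilate a t z) = dilate a (s + t) z := by
  ext1 j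
  simp only [dilate, smul_smul, ← Real.exp_add]
  congr 2
  ring

lemma sum_dilate_pow {a : Fin (n + 1) → ℕ} (ha : ∀ j, 0 < a j) (t : ℝ) (z : Fin (n + 1) → ℂ) :
    ∑ j, dilate a t z j ^ a j = Real.exp t * ∑ j, z j ^ a j := by
  rw [Finset.mul_sum]
  refine Finset.sum_congr rfl fun j _ => ?_
  have h : (a j : ℝ) ≠ 0 := Nat.cast_ne_zero.2 (ha j).ne'
  simp only [dilate, Complex.real_smul, mul_pow]
  rw [← Complex.ofReal_pow, ← Real.exp_nat_mul, mul_div_cancel₀ _ h]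

/-- The function `s² |z₀|² + |z₁|² + ⋯ + |z_n|²` of the point `z` moved by a dilation. -/
def dilatedNorm (a : Fin (n + 1) → ℕ) (q : (ℝ × (Fin (n + 1) → ℂ)) × ℝ) : ℝ :=
  ∑ j, cylWeight q.1.1 j * (Real.exp (q.2 / a j) ^ 2 * ‖q.1.2 j‖ ^ 2)

lemma dilatedNorm_eq (a : Fin (n + 1) → ℕ) (s t : ℝ) (z : Fin (n + 1) → ℂ) :
    dilatedNorm a ((s, z), t) = ∑ j, cylWeight s j * ‖dilate a t z j‖ ^ 2 := by
  simp only [dilatedNorm, dilate, norm_smul, mul_pow, Real.norm_eq_abs, sq_abs]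

lemma contDiff_dilatedNorm (a : Fin (n + 1) → ℕ) : ContDiff ℝ ∞ (dilatedNorm a) := by
  refine ContDiff.sum fun j _ => ?_
  refine ((contDiff_cylWeight j).comp (contDiff_fst.comp contDiff_fst)).mul (ContDiff.mul ?_ ?_)
  · exact ((contDiff_snd.div_const _).exp).pow 2
  · exact ((contDiff_apply ℝ ℂ j).comp (contDiff_snd.comp contDiff_fst)).norm_sq ℝ

lemma hasDerivAt_dilatedNorm (a : Fin (n + 1) → ℕ) (s t : ℝ) (z : Fin (n + 1) → ℂ) :
    HasDerivAt (fun t => dilatedNorm a ((s, z), t))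
      (2 * rePair (fun j => cylWeight s j / a j) (dilate a t z) (dilate a t z)) t := by
  refine (HasDerivAt.fun_sum fun j _ => ((((hasDerivAt_id t).div_const (a j : ℝ)).exp.pow 2).mul_const
    (‖z j‖ ^ 2)).const_mul (cylWeight s j)).congr_deriv ?_
  rw [rePair_self, Finset.mul_sum]
  refine Finset.sum_congr rfl fun j _ => ?_
  simp only [dilate, norm_smul, mul_pow, Real.norm_eq_abs, sq_abs, id]
  ring

lemma proj₀_ne_zero_iff {z : Fin (n + 1) → ℂ} : proj₀ z ≠ 0 ↔ ∃ j : Fin n, z j.succ ≠ 0 :=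
  Function.ne_iff

lemma proj₀_dilate_ne_zero {a : Fin (n + 1) → ℕ} {z : Fin (n + 1) → ℂ} (hz : proj₀ z ≠ 0) (t : ℝ) :
    proj₀ (dilate a t z) ≠ 0 := by
  rw [proj₀_ne_zero_iff] at *
  obtain ⟨j, hj⟩ := hz
  exact ⟨j, by simp [dilate, hj, -Complex.real_smul, (Real.exp_pos _).ne']⟩

lemma rePair_cylWeight_pos {z : Fin (n + 1) → ℂ} (hz : proj₀ z ≠ 0) (s : ℝ) :
    0 < rePair (cylWeight s) z z := by
  obtain ⟨j, hj⟩ := proj₀_ne_zero_iff.1 hz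
  exact rePair_self_pos (cylWeight_nonneg s) (j := j.succ) (by simp) hj

/-- The derivative is a weighted sum of squares in which the coordinates z₁, …, z_n have positive
weight for every s, including s = 0. -/
lemma strictMono_dilatedNorm {a : Fin (n + 1) → ℕ} (ha : ∀ j, 0 < a j) (s : ℝ)
    {z : Fin (n + 1) → ℂ} (hz : proj₀ z ≠ 0) : StrictMono fun t => dilatedNorm a ((s, z), t) := by
  refine strictMono_of_hasDerivAt_pos (fun t => hasDerivAt_dilatedNorm a s t z) fun t => ?_
  have := rePair_div_pos ha (cylWeight_nonneg s)
    (rePair_cylWeight_pos (proj₀_dilate_ne_zero (a := a) hz t) s)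
  positivity

lemma exists_dilatedNorm_eq_one {a : Fin (n + 1) → ℕ} (ha : ∀ j, 0 < a j) (s : ℝ)
    {z : Fin (n + 1) → ℂ} (hz : proj₀ z ≠ 0) : ∃ t, dilatedNorm a ((s, z), t) = 1 := by
  have hcont : Continuous fun t => dilatedNorm a ((s, z), t) :=
    continuous_iff_continuousAt.2 fun t => (hasDerivAt_dilatedNorm a s t z).continuousAt
  refine mem_range_of_exists_le_of_exists_ge hcont ?_ ?_
  · have h : Tendsto (fun t => dilatedNorm a ((s, z), t)) atBot (𝓝 0) := by
      have h0 : (0 : ℝ) = ∑ j, cylWeight s j * (0 ^ 2 * ‖z j‖ ^ 2) := by simp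
      rw [h0]
      refine tendsto_finsetSum _ fun j _ => Tendsto.const_mul _
        (Tendsto.mul_const _ (Tendsto.pow ?_ 2))
      exact Real.tendsto_exp_atBot.comp (tendsto_id.atBot_div_const (Nat.cast_pos.2 (ha j)))
    obtain ⟨t, ht⟩ := (h.eventually (gt_mem_nhds one_pos)).exists
    exact ⟨t, ht.le⟩
  · obtain ⟨j, hj⟩ := proj₀_ne_zero_iff.1 hz
    -- At this time the coordinate j.succ has modulus 1, so its term alone already contributes 1.
    refine ⟨a j.succ * Real.log ‖z j.succ‖⁻¹, ?_⟩
    have h := Finset.single_le_sum (s := Finset.univ) (f := fun i => cylWeight s i *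
      (Real.exp (a j.succ * Real.log ‖z j.succ‖⁻¹ / a i) ^ 2 * ‖z i‖ ^ 2))
      (fun i _ => mul_nonneg (cylWeight_nonneg s i) (by positivity)) (Finset.mem_univ j.succ)
    refine le_trans (le_of_eq ?_) h
    have h1 : (a j.succ : ℝ) ≠ 0 := Nat.cast_ne_zero.2 (ha _).ne'
    have h2 : 0 < ‖z j.succ‖ := norm_pos_iff.2 hj
    simp only [cylWeight_succ]
    rw [mul_div_cancel_left₀ _ h1, Real.exp_log (by positivity)]
    field_simp

open Classical in
/-- The time at which the dilation of `z` reaches the ellipsoid with parameter `s`. -/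
def time (a : Fin (n + 1) → ℕ) (s : ℝ) (z : Fin (n + 1) → ℂ) : ℝ :=
  if h : ∃ t, dilatedNorm a ((s, z), t) = 1 then h.choose else 0

variable {a : Fin (n + 1) → ℕ}

lemma dilatedNorm_time (ha : ∀ j, 0 < a j) (s : ℝ) {z : Fin (n + 1) → ℂ} (hz : proj₀ z ≠ 0) :
    dilatedNorm a ((s, z), time a s z) = 1 := by
  have h := exists_dilatedNorm_eq_one ha s hz
  rw [time, dif_pos h]
  exact h.choose_spec

lemma eq_time (ha : ∀ j, 0 < a j) {s t : ℝ} {z : Fin (n + 1) → ℂ} (hz : proj₀ z ≠ 0)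
    (h : dilatedNorm a ((s, z), t) = 1) : t = time a s z :=
  (strictMono_dilatedNorm ha s hz).injective (h.trans (dilatedNorm_time ha s hz).symm)

lemma continuous_proj₀ : Continuous (proj₀ : (Fin (n + 1) → ℂ) → Fin n → ℂ) :=
  continuous_pi fun j => continuous_apply j.succ

lemma eventually_proj₀_ne_zero {z : Fin (n + 1) → ℂ} (hz : proj₀ z ≠ 0) :
    ∀ᶠ x in 𝓝 z, proj₀ x ≠ 0 := continuous_proj₀.continuousAt.eventually_ne hz

/-- Joint smoothness in s and z makes the later path of forms smooth near [0, 1] × M. It is the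
implicit function theorem, the derivative in t being positive and the solution unique. -/
lemma contDiffAt_time (ha : ∀ j, 0 < a j) (s : ℝ) {z : Fin (n + 1) → ℂ} (hz : proj₀ z ≠ 0) :
    ContDiffAt ℝ ∞ (fun q : ℝ × (Fin (n + 1) → ℂ) => time a q.1 q.2) (s, z) := by
  refine contDiffAt_of_implicit (contDiff_dilatedNorm a)
    (hasDerivAt_dilatedNorm a s (time a s z) z) ?_ ?_
  · have := rePair_div_pos ha (cylWeight_nonneg s)
      (rePair_cylWeight_pos (proj₀_dilate_ne_zero (a := a) hz (time a s z)) s)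
    positivity
  · filter_upwards [continuousAt_snd.eventually (eventually_proj₀_ne_zero hz)] with q hq t ht
    exact eq_time ha hq (ht.trans (dilatedNorm_time ha s hz))

lemma time_dilate (ha : ∀ j, 0 < a j) (s t : ℝ) {z : Fin (n + 1) → ℂ} (hz : proj₀ z ≠ 0) :
    time a s (dilate a t z) = time a s z - t := by
  refine (eq_time ha (proj₀_dilate_ne_zero hz t) ?_).symm
  rw [dilatedNorm_eq, dilate_dilate, sub_add_cancel, ← dilatedNorm_eq]
  exact dilatedNorm_time ha s hz

lemma time_eq_zero (ha : ∀ j, 0 < a j) {s : ℝ} {z : Fin (n + 1) → ℂ} (hz : proj₀ z ≠ 0)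
    (h : z ∈ level a (cylWeight s)) : time a s z = 0 := by
  refine (eq_time ha hz ?_).symm
  rw [dilatedNorm_eq, dilate_zero]
  exact h.2

/-- The projection of the variety to the ellipsoid with parameter `s` along the dilations. -/
def straighten (a : Fin (n + 1) → ℕ) (s : ℝ) (z : Fin (n + 1) → ℂ) : Fin (n + 1) → ℂ :=
  dilate a (time a s z) z

lemma straighten_mem_level (ha : ∀ j, 0 < a j) (s : ℝ) {z : Fin (n + 1) → ℂ} (hz : proj₀ z ≠ 0)
    (h : ∑ j, z j ^ a j = 0) : straighten a s z ∈ level a (cylWeight s) := by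
  refine ⟨?_, ?_⟩
  · rw [straighten, sum_dilate_pow ha, h, mul_zero]
  · rw [straighten, ← dilatedNorm_eq]
    exact dilatedNorm_time ha s hz

lemma straighten_straighten (ha : ∀ j, 0 < a j) {s t : ℝ} {z : Fin (n + 1) → ℂ}
    (hz : proj₀ z ≠ 0) (h : z ∈ level a (cylWeight s)) :
    straighten a s (straighten a t z) = z := by
  rw [straighten, straighten, dilate_dilate, time_dilate ha _ _ hz, sub_add_cancel,
    time_eq_zero ha hz h, dilate_zero]

lemma contDiffAt_straighten (ha : ∀ j, 0 < a j) (s : ℝ) {z : Fin (n + 1) → ℂ} (hz : proj₀ z ≠ 0) :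
    ContDiffAt ℝ ∞ (straighten a s) z := by
  have hT : ContDiffAt ℝ ∞ (time a s) z :=
    ContDiffAt.comp (g := fun q : ℝ × (Fin (n + 1) → ℂ) => time a q.1 q.2) (f := fun z => (s, z)) z
      (contDiffAt_time ha s hz) (contDiffAt_const.prodMk contDiffAt_id)
  refine contDiffAt_pi.2 fun j => ?_
  exact (hT.div_const _).exp.smul (contDiff_apply ℝ ℂ j).contDiffAt

lemma proj₀_ne_zero_of_mem_cylinder {z : Fin (n + 1) → ℂ} (hz : z ∈ cylinderBrieskorn a) :
    proj₀ z ≠ 0 := by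
  intro h
  have := hz.2
  rw [h] at this
  simp [unitSphere] at this

/-- If z₁, …, z_n vanish, the equation forces z₀ = 0, contradicting the unit norm. -/
lemma proj₀_ne_zero_of_mem_brieskorn (ha : ∀ j, 0 < a j) {z : Fin (n + 1) → ℂ}
    (hz : z ∈ brieskorn a) : proj₀ z ≠ 0 := by
  intro h
  have h1 : ∀ j : Fin n, z j.succ = 0 := fun j => congrFun h j
  have h2 := hz.1
  have h3 := hz.2
  simp only [unitSphere, mem_ofPred_eq, Fin.sum_univ_succ, h1] at h2 h3
  simp [(ha _).ne'] at h2 h3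
  simp [h2] at h3

/-- The dilations identify the intersections of the variety with the cylinder and the sphere. -/
lemma isDiffeo_straighten (ha : ∀ j, 0 < a j) :
    IsDiffeo (straighten a 1) (cylinderBrieskorn a) (brieskorn a) ∧
      IsDiffeo (straighten a 0) (brieskorn a) (cylinderBrieskorn a) ∧
      InvOn (straighten a 0) (straighten a 1) (cylinderBrieskorn a) (brieskorn a) := by
  have h1 : MapsTo (straighten a 1) (cylinderBrieskorn a) (brieskorn a) := fun z hz => by
    rw [brieskorn_eq_level_cylWeight]
    exact straighten_mem_level ha 1 (proj₀_ne_zero_of_mem_cylinder hz) hz.1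
  have h0 : MapsTo (straighten a 0) (brieskorn a) (cylinderBrieskorn a) := fun z hz => by
    rw [cylinderBrieskorn_eq_level]
    exact straighten_mem_level ha 0 (proj₀_ne_zero_of_mem_brieskorn ha hz) hz.1
  have hs1 : SmoothNear (cylinderBrieskorn a) (straighten a 1) := by
    rw [smoothNear_iff]
    intro z hz
    filter_upwards [eventually_proj₀_ne_zero (proj₀_ne_zero_of_mem_cylinder hz)] with x hx
    exact contDiffAt_straighten ha 1 hx
  have hs0 : SmoothNear (brieskorn a) (straighten a 0) := by
    rw [smoothNear_iff]
    intro z hz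
    filter_upwards [eventually_proj₀_ne_zero (proj₀_ne_zero_of_mem_brieskorn ha hz)] with x hx
    exact contDiffAt_straighten ha 0 hx
  have hinv : InvOn (straighten a 0) (straighten a 1) (cylinderBrieskorn a) (brieskorn a) := by
    refine ⟨fun z hz => ?_, fun z hz => ?_⟩
    · exact straighten_straighten ha (proj₀_ne_zero_of_mem_cylinder hz)
        (by rwa [← cylinderBrieskorn_eq_level])
    · exact straighten_straighten ha (proj₀_ne_zero_of_mem_brieskorn ha hz)
        (by rwa [← brieskorn_eq_level_cylWeight])
  exact ⟨⟨hs1, h1, _, hs0, h0, hinv⟩, ⟨hs0, h0, _, hs1, h1, hinv.symm⟩, hinv⟩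

end Dilation

/-! ### The path of one-forms from the cylinder to the sphere -/

section Path

variable {n : ℕ} {a : Fin (n + 1) → ℕ}

/-- The coefficients of `pathForm`. -/
def pathCoeff (a : Fin (n + 1) → ℕ) (s : ℝ) (z : Fin (n + 1) → ℂ) (j : Fin (n + 1)) : ℝ :=
  a j * (cylWeight s j * Real.exp (time a s z / a j) ^ 2)

/-- The pull-back of the contact form of the ellipsoid with parameter `s` by `straighten a s`. -/
def pathForm (a : Fin (n + 1) → ℕ) (s : ℝ) : OneForm (Fin (n + 1) → ℂ) :=
  fun z => ∑ j, pathCoeff a s z j • theta j z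

lemma pathForm_apply (s : ℝ) (z v : Fin (n + 1) → ℂ) :
    pathForm a s z v = imPair (pathCoeff a s z) z v := by
  simp [pathForm, imPair, theta_apply]

lemma pathCoeff_nonneg (s : ℝ) (z : Fin (n + 1) → ℂ) (j : Fin (n + 1)) :
    0 ≤ pathCoeff a s z j :=
  mul_nonneg (Nat.cast_nonneg _) (mul_nonneg (cylWeight_nonneg s j) (by positivity))

lemma pathCoeff_div (ha : ∀ j, 0 < a j) (s : ℝ) (z : Fin (n + 1) → ℂ) :
    (fun j => pathCoeff a s z j / a j) =
      fun j => cylWeight s j * Real.exp (time a s z / a j) ^ 2 := by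
  ext j
  have : (a j : ℝ) ≠ 0 := Nat.cast_ne_zero.2 (ha j).ne'
  rw [pathCoeff, mul_div_cancel_left₀ _ this]

/-- This is the equation defining `time`. It normalizes `pathForm a s` to have value 1 on i times
the Euler vector. -/
lemma rePair_pathCoeff_self (ha : ∀ j, 0 < a j) (s : ℝ) {z : Fin (n + 1) → ℂ} (hz : proj₀ z ≠ 0) :
    rePair (fun j => pathCoeff a s z j / a j) z z = 1 := by
  rw [pathCoeff_div ha, rePair_self, ← dilatedNorm_time ha s hz]
  simp only [dilatedNorm, mul_assoc]

lemma rePair_pathCoeff_pos (ha : ∀ j, 0 < a j) (s : ℝ) {z : Fin (n + 1) → ℂ} (hz : proj₀ z ≠ 0) :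
    0 < rePair (fun j => pathCoeff a s z j / a j / a j) z z :=
  rePair_div_pos ha (fun j => div_nonneg (pathCoeff_nonneg s z j) (Nat.cast_nonneg _))
    (by rw [rePair_pathCoeff_self ha s hz]; exact one_pos)

lemma contDiffAt_time_slice (ha : ∀ j, 0 < a j) (s : ℝ) {z : Fin (n + 1) → ℂ} (hz : proj₀ z ≠ 0) :
    ContDiffAt ℝ ∞ (time a s) z :=
  ContDiffAt.comp (g := fun q : ℝ × (Fin (n + 1) → ℂ) => time a q.1 q.2) (f := fun z => (s, z)) z
    (contDiffAt_time ha s hz) (contDiffAt_const.prodMk contDiffAt_id)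

lemma hasFDerivAt_exp_time (ha : ∀ j, 0 < a j) (s : ℝ) {z : Fin (n + 1) → ℂ} (hz : proj₀ z ≠ 0)
    (b : ℝ) : HasFDerivAt (fun x => Real.exp (time a s x / b))
      ((Real.exp (time a s z / b) / b) • fderiv ℝ (time a s) z) z := by
  have h := ((contDiffAt_time_slice ha s hz).differentiableAt (by simp)).hasFDerivAt
  refine ((h.mul_const b⁻¹).exp).congr_fderiv ?_
  rw [smul_smul]
  rfl

/-- Implicit differentiation of the identity that the dilated norm at `time` is 1. -/
lemma fderiv_time (ha : ∀ j, 0 < a j) (s : ℝ) {z : Fin (n + 1) → ℂ} (hz : proj₀ z ≠ 0)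
    (v : Fin (n + 1) → ℂ) :
    fderiv ℝ (time a s) z v =
      - rePair (fun j => pathCoeff a s z j / a j) z v /
        rePair (fun j => pathCoeff a s z j / a j / a j) z z := by
  have h1 : HasFDerivAt (fun x : Fin (n + 1) → ℂ => ∑ j, cylWeight s j *
      (Real.exp (time a s x / a j) ^ 2 * ‖x j‖ ^ 2)) _ z :=
    HasFDerivAt.fun_sum fun j _ => ((((hasFDerivAt_exp_time ha s hz (a j)).pow 2).mul
      ((ContinuousLinearMap.proj (R := ℝ) j :
        (Fin (n + 1) → ℂ) →L[ℝ] ℂ).hasFDerivAt (x := z)).norm_sq).const_mul (cylWeight s j))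
  have h2 : (fun x : Fin (n + 1) → ℂ => ∑ j, cylWeight s j *
      (Real.exp (time a s x / a j) ^ 2 * ‖x j‖ ^ 2)) =ᶠ[𝓝 z] fun _ => 1 := by
    filter_upwards [eventually_proj₀_ne_zero hz] with x hx
    exact dilatedNorm_time ha s hx
  have h3 := h1.unique ((hasFDerivAt_const (1 : ℝ) z).congr_of_eventuallyEq h2)
  have h4 := DFunLike.congr_fun h3 v
  rw [eq_div_iff (rePair_pathCoeff_pos ha s hz).ne']
  have h5 : fderiv ℝ (time a s) z v * rePair (fun j => pathCoeff a s z j / a j / a j) z z +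
      rePair (fun j => pathCoeff a s z j / a j) z v = 0 := by
    have h6 : ∀ j, pathCoeff a s z j / a j = cylWeight s j * Real.exp (time a s z / a j) ^ 2 :=
      fun j => congrFun (pathCoeff_div ha s z) j
    rw [rePair_self]
    simp only [h6, rePair, Finset.mul_sum, ← Finset.sum_add_distrib]
    simp only [sum_apply, zero_apply] at h4
    rw [← mul_eq_zero_iff_left (two_ne_zero' ℝ), ← h4, Finset.mul_sum]
    refine Finset.sum_congr rfl fun j _ => ?_
    simp [Complex.inner]
    ring
  linarith

/-- As for a pull-back by `straighten a s`: up to the factors exp(time/a_j), which are absorbed in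
the coefficients, its derivative sends v to v plus the derivative of `time` along v times the Euler
vector. -/
lemma dForm_pathForm (ha : ∀ j, 0 < a j) (s : ℝ) {z : Fin (n + 1) → ℂ} (hz : proj₀ z ≠ 0)
    (v w : Fin (n + 1) → ℂ) :
    dForm (pathForm a s) z v w = 2 * imPair (pathCoeff a s z)
      (v + fderiv ℝ (time a s) z v • euler a z) (w + fderiv ℝ (time a s) z w • euler a z) := by
  have hC : ∀ j, HasFDerivAt (fun x => pathCoeff a s x j) _ z := fun j =>
    (((hasFDerivAt_exp_time ha s hz (a j)).pow 2).const_mul (cylWeight s j)).const_mul (a j : ℝ)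
  have := dForm_sum_smul_theta (C := fun j x => pathCoeff a s x j)
    (fun j => (hC j).differentiableAt) v w
  refine this.trans ?_
  simp only [(hC _).fderiv, imPair, Finset.mul_sum]
  refine Finset.sum_congr rfl fun j _ => ?_
  have : (a j : ℝ) ≠ 0 := Nat.cast_ne_zero.2 (ha j).ne'
  simp [theta_apply, euler, pathCoeff]
  field_simp
  ring

lemma fderiv_straighten (ha : ∀ j, 0 < a j) (s : ℝ) {z : Fin (n + 1) → ℂ} (hz : proj₀ z ≠ 0)
    (v : Fin (n + 1) → ℂ) (j : Fin (n + 1)) :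
    fderiv ℝ (straighten a s) z v j =
      Real.exp (time a s z / a j) • (v + fderiv ℝ (time a s) z v • euler a z) j := by
  have h : HasFDerivAt (straighten a s) _ z := hasFDerivAt_pi.2 fun j =>
    (hasFDerivAt_exp_time ha s hz (a j)).smul
      ((ContinuousLinearMap.proj (R := ℝ) j : (Fin (n + 1) → ℂ) →L[ℝ] ℂ).hasFDerivAt (x := z))
  rw [h.fderiv]
  simp [euler]
  ring

/-- The derivative of `time` only contributes a real multiple of the Euler vector, on which the form
vanishes. -/
lemma pullback_straighten (ha : ∀ j, 0 < a j) {z : Fin (n + 1) → ℂ} (hz : proj₀ z ≠ 0)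
    (v : Fin (n + 1) → ℂ) :
    pullback (straighten a 1) (weightedForm a) z v = pathForm a 1 z v := by
  rw [pullback_apply, weightedForm_apply, pathForm_apply]
  simp only [imPair, fderiv_straighten ha 1 hz]
  refine Finset.sum_congr rfl fun j _ => ?_
  have h : cylWeight (1 : ℝ) j = 1 := by
    refine Fin.cases ?_ (fun i => ?_) j <;> simp
  simp only [straighten, dilate, pathCoeff, h]
  generalize Real.exp (time a 1 z / a j) = e
  simp [euler]
  ring

/-- The projection `proj₀` as a linear map. -/
def projL (n : ℕ) : (Fin (n + 1) → ℂ) →L[ℝ] (Fin n → ℂ) :=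
  ContinuousLinearMap.pi fun j => ContinuousLinearMap.proj j.succ

lemma coe_projL : (projL n : (Fin (n + 1) → ℂ) → Fin n → ℂ) = proj₀ := rfl

lemma contDiff_proj₀ : ContDiff ℝ ∞ (proj₀ : (Fin (n + 1) → ℂ) → Fin n → ℂ) :=
  (projL n).contDiff

lemma fderiv_proj₀ (z v : Fin (n + 1) → ℂ) : fderiv ℝ proj₀ z v = proj₀ v := by
  rw [← coe_projL, ContinuousLinearMap.fderiv]

/-- On the cylinder the time for s = 0 is zero, and the weight s² of z₀ vanishes. -/
lemma pullback_proj₀ (ha : ∀ j, 0 < a j) {z : Fin (n + 1) → ℂ} (hz : z ∈ cylinderBrieskorn a)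
    (v : Fin (n + 1) → ℂ) :
    pathForm a 0 z v = pullback proj₀ (weightedForm fun j : Fin n => a j.succ) z v := by
  have h0 : time a 0 z = 0 := time_eq_zero ha (proj₀_ne_zero_of_mem_cylinder hz)
    (by rwa [← cylinderBrieskorn_eq_level])
  rw [pullback_apply, weightedForm_apply, pathForm_apply, fderiv_proj₀]
  simp [imPair, pathCoeff, h0, Fin.sum_univ_succ, proj₀]

lemma contDiffAt_pathCoeff (ha : ∀ j, 0 < a j) (s : ℝ) {z : Fin (n + 1) → ℂ} (hz : proj₀ z ≠ 0)
    (j : Fin (n + 1)) :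
    ContDiffAt ℝ ∞ (fun q : ℝ × (Fin (n + 1) → ℂ) => pathCoeff a q.1 q.2 j) (s, z) :=
  contDiffAt_const.mul ((ContDiffAt.comp (g := fun s => cylWeight s j) (f := Prod.fst) (s, z)
    (contDiff_cylWeight j).contDiffAt contDiffAt_fst).mul
      (((contDiffAt_time ha s hz).div_const _).exp.pow 2))

lemma contDiffAt_pathForm (ha : ∀ j, 0 < a j) (s : ℝ) {z : Fin (n + 1) → ℂ} (hz : proj₀ z ≠ 0) :
    ContDiffAt ℝ ∞ (fun q : ℝ × (Fin (n + 1) → ℂ) => pathForm a q.1 q.2) (s, z) :=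
  ContDiffAt.sum fun j _ => (contDiffAt_pathCoeff ha s hz j).smul
    ((theta j).contDiff.comp contDiff_snd).contDiffAt

end Path

/-! ### Continuity of the pairings and of the test vector -/

section Continuity

variable {m : ℕ} {Q : Type*} [TopologicalSpace Q] {q₀ : Q} {c : Q → Fin m → ℝ}
  {z v : Q → Fin m → ℂ}

lemma continuousAt_rePair (hc : ∀ j, ContinuousAt (fun q => c q j) q₀) (hz : ContinuousAt z q₀)
    (hv : ContinuousAt v q₀) : ContinuousAt (fun q => rePair (c q) (z q) (v q)) q₀ := by
  refine tendsto_finsetSum _ fun j _ => (hc j).mul (Complex.continuous_re.continuousAt.comp ?_)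
  exact ((continuous_apply j).continuousAt.comp hz).star.mul
    ((continuous_apply j).continuousAt.comp hv)

lemma continuousAt_imPair (hc : ∀ j, ContinuousAt (fun q => c q j) q₀) (hz : ContinuousAt z q₀)
    (hv : ContinuousAt v q₀) : ContinuousAt (fun q => imPair (c q) (z q) (v q)) q₀ := by
  refine tendsto_finsetSum _ fun j _ => (hc j).mul (Complex.continuous_im.continuousAt.comp ?_)
  exact ((continuous_apply j).continuousAt.comp hz).star.mul
    ((continuous_apply j).continuousAt.comp hv)

lemma continuousAt_euler (a : Fin m → ℕ) (hz : ContinuousAt z q₀) :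
    ContinuousAt (fun q => euler a (z q)) q₀ :=
  continuousAt_pi.2 fun j =>
    ((continuous_apply j).continuousAt.comp hz).const_smul ((a j : ℝ)⁻¹ : ℝ)

lemma continuousAt_testCoeff (a : Fin m → ℕ) (hc : ∀ j, ContinuousAt (fun q => c q j) q₀)
    (hz : ContinuousAt z q₀) (hv : ContinuousAt v q₀)
    (h : rePair (fun j => c q₀ j / a j / a j) (z q₀) (z q₀) ≠ 0) :
    ContinuousAt (fun q => testCoeff (c q) (z q) (v q) a) q₀ :=
  (continuousAt_imPair (fun j => (hc j).div_const _) hz hv).div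
    (continuousAt_rePair (fun j => ((hc j).div_const _).div_const _) hz hz) h

lemma continuousAt_testVector (a : Fin m → ℕ) (hc : ∀ j, ContinuousAt (fun q => c q j) q₀)
    (hz : ContinuousAt z q₀) (hv : ContinuousAt v q₀) {τ : Q → ℝ} (hτ : ContinuousAt τ q₀)
    (h : rePair (fun j => c q₀ j / a j / a j) (z q₀) (z q₀) ≠ 0) :
    ContinuousAt (fun q => testVector (c q) (z q) (v q) a (τ q)) q₀ := by
  have h1 := continuousAt_testCoeff a hc hz hv h
  have h2 := continuousAt_euler a hz
  simp only [testVector]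
  have h3 : ContinuousAt (fun q => Complex.I • v q) q₀ := hv.const_smul Complex.I
  have h4 : ContinuousAt (fun q => Complex.I • euler a (z q)) q₀ := h2.const_smul Complex.I
  have h5 : ContinuousAt (fun q => testCoeff (c q) (z q) (v q) a • euler a (z q)) q₀ := h1.smul h2
  have h6 : ContinuousAt (fun q => (-τ q) • Complex.I • euler a (z q)) q₀ := hτ.neg.smul h4
  exact (h3.add h5).add h6

end Continuity

/-! ### Degenerate directions of the path of forms -/

section Path

variable {n : ℕ} {a : Fin (n + 1) → ℕ}

/-- The image of a tangent vector under the derivative of `straighten a s`, rescaled. -/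
def pathLift (a : Fin (n + 1) → ℕ) (s : ℝ) (z v : Fin (n + 1) → ℂ) : Fin (n + 1) → ℂ :=
  v + (- rePair (fun j => pathCoeff a s z j / a j) z v /
    rePair (fun j => pathCoeff a s z j / a j / a j) z z) • euler a z

/-- The projection along the dilations to the tangent space of the cylinder. -/
def flatten (a : Fin (n + 1) → ℕ) (z w : Fin (n + 1) → ℂ) : Fin (n + 1) → ℂ :=
  w + (- rePair (cylWeight 0) z w / rePair (fun j => cylWeight 0 j / a j) z z) • euler a z

lemma mem_tangentAt_cylinder (ha : ∀ j, 0 < a j) {z : Fin (n + 1) → ℂ}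
    (hz : z ∈ cylinderBrieskorn a) {v : Fin (n + 1) → ℂ} :
    v ∈ tangentAt (cylinderBrieskorn a) z ↔ brDeriv a z v = 0 ∧ rePair (cylWeight 0) z v = 0 := by
  rw [cylinderBrieskorn_eq_level] at hz ⊢
  exact mem_tangentAt_level ha (cylWeight_nonneg 0) hz

lemma isSubmanifold_cylinder (ha : ∀ j, 0 < a j) : IsSubmanifold 3 (cylinderBrieskorn a) := by
  rw [cylinderBrieskorn_eq_level]
  exact isSubmanifold_level ha (cylWeight_nonneg 0)

lemma rePair_pathLift (ha : ∀ j, 0 < a j) (s : ℝ) {z : Fin (n + 1) → ℂ} (hz : proj₀ z ≠ 0)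
    (v : Fin (n + 1) → ℂ) :
    rePair (fun j => pathCoeff a s z j / a j) z (pathLift a s z v) = 0 := by
  rw [pathLift, rePair_add, rePair_smul, rePair_euler,
    div_mul_cancel₀ _ (rePair_pathCoeff_pos ha s hz).ne']
  ring

lemma brDeriv_pathLift (ha : ∀ j, 0 < a j) (s : ℝ) {z : Fin (n + 1) → ℂ}
    (hz : ∑ j, z j ^ a j = 0) (v : Fin (n + 1) → ℂ) :
    brDeriv a z (pathLift a s z v) = brDeriv a z v := by
  rw [pathLift, map_add, map_smul, brDeriv_euler ha, hz, smul_zero, add_zero]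

lemma brDeriv_flatten (ha : ∀ j, 0 < a j) {z : Fin (n + 1) → ℂ}
    (hz : ∑ j, z j ^ a j = 0) (v : Fin (n + 1) → ℂ) :
    brDeriv a z (flatten a z v) = brDeriv a z v := by
  rw [flatten, map_add, map_smul, brDeriv_euler ha, hz, smul_zero, add_zero]

lemma rePair_flatten (ha : ∀ j, 0 < a j) {z : Fin (n + 1) → ℂ} (hz : proj₀ z ≠ 0)
    (v : Fin (n + 1) → ℂ) : rePair (cylWeight 0) z (flatten a z v) = 0 := by
  have h := rePair_div_pos ha (cylWeight_nonneg 0) (rePair_cylWeight_pos hz 0)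
  rw [flatten, rePair_add, rePair_smul, rePair_euler, div_mul_cancel₀ _ h.ne']
  ring

/-- Both operations add a multiple of the Euler vector, and `pathLift` is the projection along it
that fixes vectors orthogonal to z for the weights of `pathForm`. -/
lemma pathLift_flatten (ha : ∀ j, 0 < a j) (s : ℝ) {z : Fin (n + 1) → ℂ} (hz : proj₀ z ≠ 0)
    {v : Fin (n + 1) → ℂ} (hv : rePair (fun j => pathCoeff a s z j / a j) z v = 0) :
    pathLift a s z (flatten a z v) = v := by
  rw [pathLift, flatten, rePair_add, hv, rePair_smul, rePair_euler, zero_add, ← neg_mul,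
    mul_div_assoc, div_self (rePair_pathCoeff_pos ha s hz).ne', mul_one, neg_smul,
    add_neg_cancel_right]

lemma imPair_flatten (c : Fin (n + 1) → ℝ) (z v : Fin (n + 1) → ℂ) :
    imPair c z (flatten a z v) = imPair c z v := by
  rw [flatten, imPair_add, imPair_smul, imPair_euler, imPair_self, mul_zero, add_zero]

lemma imPair_pathLift (s : ℝ) (c : Fin (n + 1) → ℝ) (z v : Fin (n + 1) → ℂ) :
    imPair c z (pathLift a s z v) = imPair c z v := by
  rw [pathLift, imPair_add, imPair_smul, imPair_euler, imPair_self, mul_zero, add_zero]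

lemma flatten_testVector (c : Fin (n + 1) → ℝ) (z v : Fin (n + 1) → ℂ) (τ : ℝ) :
    flatten a z (testVector c z v a τ) =
      flatten a z (testVector c z v a 0) - τ • (Complex.I • euler a z) := by
  have h : testVector c z v a τ = testVector c z v a 0 + (-τ) • (Complex.I • euler a z) := by
    simp [testVector]
  rw [h, flatten, rePair_add, rePair_smul, rePair_I_smul, imPair_euler, imPair_self, neg_zero,
    mul_zero, add_zero, flatten]
  module

/-- The tangent vector that is paired with `v` in the proof of the contact condition. -/
def pathTest (a : Fin (n + 1) → ℕ) (s : ℝ) (z v : Fin (n + 1) → ℂ) (τ : ℝ) : Fin (n + 1) → ℂ :=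
  flatten a z (testVector (pathCoeff a s z) z (pathLift a s z v) a τ)

/-- The square that measures the nondegeneracy of `pathForm a s`. -/
def pathSquare (a : Fin (n + 1) → ℕ) (s : ℝ) (z v : Fin (n + 1) → ℂ) : ℝ :=
  ∑ j, pathCoeff a s z j * ‖pathLift a s z v j -
    testCoeff (pathCoeff a s z) z (pathLift a s z v) a • (Complex.I • euler a z) j‖ ^ 2

lemma pathSquare_nonneg (s : ℝ) (z v : Fin (n + 1) → ℂ) : 0 ≤ pathSquare a s z v :=
  Finset.sum_nonneg fun j _ => mul_nonneg (pathCoeff_nonneg s z j) (by positivity)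

lemma pathTest_mem (ha : ∀ j, 0 < a j) (s : ℝ) {z v : Fin (n + 1) → ℂ}
    (hz : z ∈ cylinderBrieskorn a) (hv : v ∈ tangentAt (cylinderBrieskorn a) z) (τ : ℝ) :
    pathTest a s z v τ ∈ tangentAt (cylinderBrieskorn a) z := by
  rw [mem_tangentAt_cylinder ha hz] at *
  refine ⟨?_, rePair_flatten ha (proj₀_ne_zero_of_mem_cylinder hz) _⟩
  rw [pathTest, brDeriv_flatten ha hz.1]
  exact brDeriv_testVector ha hz.1 ((brDeriv_pathLift ha s hz.1 v).trans hv.1) _ τ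

/-- Lifting undoes the flattening, so the exterior derivative sees the original test vector and
`imPair_testVector_eq` applies. -/
lemma dForm_pathForm_pathTest (ha : ∀ j, 0 < a j) (s : ℝ) {z : Fin (n + 1) → ℂ}
    (hz : proj₀ z ≠ 0) (v : Fin (n + 1) → ℂ) (τ : ℝ) :
    dForm (pathForm a s) z v (pathTest a s z v τ) = 2 * pathSquare a s z v := by
  have h1 : 0 < rePair (fun j => pathCoeff a s z j / a j) z z := by
    rw [rePair_pathCoeff_self ha s hz]; exact one_pos
  rw [dForm_pathForm ha s hz]
  simp only [fderiv_time ha s hz]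
  change 2 * imPair _ (pathLift a s z v) (pathLift a s z (pathTest a s z v τ)) = _
  rw [pathTest, pathLift_flatten ha s hz (rePair_testVector ha (pathCoeff_nonneg s z) h1 τ),
    imPair_testVector_eq ha (pathCoeff_nonneg s z) h1 (rePair_pathLift ha s hz v), pathSquare]

lemma pathForm_pathTest (ha : ∀ j, 0 < a j) (s : ℝ) {z : Fin (n + 1) → ℂ} (hz : proj₀ z ≠ 0)
    (v : Fin (n + 1) → ℂ) (τ : ℝ) :
    pathForm a s z (pathTest a s z v τ) = rePair (pathCoeff a s z) z (pathLift a s z v) - τ := by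
  rw [pathForm_apply, pathTest, imPair_flatten, imPair_testVector, rePair_pathCoeff_self ha s hz,
    mul_one]

lemma pathTest_eq (s : ℝ) (z v : Fin (n + 1) → ℂ) (τ : ℝ) :
    pathTest a s z v τ = pathTest a s z v 0 - τ • (Complex.I • euler a z) :=
  flatten_testVector _ _ _ _

lemma I_smul_euler_mem (ha : ∀ j, 0 < a j) {z : Fin (n + 1) → ℂ} (hz : z ∈ cylinderBrieskorn a) :
    Complex.I • euler a z ∈ tangentAt (cylinderBrieskorn a) z := by
  rw [mem_tangentAt_cylinder ha hz, brDeriv_smul, brDeriv_euler ha, hz.1, rePair_I_smul,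
    imPair_euler, imPair_self]
  simp

lemma pathForm_I_smul_euler (ha : ∀ j, 0 < a j) (s : ℝ) {z : Fin (n + 1) → ℂ} (hz : proj₀ z ≠ 0) :
    pathForm a s z (Complex.I • euler a z) = 1 := by
  rw [pathForm_apply, imPair_I_smul, rePair_euler, rePair_pathCoeff_self ha s hz]

lemma pathCoeff_succ_pos (ha : ∀ j, 0 < a j) (s : ℝ) (z : Fin (n + 1) → ℂ) (j : Fin n) :
    0 < pathCoeff a s z j.succ := by
  have := ha j.succ
  simp only [pathCoeff, cylWeight_succ]
  positivity

/-- The only tangent vectors on which the square and the form vanish are those along which the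
branched covering is singular. -/
lemma eq_single_of_pathSquare_eq_zero (ha : ∀ j, 0 < a j) {s : ℝ} {z v : Fin (n + 1) → ℂ}
    (hz : z ∈ cylinderBrieskorn a) (hv : v ∈ tangentAt (cylinderBrieskorn a) z) (hv0 : v ≠ 0)
    (hA : pathForm a s z v = 0) (hS : pathSquare a s z v = 0) :
    s = 0 ∧ z 0 = 0 ∧ 2 ≤ a 0 ∧ v = Pi.single 0 (v 0) ∧ v 0 ≠ 0 ∧
      pathTest a s z v (rePair (pathCoeff a s z) z (pathLift a s z v)) =
        Pi.single 0 (Complex.I * v 0) := by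
  have hz' := proj₀_ne_zero_of_mem_cylinder hz
  rw [mem_tangentAt_cylinder ha hz] at hv
  set κ := testCoeff (pathCoeff a s z) z (pathLift a s z v) a with hκ
  have h1 : ∀ j, pathCoeff a s z j * ‖pathLift a s z v j - κ • (Complex.I • euler a z) j‖ ^ 2
      = 0 := by
    have h := hS
    rw [pathSquare, Finset.sum_eq_zero_iff_of_nonneg fun j _ =>
      mul_nonneg (pathCoeff_nonneg s z j) (by positivity)] at h
    exact fun j => h j (Finset.mem_univ j)
  have h2 : ∀ j, pathCoeff a s z j ≠ 0 → pathLift a s z v j = (κ • (Complex.I • euler a z)) j := by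
    intro j hj
    have := h1 j
    simpa [hj, sub_eq_zero] using this
  -- Coordinates with coefficient zero do not enter the form, so its value on v is its value on κ i
  -- E, which is κ by normalization. But v is in the kernel.
  have h3 : κ = 0 := by
    have h4 : imPair (pathCoeff a s z) z (pathLift a s z v) =
        imPair (pathCoeff a s z) z (κ • (Complex.I • euler a z)) := by
      refine Finset.sum_congr rfl fun j _ => ?_
      by_cases hj : pathCoeff a s z j = 0
      · simp [hj]
      · rw [h2 j hj]
    rw [imPair_pathLift, ← pathForm_apply, hA, imPair_smul, imPair_I_smul, rePair_euler,
      rePair_pathCoeff_self ha s hz', mul_one] at h4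
    exact h4.symm
  have h5 : ∀ j, pathCoeff a s z j ≠ 0 → pathLift a s z v j = 0 := fun j hj => by
    rw [h2 j hj, h3]; simp
  set p := - rePair (fun j => pathCoeff a s z j / a j) z v /
    rePair (fun j => pathCoeff a s z j / a j / a j) z z with hp
  have hlift : pathLift a s z v = v + p • euler a z := rfl
  -- The lift v + pE vanishes in the coordinates z₁, …, z_n, while v is tangent to the cylinder and
  -- E is transverse to it.
  have hp0 : p = 0 := by
    have h6 : rePair (cylWeight 0) z (pathLift a s z v) = 0 := by
      refine Finset.sum_eq_zero fun j _ => ?_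
      refine Fin.cases ?_ (fun i => ?_) j
      · simp
      · rw [h5 i.succ (pathCoeff_succ_pos ha s z i).ne']
        simp
    rw [hlift, rePair_add, hv.2, rePair_smul, rePair_euler, zero_add] at h6
    exact (mul_eq_zero.1 h6).resolve_right
      (rePair_div_pos ha (cylWeight_nonneg 0) (rePair_cylWeight_pos hz' 0)).ne'
  have hlv : pathLift a s z v = v := by rw [hlift, hp0, zero_smul, add_zero]
  rw [hlv] at h5
  have hvs : ∀ i : Fin n, v i.succ = 0 := fun i => h5 _ (pathCoeff_succ_pos ha s z i).ne'
  have hve : v = Pi.single 0 (v 0) := by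
    ext1 j
    refine Fin.cases ?_ (fun i => ?_) j
    · simp
    · simp [hvs i]
  have hv00 : v 0 ≠ 0 := fun h => hv0 (by rw [hve, h, Pi.single_zero])
  have hs : s = 0 := by
    by_contra hs
    refine hv00 (h5 0 ?_)
    have := ha 0
    simp only [pathCoeff, cylWeight_zero]
    positivity
  -- With v along the z₀-axis, tangency to the variety is a single equation. As v₀ ≠ 0, it forces z₀
  -- = 0 and excludes a₀ = 1.
  have hb : (a 0 : ℂ) * z 0 ^ (a 0 - 1) * v 0 = 0 := by
    have := hv.1
    rw [brDeriv_apply, Fin.sum_univ_succ] at this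
    simpa [hvs] using this
  have hz0 : z 0 ^ (a 0 - 1) = 0 := by
    have h : (a 0 : ℂ) ≠ 0 := Nat.cast_ne_zero.2 (ha 0).ne'
    simpa [h, hv00] using hb
  have ha0 : a 0 - 1 ≠ 0 := fun h => by simp [h] at hz0
  refine ⟨hs, eq_zero_of_pow_eq_zero hz0, by omega, hve, hv00, ?_⟩
  have hc0 : pathCoeff a s z 0 = 0 := by simp [pathCoeff, hs]
  have hre : rePair (pathCoeff a s z) z v = 0 := by
    refine Finset.sum_eq_zero fun j _ => ?_
    refine Fin.cases ?_ (fun i => ?_) j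
    · simp [hc0]
    · simp [hvs i]
  have hI : Complex.I • v = Pi.single 0 (Complex.I * v 0) := by
    rw [hve]
    ext1 j
    refine Fin.cases ?_ (fun i => ?_) j
    · simp
    · simp
  have him : rePair (cylWeight 0) z (Complex.I • v) = 0 := by
    refine Finset.sum_eq_zero fun j _ => ?_
    refine Fin.cases ?_ (fun i => ?_) j
    · simp
    · simp [hvs i]
  rw [hlv] at hκ
  rw [pathTest, hlv, hre, testVector, ← hκ, h3, zero_smul, neg_zero, zero_smul, add_zero, add_zero,
    flatten, him, neg_zero, zero_div, zero_smul, add_zero, hI]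

end Path

/-! ### Perturbation of the path by a positive form -/

section Path

variable {n : ℕ} {a : Fin (n + 1) → ℕ}

/-- The path of contact forms from `f^* α + ε γ` to the contact form of the Brieskorn manifold. -/
def perturbedForm (a : Fin (n + 1) → ℕ) (γ : OneForm (Fin (n + 1) → ℂ)) (ε s : ℝ) :
    OneForm (Fin (n + 1) → ℂ) := fun z => pathForm a s z + ((1 - s) * ε) • γ z

lemma perturbedForm_apply (γ : OneForm (Fin (n + 1) → ℂ)) (ε s : ℝ) (z v : Fin (n + 1) → ℂ) :
    perturbedForm a γ ε s z v = pathForm a s z v + (1 - s) * ε * γ z v := by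
  simp [perturbedForm]

lemma differentiableAt_pathForm (ha : ∀ j, 0 < a j) (s : ℝ) {z : Fin (n + 1) → ℂ}
    (hz : proj₀ z ≠ 0) : DifferentiableAt ℝ (pathForm a s) z := by
  have h := (contDiffAt_pathForm ha s hz).differentiableAt (by simp)
  exact DifferentiableAt.comp (g := fun q : ℝ × (Fin (n + 1) → ℂ) => pathForm a q.1 q.2)
    (f := fun z => (s, z)) z h ((differentiableAt_const s).prodMk differentiableAt_id)

lemma dForm_perturbedForm (ha : ∀ j, 0 < a j) {γ : OneForm (Fin (n + 1) → ℂ)} (ε s : ℝ)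
    {z : Fin (n + 1) → ℂ} (hz : proj₀ z ≠ 0) (hγ : DifferentiableAt ℝ γ z)
    (v w : Fin (n + 1) → ℂ) :
    dForm (perturbedForm a γ ε s) z v w =
      dForm (pathForm a s) z v w + (1 - s) * ε * dForm γ z v w := by
  have hd : DifferentiableAt ℝ (fun x => ((1 - s) * ε) • γ x) z :=
    hγ.const_smul ((1 - s) * ε)
  rw [← dForm_const_smul hγ]
  exact dForm_add (differentiableAt_pathForm ha s hz) hd v w

/-- This is the local statement at ε = 0 that compactness will make uniform. Failing to be tangent
or to lie in the kernel is an open condition on X₀. Otherwise the exterior derivative pairs X with a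
continuously varying kernel vector Y to give 2 · `pathSquare` + (1 - s)ε dγ(X, Y). Either the first
term is positive at the limit point and dominates, or X₀ spans a singular direction, s₀ = 0 and Y is
i X₀, so that dγ(X, Y) > 0. -/
lemma eventually_perturbedForm_nondegenerate (ha : ∀ j, 0 < a j) {γ : OneForm (Fin (n + 1) → ℂ)}
    (hγ : SmoothNear (cylinderBrieskorn a) γ)
    (hpos : ∀ z ∈ cylinderBrieskorn a, z 0 = 0 → 2 ≤ a 0 → ∀ x : ℂ, x ≠ 0 →
      0 < dForm γ z (Pi.single 0 x) (Pi.single 0 (Complex.I * x)))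
    {s₀ : ℝ} {z₀ X₀ : Fin (n + 1) → ℂ} (hz₀ : z₀ ∈ cylinderBrieskorn a)
    (hX₀ : X₀ ≠ 0) :
    ∀ᶠ p : ℝ × (ℝ × (Fin (n + 1) → ℂ) × (Fin (n + 1) → ℂ)) in 𝓝 (0, (s₀, z₀, X₀)), 0 < p.1 →
      p.2.1 ∈ Icc (0 : ℝ) 1 → p.2.2.1 ∈ cylinderBrieskorn a →
      p.2.2.2 ∈ tangentAt (cylinderBrieskorn a) p.2.2.1 →
      perturbedForm a γ p.1 p.2.1 p.2.2.1 p.2.2.2 = 0 →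
      (∀ w ∈ tangentAt (cylinderBrieskorn a) p.2.2.1,
        perturbedForm a γ p.1 p.2.1 p.2.2.1 w = 0 →
          dForm (perturbedForm a γ p.1 p.2.1) p.2.2.1 p.2.2.2 w = 0) → False := by
  have hz₀' := proj₀_ne_zero_of_mem_cylinder hz₀
  set p₀ : ℝ × (ℝ × (Fin (n + 1) → ℂ) × (Fin (n + 1) → ℂ)) := (0, (s₀, z₀, X₀)) with hp₀
  have hε : ContinuousAt (fun p : ℝ × (ℝ × (Fin (n + 1) → ℂ) × (Fin (n + 1) → ℂ)) => p.1) p₀ :=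
    continuousAt_fst
  have hs : ContinuousAt (fun p : ℝ × (ℝ × (Fin (n + 1) → ℂ) × (Fin (n + 1) → ℂ)) => p.2.1) p₀ := by
    fun_prop
  have hz : ContinuousAt
      (fun p : ℝ × (ℝ × (Fin (n + 1) → ℂ) × (Fin (n + 1) → ℂ)) => p.2.2.1) p₀ := by
    fun_prop
  have hX : ContinuousAt
      (fun p : ℝ × (ℝ × (Fin (n + 1) → ℂ) × (Fin (n + 1) → ℂ)) => p.2.2.2) p₀ := by
    fun_prop
  have hC : ∀ j, ContinuousAt (fun p : ℝ × (ℝ × (Fin (n + 1) → ℂ) × (Fin (n + 1) → ℂ)) =>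
      pathCoeff a p.2.1 p.2.2.1 j) p₀ := fun j =>
    ContinuousAt.comp (g := fun q : ℝ × (Fin (n + 1) → ℂ) => pathCoeff a q.1 q.2 j)
      (f := fun p : ℝ × (ℝ × (Fin (n + 1) → ℂ) × (Fin (n + 1) → ℂ)) => (p.2.1, p.2.2.1))
      (contDiffAt_pathCoeff ha s₀ hz₀' j).continuousAt (hs.prodMk hz)
  have hγc : ContinuousAt (fun p : ℝ × (ℝ × (Fin (n + 1) → ℂ) × (Fin (n + 1) → ℂ)) =>
      γ p.2.2.1) p₀ :=
    ContinuousAt.comp (g := γ) (hγ.contDiffAt hz₀).continuousAt hz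
  have hDγc : ContinuousAt (fun p : ℝ × (ℝ × (Fin (n + 1) → ℂ) × (Fin (n + 1) → ℂ)) =>
      fderiv ℝ γ p.2.2.1) p₀ :=
    ContinuousAt.comp (g := fderiv ℝ γ) (hγ.fderiv.contDiffAt hz₀).continuousAt hz
  have hμ : ContinuousAt (fun p : ℝ × (ℝ × (Fin (n + 1) → ℂ) × (Fin (n + 1) → ℂ)) =>
      (1 - p.2.1) * p.1) p₀ := (continuousAt_const.sub hs).mul hε
  by_cases hT : brDeriv a z₀ X₀ = 0 ∧ rePair (cylWeight 0) z₀ X₀ = 0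
  swap
  · have h1 : ContinuousAt (fun p : ℝ × (ℝ × (Fin (n + 1) → ℂ) × (Fin (n + 1) → ℂ)) =>
        (brDeriv a p.2.2.1 p.2.2.2, rePair (cylWeight 0) p.2.2.1 p.2.2.2)) p₀ := by
      refine ContinuousAt.prodMk ?_ (continuousAt_rePair (fun j => continuousAt_const) hz hX)
      simp only [brDeriv_apply]
      fun_prop
    have h2 : (brDeriv a z₀ X₀, rePair (cylWeight 0) z₀ X₀) ≠ (0, 0) :=
      fun h => hT (by simpa using h)
    filter_upwards [h1.eventually_ne h2] with p hp _ _ hpz hpX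
    rw [mem_tangentAt_cylinder ha hpz] at hpX
    exact absurd (Prod.ext hpX.1 hpX.2) hp
  have hX₀T : X₀ ∈ tangentAt (cylinderBrieskorn a) z₀ := (mem_tangentAt_cylinder ha hz₀).2 hT
  by_cases hA : pathForm a s₀ z₀ X₀ = 0
  swap
  · have h1 : ContinuousAt (fun p : ℝ × (ℝ × (Fin (n + 1) → ℂ) × (Fin (n + 1) → ℂ)) =>
        perturbedForm a γ p.1 p.2.1 p.2.2.1 p.2.2.2) p₀ := by
      simp only [perturbedForm_apply, pathForm_apply]
      exact (continuousAt_imPair hC hz hX).add (hμ.mul (hγc.clm_apply hX))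
    have h2 : perturbedForm a γ p₀.1 p₀.2.1 p₀.2.2.1 p₀.2.2.2 ≠ 0 := by
      simpa [perturbedForm_apply, hp₀] using hA
    filter_upwards [h1.eventually_ne h2] with p hp _ _ _ _ h
    exact absurd h hp
  have hQ := (rePair_pathCoeff_pos ha s₀ hz₀').ne'
  have hL : ContinuousAt (fun p : ℝ × (ℝ × (Fin (n + 1) → ℂ) × (Fin (n + 1) → ℂ)) =>
      pathLift a p.2.1 p.2.2.1 p.2.2.2) p₀ := by
    have h1 := continuousAt_rePair (fun j => (hC j).div_const (a j : ℝ)) hz hX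
    have h2 := continuousAt_rePair
      (fun j => ((hC j).div_const (a j : ℝ)).div_const (a j : ℝ)) hz hz
    exact hX.add ((h1.neg.div h2 hQ).smul (continuousAt_euler a hz))
  have hR : ContinuousAt (fun p : ℝ × (ℝ × (Fin (n + 1) → ℂ) × (Fin (n + 1) → ℂ)) =>
      Complex.I • euler a p.2.2.1) p₀ := (continuousAt_euler a hz).const_smul Complex.I
  have hY0 : ContinuousAt (fun p : ℝ × (ℝ × (Fin (n + 1) → ℂ) × (Fin (n + 1) → ℂ)) =>
      pathTest a p.2.1 p.2.2.1 p.2.2.2 0) p₀ := by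
    have h1 := continuousAt_testVector a hC hz hL
      (continuousAt_const (y := (0 : ℝ))) hQ
    have h2 := continuousAt_rePair (c := fun _ => cylWeight 0) (fun j => continuousAt_const) hz h1
    have h3 := continuousAt_rePair (c := fun _ => fun j => cylWeight 0 j / (a j : ℝ))
      (fun j => continuousAt_const) hz hz
    have h4 := rePair_div_pos ha (cylWeight_nonneg 0) (rePair_cylWeight_pos hz₀' 0)
    exact h1.add ((h2.neg.div h3 h4.ne').smul (continuousAt_euler a hz))
  -- D is the value of the perturbed form on i times the Euler vector, equal to 1 at ε = 0. The form
  -- takes on `pathTest` the value of the numerator of τ minus τ D, so this τ makes Y a kernel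
  -- vector.
  set D : ℝ × (ℝ × (Fin (n + 1) → ℂ) × (Fin (n + 1) → ℂ)) → ℝ := fun p =>
    1 + (1 - p.2.1) * p.1 * γ p.2.2.1 (Complex.I • euler a p.2.2.1) with hD
  have hDc : ContinuousAt D p₀ := continuousAt_const.add (hμ.mul (hγc.clm_apply hR))
  have hD0 : D p₀ = 1 := by simp [hD, hp₀]
  set τ : ℝ × (ℝ × (Fin (n + 1) → ℂ) × (Fin (n + 1) → ℂ)) → ℝ := fun p =>
    (rePair (pathCoeff a p.2.1 p.2.2.1) p.2.2.1 (pathLift a p.2.1 p.2.2.1 p.2.2.2) +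
      (1 - p.2.1) * p.1 * γ p.2.2.1 (pathTest a p.2.1 p.2.2.1 p.2.2.2 0)) / D p with hτ
  have hτc : ContinuousAt τ p₀ :=
    ((continuousAt_rePair hC hz hL).add (hμ.mul (hγc.clm_apply hY0))).div hDc
      (by rw [hD0]; exact one_ne_zero)
  set Y : ℝ × (ℝ × (Fin (n + 1) → ℂ) × (Fin (n + 1) → ℂ)) → (Fin (n + 1) → ℂ) := fun p =>
    pathTest a p.2.1 p.2.2.1 p.2.2.2 (τ p) with hY
  have hYc : ContinuousAt Y p₀ := by
    have : Y = fun p => pathTest a p.2.1 p.2.2.1 p.2.2.2 0 -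
        τ p • (Complex.I • euler a p.2.2.1) := funext fun p => pathTest_eq _ _ _ _
    rw [this]
    exact hY0.sub (hτc.smul hR)
  have hdγ : ContinuousAt (fun p => dForm γ p.2.2.1 p.2.2.2 (Y p)) p₀ :=
    ((hDγc.clm_apply hX).clm_apply hYc).sub ((hDγc.clm_apply hYc).clm_apply hX)
  have hSc : ContinuousAt (fun p : ℝ × (ℝ × (Fin (n + 1) → ℂ) × (Fin (n + 1) → ℂ)) =>
      pathSquare a p.2.1 p.2.2.1 p.2.2.2) p₀ := by
    have h1 := continuousAt_testCoeff a hC hz hL hQ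
    refine tendsto_finsetSum _ fun j _ => (hC j).mul (ContinuousAt.pow (ContinuousAt.norm ?_) 2)
    exact ((continuous_apply j).continuousAt.comp hL).sub
      (h1.smul ((continuous_apply j).continuousAt.comp hR))
  have key : ∀ᶠ p in 𝓝 p₀, 0 < p.1 →
      0 < 2 * pathSquare a p.2.1 p.2.2.1 p.2.2.2 +
        (1 - p.2.1) * p.1 * dForm γ p.2.2.1 p.2.2.2 (Y p) := by
    -- In the degenerate case s is close to 0, so the factor 1 - s is positive; in the other case
    -- the sign of the perturbation is irrelevant.
    rcases (pathSquare_nonneg (a := a) s₀ z₀ X₀).eq_or_lt with hS | hS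
    · obtain ⟨h1, h2, h3, h4, h5, h6⟩ := eq_single_of_pathSquare_eq_zero ha hz₀ hX₀T hX₀ hA hS.symm
      have hY₀ : Y p₀ = Pi.single 0 (Complex.I * X₀ 0) := by
        rw [← h6]
        simp [hY, hτ, hp₀, hD]
      have h7 : 0 < dForm γ p₀.2.2.1 p₀.2.2.2 (Y p₀) := by
        rw [hY₀]
        change 0 < dForm γ z₀ X₀ _
        conv_rhs => rw [h4]
        simpa using hpos z₀ hz₀ h2 h3 _ h5
      have h8 : p₀.2.1 < 1 := by
        change s₀ < 1
        rw [h1]; exact one_pos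
      filter_upwards [hdγ.eventually (lt_mem_nhds h7), hs.eventually (gt_mem_nhds h8)]
        with p hp1 hp2 hp3
      have h9 : 0 < 1 - p.2.1 := by linarith
      have := pathSquare_nonneg (a := a) p.2.1 p.2.2.1 p.2.2.2
      positivity
    · have h1 : ContinuousAt (fun p : ℝ × (ℝ × (Fin (n + 1) → ℂ) × (Fin (n + 1) → ℂ)) =>
          2 * pathSquare a p.2.1 p.2.2.1 p.2.2.2 +
          (1 - p.2.1) * p.1 * dForm γ p.2.2.1 p.2.2.2 (Y p)) p₀ :=
        (continuousAt_const.mul hSc).add (hμ.mul hdγ)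
      filter_upwards [h1.eventually (lt_mem_nhds (a := 0) (by simp [hp₀, hS]))] with p hp _ using hp
  filter_upwards [key, hDc.eventually_ne (by rw [hD0]; exact one_ne_zero)]
    with p hp hDp hp1 hp2 hp3 hp4 _ hp6
  have hpz := proj₀_ne_zero_of_mem_cylinder hp3
  have hYp : Y p = pathTest a p.2.1 p.2.2.1 p.2.2.2 0 - τ p • (Complex.I • euler a p.2.2.1) :=
    pathTest_eq _ _ _ _
  have h1 := hp6 (Y p) (pathTest_mem ha _ hp3 hp4 _) (by
    rw [perturbedForm_apply, pathForm_pathTest ha _ hpz, hYp, map_sub, map_smul, smul_eq_mul]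
    have : τ p * D p = rePair (pathCoeff a p.2.1 p.2.2.1) p.2.2.1
        (pathLift a p.2.1 p.2.2.1 p.2.2.2) +
      (1 - p.2.1) * p.1 * γ p.2.2.1 (pathTest a p.2.1 p.2.2.1 p.2.2.2 0) :=
      div_mul_cancel₀ _ hDp
    simp only [hD] at this
    linear_combination -this)
  rw [dForm_perturbedForm ha _ _ hpz (hγ.differentiableAt hp3), dForm_pathForm_pathTest ha _ hpz]
    at h1
  exact absurd h1 (hp hp1).ne'

end Path

/-! ### Forms with the same restriction to M -/

section Congr

variable {E F : Type*} [NormedAddCommGroup E] [NormedSpace ℝ E] [NormedAddCommGroup F]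
  [NormedSpace ℝ F]

lemma IsContactForm.congr {M : Set E} {α β : OneForm E} (hα : IsContactForm M α)
    (hret : ∀ p ∈ M, ∃ r, IsLocalRetraction M p r) (hβ : SmoothNear M β)
    (h : ∀ p ∈ M, ∀ v ∈ tangentAt M p, α p v = β p v) : IsContactForm M β := by
  refine ⟨hβ, fun p hp => ?_⟩
  obtain ⟨⟨v, hv, hv0⟩, hnd⟩ := hα.2 p hp
  refine ⟨⟨v, hv, by rwa [← h p hp v hv]⟩, fun v hv hv0 hw => ?_⟩
  refine hnd v hv (by rwa [h p hp v hv]) fun w hwT hw0 => ?_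
  obtain ⟨r, hr⟩ := hret p hp
  rw [hr.dForm_eq hp (hα.1.differentiableAt hp) (hβ.differentiableAt hp)
    (eventually_nhdsWithin_of_forall h) hv hwT]
  exact hw w hwT (by rwa [← h p hp w hwT])

lemma IsContactomorphism.congr {M : Set E} {N : Set F} {φ : E → F} {α α' : OneForm E}
    {β β' : OneForm F} (h : IsContactomorphism φ M α N β)
    (hα : ∀ p ∈ M, ∀ v ∈ tangentAt M p, α p v = α' p v)
    (hβ : ∀ p ∈ N, ∀ v ∈ tangentAt N p, β p v = β' p v) : IsContactomorphism φ M α' N β' := by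
  refine ⟨h.1, fun p hp => ?_⟩
  obtain ⟨c, hc, hcv⟩ := h.2 p hp
  refine ⟨c, hc, fun v hv => ?_⟩
  have h1 := hcv v hv
  rw [pullback_apply] at h1 ⊢
  rw [← hα p hp v hv, ← h1]
  exact (hβ _ (h.1.2.1 hp) _ (fderiv_mem_tangentAt (h.1.1.contDiffAt hp) h.1.2.1 hv)).symm

lemma AreIsotopic.congr {M : Set E} {α α' β β' : OneForm E} (h : AreIsotopic M α β)
    (hα : ∀ p ∈ M, ∀ v ∈ tangentAt M p, α p v = α' p v)
    (hβ : ∀ p ∈ M, ∀ v ∈ tangentAt M p, β p v = β' p v) : AreIsotopic M α' β' := by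
  obtain ⟨Φ, h1, h2, h3, h4⟩ := h
  exact ⟨Φ, h1, h2, h3, h4.congr hα hβ⟩

end Congr

/-! ### Uniform contact condition and the isotopy -/

section Path

variable {n : ℕ} {a : Fin (n + 1) → ℕ}

/-- The coordinates z₁, …, z_n are bounded by 1, and the equation then gives |z₀|^a₀ ≤ n. -/
lemma isCompact_cylinderBrieskorn (ha : ∀ j, 0 < a j) : IsCompact (cylinderBrieskorn a) := by
  refine Metric.isCompact_of_isClosed_isBounded ?_ ?_
  · rw [cylinderBrieskorn_eq_level]
    exact isClosed_level a _
  · refine (Metric.isBounded_closedBall (x := (0 : Fin (n + 1) → ℂ)) (r := n + 1)).subset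
      fun z hz => ?_
    rw [mem_closedBall_zero_iff]
    have h1 : ∀ j : Fin n, ‖z j.succ‖ ≤ 1 := fun j => by
      have h1 : ‖z j.succ‖ ^ 2 ≤ ∑ j, ‖proj₀ z j‖ ^ 2 :=
        Finset.single_le_sum (f := fun j => ‖proj₀ z j‖ ^ 2) (fun i _ => by positivity)
          (Finset.mem_univ j)
      rw [show ∑ j, ‖proj₀ z j‖ ^ 2 = 1 from hz.2] at h1
      exact (sq_le_one_iff₀ (norm_nonneg _)).1 h1
    refine (pi_norm_le_iff_of_nonneg (by positivity)).2 fun j => ?_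
    refine Fin.cases ?_ (fun i => (h1 i).trans (by simp)) j
    rcases le_total ‖z 0‖ 1 with h | h
    · exact h.trans (by simp)
    · have h2 := hz.1
      rw [Fin.sum_univ_succ, add_eq_zero_iff_eq_neg] at h2
      calc ‖z 0‖ ≤ ‖z 0‖ ^ a 0 := le_self_pow₀ h (ha 0).ne'
        _ = ‖∑ i : Fin n, z i.succ ^ a i.succ‖ := by rw [← norm_pow, h2, norm_neg]
        _ ≤ ∑ i : Fin n, ‖z i.succ ^ a i.succ‖ := norm_sum_le _ _
        _ ≤ ∑ i : Fin n, (1 : ℝ) := Finset.sum_le_sum fun i _ => by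
            rw [norm_pow]; exact pow_le_one₀ (norm_nonneg _) (h1 i)
        _ ≤ n + 1 := by simp

lemma contDiffAt_perturbedForm (ha : ∀ j, 0 < a j) {γ : OneForm (Fin (n + 1) → ℂ)} (ε s : ℝ)
    {z : Fin (n + 1) → ℂ} (hz : proj₀ z ≠ 0) (hγ : ContDiffAt ℝ ∞ γ z) :
    ContDiffAt ℝ ∞ (fun q : ℝ × (Fin (n + 1) → ℂ) => perturbedForm a γ ε q.1 q.2) (s, z) :=
  (contDiffAt_pathForm ha s hz).add (((contDiffAt_const.sub contDiffAt_fst).mul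
    contDiffAt_const).smul (ContDiffAt.comp (g := γ) (f := Prod.snd) (s, z) hγ contDiffAt_snd))

lemma smoothNear_perturbedForm (ha : ∀ j, 0 < a j) {γ : OneForm (Fin (n + 1) → ℂ)} (ε : ℝ)
    (hγ : SmoothNear (cylinderBrieskorn a) γ) :
    SmoothNear (Icc (0 : ℝ) 1 ×ˢ cylinderBrieskorn a)
      (fun q : ℝ × (Fin (n + 1) → ℂ) => perturbedForm a γ ε q.1 q.2) := by
  rw [smoothNear_iff] at hγ ⊢
  rintro ⟨s, z⟩ ⟨-, hz⟩
  filter_upwards [continuousAt_snd.eventually (hγ z hz), continuousAt_snd.eventually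
    (eventually_proj₀_ne_zero (proj₀_ne_zero_of_mem_cylinder hz))] with q h1 h2
  exact contDiffAt_perturbedForm ha ε q.1 h2 h1

/-- Degeneracy is homogeneous in v, so unit vectors suffice. The local statements over the compact
set of triples (s, z, v) combine to one ε₀. A similar argument keeps the form nonzero on i times the
Euler vector. -/
lemma exists_isContactForm_perturbedForm (ha : ∀ j, 0 < a j) {γ : OneForm (Fin (n + 1) → ℂ)}
    (hγ : SmoothNear (cylinderBrieskorn a) γ)
    (hpos : ∀ z ∈ cylinderBrieskorn a, z 0 = 0 → 2 ≤ a 0 → ∀ x : ℂ, x ≠ 0 →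
      0 < dForm γ z (Pi.single 0 x) (Pi.single 0 (Complex.I * x))) :
    ∃ ε₀ : ℝ, 0 < ε₀ ∧ ∀ ε : ℝ, 0 < ε → ε < ε₀ → ∀ s ∈ Icc (0 : ℝ) 1,
      IsContactForm (cylinderBrieskorn a) (perturbedForm a γ ε s) := by
  have hM := isCompact_cylinderBrieskorn ha
  have h1 : ∀ᶠ ε : ℝ in 𝓝 0, ∀ q ∈ Icc (0 : ℝ) 1 ×ˢ cylinderBrieskorn a,
      1 + (1 - q.1) * ε * γ q.2 (Complex.I • euler a q.2) ≠ 0 := by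
    refine (isCompact_Icc.prod hM).eventually_forall_of_forall_eventually ?_
    rintro ⟨s, z⟩ ⟨-, hz⟩
    have hγc : ContinuousAt (fun p : ℝ × (ℝ × (Fin (n + 1) → ℂ)) => γ p.2.2) (0, (s, z)) :=
      ContinuousAt.comp (g := γ) (f := fun p : ℝ × (ℝ × (Fin (n + 1) → ℂ)) => p.2.2)
        (hγ.contDiffAt hz).continuousAt (by fun_prop)
    have hz : ContinuousAt (fun p : ℝ × (ℝ × (Fin (n + 1) → ℂ)) => p.2.2) (0, (s, z)) := by
      fun_prop
    have hR : ContinuousAt (fun p : ℝ × (ℝ × (Fin (n + 1) → ℂ)) =>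
      Complex.I • euler a p.2.2) (0, (s, z)) := (continuousAt_euler a hz).const_smul Complex.I
    have hμ : ContinuousAt (fun p : ℝ × (ℝ × (Fin (n + 1) → ℂ)) => (1 - p.2.1) * p.1)
      (0, (s, z)) := by fun_prop
    have hc : ContinuousAt (fun p : ℝ × (ℝ × (Fin (n + 1) → ℂ)) =>
        1 + (1 - p.2.1) * p.1 * γ p.2.2 (Complex.I • euler a p.2.2)) (0, (s, z)) :=
      continuousAt_const.add (hμ.mul (hγc.clm_apply hR))
    exact hc.eventually_ne (by simp)
  have h2 := ((isCompact_Icc (a := (0 : ℝ)) (b := 1)).prod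
    (hM.prod (isCompact_sphere (0 : Fin (n + 1) → ℂ) 1))).eventually_forall_of_forall_eventually
    (x₀ := (0 : ℝ)) (P := fun (ε : ℝ) (q : ℝ × (Fin (n + 1) → ℂ) × (Fin (n + 1) → ℂ)) => 0 < ε →
      q.1 ∈ Icc (0 : ℝ) 1 → q.2.1 ∈ cylinderBrieskorn a →
      q.2.2 ∈ tangentAt (cylinderBrieskorn a) q.2.1 →
      perturbedForm a γ ε q.1 q.2.1 q.2.2 = 0 →
      (∀ w ∈ tangentAt (cylinderBrieskorn a) q.2.1, perturbedForm a γ ε q.1 q.2.1 w = 0 →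
        dForm (perturbedForm a γ ε q.1) q.2.1 q.2.2 w = 0) → False)
    fun q hq => eventually_perturbedForm_nondegenerate ha hγ hpos hq.2.1
      (by
        intro h
        have := hq.2.2
        simp [h] at this)
  obtain ⟨ε₀, hε₀, hball⟩ := Metric.eventually_nhds_iff.1 (h1.and h2)
  refine ⟨ε₀, hε₀, fun ε hε hεlt s hs => ?_⟩
  obtain ⟨k1, k2⟩ := hball (y := ε) (by rwa [dist_zero_right, Real.norm_eq_abs, abs_of_pos hε])
  refine ⟨?_, fun z hz => ⟨⟨_, I_smul_euler_mem ha hz, ?_⟩, fun v hv hv0 hnd => ?_⟩⟩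
  · rw [smoothNear_iff] at hγ ⊢
    intro z hz
    filter_upwards [hγ z hz, eventually_proj₀_ne_zero (proj₀_ne_zero_of_mem_cylinder hz)]
      with x hx1 hx2
    exact ContDiffAt.comp (g := fun q : ℝ × (Fin (n + 1) → ℂ) => perturbedForm a γ ε q.1 q.2)
      (f := fun x => (s, x)) x (contDiffAt_perturbedForm ha ε s hx2 hx1)
      (contDiffAt_const.prodMk contDiffAt_id)
  · rw [perturbedForm_apply, pathForm_I_smul_euler ha s (proj₀_ne_zero_of_mem_cylinder hz)]
    exact k1 (s, z) ⟨hs, hz⟩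
  · by_contra hne
    have hn : 0 < ‖v‖ := norm_pos_iff.2 hne
    obtain ⟨r, hr⟩ := (isSubmanifold_cylinder ha).exists_localRetraction hz
    obtain ⟨W, hW⟩ := hr.exists_submodule hz
    refine k2 (s, z, ‖v‖⁻¹ • v) ⟨hs, hz, ?_⟩ hε hs hz ((hW _).2 (W.smul_mem _ ((hW _).1 hv))) ?_ ?_
    · simp [norm_smul, hn.ne']
    · simp [hv0]
    · intro w hw hw0
      have := hnd w hw hw0
      simp only [dForm] at this ⊢
      simp only [map_smul, smul_apply, ← smul_sub, this, smul_zero]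

lemma perturbedForm_zero (ha : ∀ j, 0 < a j) (γ : OneForm (Fin (n + 1) → ℂ)) (ε : ℝ)
    {z : Fin (n + 1) → ℂ} (hz : z ∈ cylinderBrieskorn a) (v : Fin (n + 1) → ℂ) :
    perturbedForm a γ ε 0 z v =
      (pullback proj₀ (weightedForm fun j : Fin n => a j.succ) z + ε • γ z) v := by
  rw [perturbedForm_apply, pullback_proj₀ ha hz]
  simp

lemma perturbedForm_one (γ : OneForm (Fin (n + 1) → ℂ)) (ε : ℝ) :
    perturbedForm a γ ε 1 = pathForm a 1 := by
  ext1 z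
  simp [perturbedForm]

lemma mapsTo_proj₀ (a : Fin (n + 1) → ℕ) :
    MapsTo proj₀ (cylinderBrieskorn a) (unitSphere n) := fun _ hz => hz.2

/-- For small `ε`, the form `f^* α + ε γ` is a contact form whose contact structure is isotopic
to the one transported from the Brieskorn manifold. -/
theorem exists_isotopic_pathForm (ha : ∀ j, 0 < a j) {γ : OneForm (Fin (n + 1) → ℂ)}
    (hγ : SmoothNear (cylinderBrieskorn a) γ)
    (hpos : ∀ z ∈ cylinderBrieskorn a, z 0 = 0 → 2 ≤ a 0 → ∀ x : ℂ, x ≠ 0 →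
      0 < dForm γ z (Pi.single 0 x) (Pi.single 0 (Complex.I * x))) :
    ∃ ε₀ : ℝ, 0 < ε₀ ∧ ∀ ε : ℝ, 0 < ε → ε < ε₀ →
      IsContactForm (cylinderBrieskorn a)
        (fun x => pullback proj₀ (weightedForm fun j : Fin n => a j.succ) x + ε • γ x) ∧
      AreIsotopic (cylinderBrieskorn a)
        (fun x => pullback proj₀ (weightedForm fun j : Fin n => a j.succ) x + ε • γ x)
        (pathForm a 1) := by
  obtain ⟨ε₀, hε₀, h⟩ := exists_isContactForm_perturbedForm ha hγ hpos
  have hret : ∀ p ∈ cylinderBrieskorn a, ∃ r, IsLocalRetraction (cylinderBrieskorn a) p r :=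
    fun p hp => (isSubmanifold_cylinder ha).exists_localRetraction hp
  refine ⟨ε₀, hε₀, fun ε hε hlt => ⟨?_, ?_⟩⟩
  · refine (h ε hε hlt 0 ⟨le_rfl, zero_le_one⟩).congr hret ?_
      fun z hz v _ => perturbedForm_zero ha γ ε hz v
    exact ((smoothNear_of_contDiff contDiff_proj₀ _).pullback (mapsTo_proj₀ a)
      (smoothNear_of_contDiff (contDiff_weightedForm _) _)).add (hγ.const_smul ε)
  · have := areIsotopic_of_path (isCompact_cylinderBrieskorn ha) hret
      (smoothNear_perturbedForm ha ε hγ) (h ε hε hlt)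
    exact this.congr (fun z hz v _ => perturbedForm_zero ha γ ε hz v)
      fun z _ v _ => by rw [perturbedForm_one]

lemma isContactomorphism_straighten (ha : ∀ j, 0 < a j) :
    IsContactomorphism (straighten a 1) (cylinderBrieskorn a) (pathForm a 1) (brieskorn a)
      (weightedForm a) :=
  ⟨(isDiffeo_straighten ha).1, fun z hz => ⟨1, one_pos, fun v _ => by
    rw [pullback_straighten ha (proj₀_ne_zero_of_mem_cylinder hz), one_mul]⟩⟩

end Path

/-! ### The projection as a cyclic branched covering -/

section Covering

variable {n : ℕ} {a : Fin (n + 1) → ℕ}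

/-- The function on the base whose `a₀`-th root is the coordinate `z₀`. -/
def branchFun (a : Fin (n + 1) → ℕ) (y : Fin n → ℂ) : ℂ := -∑ j : Fin n, y j ^ a j.succ

lemma contDiff_branchFun (a : Fin (n + 1) → ℕ) : ContDiff ℝ ∞ (branchFun a) :=
  (contDiff_sum_pow fun j : Fin n => a j.succ).neg

lemma fderiv_branchFun (a : Fin (n + 1) → ℕ) (y v : Fin n → ℂ) :
    fderiv ℝ (branchFun a) y v = - brDeriv (fun j : Fin n => a j.succ) y v := by
  have h : HasFDerivAt (branchFun a) _ y := (hasFDerivAt_sum_pow (fun j : Fin n => a j.succ) y).neg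
  rw [h.fderiv]
  rfl

lemma mem_cylinder_iff {z : Fin (n + 1) → ℂ} :
    z ∈ cylinderBrieskorn a ↔ z 0 ^ a 0 = branchFun a (proj₀ z) ∧ proj₀ z ∈ unitSphere n := by
  simp only [cylinderBrieskorn, mem_ofPred_eq, branchFun, Fin.sum_univ_succ, proj₀]
  rw [add_eq_zero_iff_eq_neg]

lemma mem_branch_iff {y : Fin n → ℂ} (hy : y ∈ unitSphere n) :
    (y ∈ brieskorn fun j : Fin n => a j.succ) ↔ branchFun a y = 0 := by
  simp [brieskorn, branchFun, hy]

lemma proj₀_mem_branch_iff (ha : ∀ j, 0 < a j) {z : Fin (n + 1) → ℂ}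
    (hz : z ∈ cylinderBrieskorn a) :
    (proj₀ z ∈ brieskorn fun j : Fin n => a j.succ) ↔ z 0 = 0 := by
  rw [mem_branch_iff hz.2, ← (mem_cylinder_iff.1 hz).1, pow_eq_zero_iff (ha 0).ne']

lemma brDeriv_succ (z v : Fin (n + 1) → ℂ) :
    brDeriv a z v = a 0 * z 0 ^ (a 0 - 1) * v 0 +
      brDeriv (fun j : Fin n => a j.succ) (proj₀ z) (proj₀ v) := by
  simp [brDeriv_apply, Fin.sum_univ_succ, proj₀]

lemma rePair_cylWeight_zero (z v : Fin (n + 1) → ℂ) :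
    rePair (cylWeight 0) z v = rePair (fun _ => 1) (proj₀ z) (proj₀ v) := by
  simp [rePair, Fin.sum_univ_succ, proj₀]

lemma mem_tangentAt_cylinder_iff (ha : ∀ j, 0 < a j) {z : Fin (n + 1) → ℂ}
    (hz : z ∈ cylinderBrieskorn a) {v : Fin (n + 1) → ℂ} :
    v ∈ tangentAt (cylinderBrieskorn a) z ↔
      a 0 * z 0 ^ (a 0 - 1) * v 0 = fderiv ℝ (branchFun a) (proj₀ z) (proj₀ v) ∧
        proj₀ v ∈ tangentAt (unitSphere n) (proj₀ z) := by
  rw [mem_tangentAt_cylinder ha hz, mem_tangentAt_unitSphere hz.2, brDeriv_succ,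
    rePair_cylWeight_zero, fderiv_branchFun, add_eq_zero_iff_eq_neg]

lemma proj₀_cons (x : ℂ) (y : Fin n → ℂ) : proj₀ (Fin.cons x y : Fin (n + 1) → ℂ) = y := rfl

lemma cons_proj₀ (z : Fin (n + 1) → ℂ) : (Fin.cons (z 0) (proj₀ z) : Fin (n + 1) → ℂ) = z :=
  Fin.cons_self_tail z

lemma surjOn_proj₀ (ha : ∀ j, 0 < a j) : SurjOn proj₀ (cylinderBrieskorn a) (unitSphere n) := by
  intro y hy
  obtain ⟨x, hx⟩ := IsAlgClosed.exists_pow_nat_eq (branchFun a y) (ha 0)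
  exact ⟨Fin.cons x y, mem_cylinder_iff.2 ⟨hx, hy⟩, rfl⟩

lemma bijOn_proj₀ (ha : ∀ j, 0 < a j) {z : Fin (n + 1) → ℂ} (hz : z ∈ cylinderBrieskorn a)
    (hB : proj₀ z ∉ brieskorn fun j : Fin n => a j.succ) :
    BijOn (fun v => fderiv ℝ proj₀ z v) (tangentAt (cylinderBrieskorn a) z)
      (tangentAt (unitSphere n) (proj₀ z)) := by
  have hz0 : z 0 ≠ 0 := fun h => hB ((proj₀_mem_branch_iff ha hz).2 h)
  have ha0 : (a 0 : ℂ) ≠ 0 := Nat.cast_ne_zero.2 (ha 0).ne'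
  have hc : (a 0 : ℂ) * z 0 ^ (a 0 - 1) ≠ 0 := mul_ne_zero ha0 (pow_ne_zero _ hz0)
  simp only [fderiv_proj₀]
  refine ⟨fun v hv => ((mem_tangentAt_cylinder_iff ha hz).1 hv).2, fun v hv w hw h => ?_,
    fun u hu => ?_⟩
  · rw [mem_tangentAt_cylinder_iff ha hz] at hv hw
    have h : proj₀ v = proj₀ w := h
    rw [← cons_proj₀ v, ← cons_proj₀ w, h]
    congr 1
    exact mul_left_cancel₀ hc (by rw [hv.1, hw.1, h])
  · refine ⟨Fin.cons (fderiv ℝ (branchFun a) (proj₀ z) u / (a 0 * z 0 ^ (a 0 - 1))) u,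
      (mem_tangentAt_cylinder_iff ha hz).2 ⟨?_, hu⟩, rfl⟩
    rw [proj₀_cons, Fin.cons_zero, mul_div_cancel₀ _ hc]

/-- The total space is compact, so it suffices that the projection is a local homeomorphism where z₀
≠ 0. The local inverse solves for z₀ by a local inverse of x ↦ x ^ a₀. -/
lemma isCoveringMapOn_proj₀ (ha : ∀ j, 0 < a j) :
    IsCoveringMapOn ((mapsTo_proj₀ a).restrict proj₀ (cylinderBrieskorn a) (unitSphere n))
      {x | (x : Fin n → ℂ) ∉ brieskorn fun j : Fin n => a j.succ} := by
  have : CompactSpace (cylinderBrieskorn a) :=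
    isCompact_iff_compactSpace.1 (isCompact_cylinderBrieskorn ha)
  refine IsCoveringMapOn.of_isLocalHomeomorphOn
    (continuous_proj₀.continuousOn.mapsToRestrict _) ?_
  refine IsLocalHomeomorphOn.mk _ _ fun z hz => ?_
  have hz0 : (z : Fin (n + 1) → ℂ) 0 ≠ 0 := fun h => hz ((proj₀_mem_branch_iff ha z.2).2 h)
  have ha0 : (a 0 : ℂ) ≠ 0 := Nat.cast_ne_zero.2 (ha 0).ne'
  have hd : HasStrictDerivAt (fun x : ℂ => x ^ a 0) (a 0 * (z : Fin (n + 1) → ℂ) 0 ^ (a 0 - 1))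
      ((z : Fin (n + 1) → ℂ) 0) := hasStrictDerivAt_pow _ _
  have hc : (a 0 : ℂ) * (z : Fin (n + 1) → ℂ) 0 ^ (a 0 - 1) ≠ 0 :=
    mul_ne_zero ha0 (pow_ne_zero _ hz0)
  have hd' := hd.hasStrictFDerivAt_equiv hc
  let φ := hd'.toOpenPartialHomeomorph _
  have hφ : ∀ x, φ x = x ^ a 0 := fun x => rfl
  have hbr : Continuous (branchFun a) := (contDiff_branchFun a).continuous
  have hmem : ∀ y : unitSphere n, branchFun a y ∈ φ.target →
      (Fin.cons (φ.symm (branchFun a y)) (y : Fin n → ℂ) : Fin (n + 1) → ℂ) ∈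
        cylinderBrieskorn a := fun y hy => by
    rw [mem_cylinder_iff, Fin.cons_zero, proj₀_cons, ← hφ, φ.right_inv hy]
    exact ⟨rfl, y.2⟩
  classical
  refine ⟨{
    toFun := (mapsTo_proj₀ a).restrict proj₀ (cylinderBrieskorn a) (unitSphere n)
    invFun := fun y => if h : branchFun a y ∈ φ.target then ⟨_, hmem y h⟩ else z
    source := {x | (x : Fin (n + 1) → ℂ) 0 ∈ φ.source}
    target := {y | branchFun a y ∈ φ.target}
    map_source' := fun x hx => ?_
    map_target' := fun y hy => ?_
    left_inv' := fun x hx => ?_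
    right_inv' := fun y hy => ?_
    open_source := φ.open_source.preimage ((continuous_apply 0).comp continuous_subtype_val)
    open_target := φ.open_target.preimage (hbr.comp continuous_subtype_val)
    continuousOn_toFun := (continuous_proj₀.continuousOn.mapsToRestrict _).continuousOn
    continuousOn_invFun := ?_ }, hd'.mem_toOpenPartialHomeomorph_source, fun x _ => rfl⟩
  · have h1 := (mem_cylinder_iff.1 x.2).1
    change branchFun a (proj₀ x) ∈ φ.target
    rw [← h1, ← hφ]
    exact φ.map_source hx
  · have hy' : branchFun a y ∈ φ.target := hy
    simp only [dif_pos hy']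
    exact φ.map_target hy'
  · have h1 := (mem_cylinder_iff.1 x.2).1
    have h2 : branchFun a ((mapsTo_proj₀ a).restrict proj₀ (cylinderBrieskorn a) (unitSphere n) x)
        ∈ φ.target := by
      change branchFun a (proj₀ x) ∈ φ.target
      rw [← h1, ← hφ]
      exact φ.map_source hx
    apply Subtype.ext
    simp only [dif_pos h2]
    change (Fin.cons (φ.symm (branchFun a (proj₀ x))) (proj₀ x) : Fin (n + 1) → ℂ) = x
    rw [← h1, ← hφ, φ.left_inv hx]
    exact cons_proj₀ _
  · have hy' : branchFun a y ∈ φ.target := hy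
    apply Subtype.ext
    simp only [dif_pos hy', MapsTo.val_restrict_apply]
    rfl
  · rw [continuousOn_iff_continuous_domRestrict]
    refine Continuous.subtype_mk (f := fun y : {y : unitSphere n | branchFun a y ∈ φ.target} =>
      (Fin.cons (φ.symm (branchFun a y)) ((y : unitSphere n) : Fin n → ℂ) : Fin (n + 1) → ℂ)) ?_
      (fun y => hmem y.1 y.2) |>.congr fun y => ?_
    · refine continuous_pi fun j => ?_
      refine Fin.cases ?_ (fun i => ?_) j
      · simp only [Fin.cons_zero]
        exact φ.continuousOn_symm.comp_continuous
          (hbr.comp (continuous_subtype_val.comp continuous_subtype_val)) fun y => y.2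
      · simp only [Fin.cons_succ]
        exact (continuous_apply i).comp (continuous_subtype_val.comp continuous_subtype_val)
    · have hy : branchFun a (y : unitSphere n) ∈ φ.target := y.2
      simp only [domRestrict_apply, dif_pos hy]

/-- The rotation of the coordinate `z₀`. -/
def rotate (ξ : ℂ) (z : Fin (n + 1) → ℂ) : Fin (n + 1) → ℂ := Fin.cons (ξ * z 0) (proj₀ z)

lemma iterate_rotate (ξ : ℂ) (j : ℕ) (z : Fin (n + 1) → ℂ) :
    (rotate ξ)^[j] z = Fin.cons (ξ ^ j * z 0) (proj₀ z) := by
  induction j with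
  | zero => simp [cons_proj₀]
  | succ j ih =>
    rw [Function.iterate_succ_apply', ih, rotate, Fin.cons_zero, proj₀_cons, pow_succ', mul_assoc]

lemma contDiff_rotate (ξ : ℂ) : ContDiff ℝ ∞ (rotate ξ : (Fin (n + 1) → ℂ) → _) := by
  refine contDiff_pi.2 fun j => ?_
  refine Fin.cases ?_ (fun i => ?_) j
  · simp only [rotate, Fin.cons_zero]
    exact contDiff_const.mul (contDiff_apply ℝ ℂ 0)
  · simp only [rotate, Fin.cons_succ]
    exact contDiff_apply ℝ ℂ i.succ

lemma mapsTo_rotate {ξ : ℂ} (hξ : ξ ^ a 0 = 1) :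
    MapsTo (rotate ξ) (cylinderBrieskorn a) (cylinderBrieskorn a) := fun z hz => by
  rw [mem_cylinder_iff] at *
  rwa [rotate, Fin.cons_zero, proj₀_cons, mul_pow, hξ, one_mul]

/-- A fibre consists of the a₀-th roots of one complex number, permuted by multiplication of z₀ by a
primitive root of unity. -/
lemma exists_deck (ha : ∀ j, 0 < a j) :
    ∃ τ : (Fin (n + 1) → ℂ) → (Fin (n + 1) → ℂ),
      IsDiffeo τ (cylinderBrieskorn a) (cylinderBrieskorn a) ∧
      (∀ p ∈ cylinderBrieskorn a, proj₀ (τ p) = proj₀ p) ∧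
      (∀ p ∈ cylinderBrieskorn a, ∀ q ∈ cylinderBrieskorn a, proj₀ p = proj₀ q →
        ∃ j : ℕ, τ^[j] p = q) ∧
      (∀ p ∈ cylinderBrieskorn a, proj₀ p ∉ (brieskorn fun j : Fin n => a j.succ) →
        Function.minimalPeriod τ p = a 0) ∧
      (∀ p ∈ cylinderBrieskorn a, proj₀ p ∈ (brieskorn fun j : Fin n => a j.succ) → τ p = p) := by
  have hξ := Complex.isPrimitiveRoot_exp (a 0) (ha 0).ne'
  set ξ := Complex.exp (2 * Real.pi * Complex.I / a 0) with hξdef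
  have hinv : ξ * ξ⁻¹ = 1 := mul_inv_cancel₀ (Complex.exp_ne_zero _)
  refine ⟨rotate ξ, ⟨smoothNear_of_contDiff (contDiff_rotate ξ) _, mapsTo_rotate hξ.pow_eq_one,
    rotate ξ⁻¹, smoothNear_of_contDiff (contDiff_rotate _) _,
    mapsTo_rotate (by rw [inv_pow, hξ.pow_eq_one, inv_one]), fun z _ => ?_, fun z _ => ?_⟩,
    fun p _ => rfl, fun p hp q hq hpq => ?_, fun p hp hB => ?_, fun p hp hB => ?_⟩
  · rw [rotate, rotate, Fin.cons_zero, proj₀_cons, ← mul_assoc, mul_comm ξ⁻¹, hinv, one_mul,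
      cons_proj₀]
  · rw [rotate, rotate, Fin.cons_zero, proj₀_cons, ← mul_assoc, hinv, one_mul, cons_proj₀]
  · rw [mem_cylinder_iff] at hp hq
    -- Over the branching locus the fibre is a single point. Elsewhere the quotient of the two
    -- values of z₀ is a root of unity.
    by_cases h0 : p 0 = 0
    · refine ⟨0, ?_⟩
      have : q 0 ^ a 0 = 0 := by rw [hq.1, ← hpq, ← hp.1, h0, zero_pow (ha 0).ne']
      rw [Function.iterate_zero_apply, ← cons_proj₀ p, ← cons_proj₀ q, h0, hpq,
        (pow_eq_zero_iff (ha 0).ne').1 this]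
    · have : NeZero (a 0) := ⟨(ha 0).ne'⟩
      obtain ⟨j, -, hj⟩ := hξ.eq_pow_of_pow_eq_one (ξ := q 0 / p 0) (by
        rw [div_pow, hq.1, ← hpq, ← hp.1, div_self (pow_ne_zero _ h0)])
      refine ⟨j, ?_⟩
      rw [iterate_rotate, hj, div_mul_cancel₀ _ h0, hpq, cons_proj₀]
  · have h0 : p 0 ≠ 0 := fun h => hB ((proj₀_mem_branch_iff ha hp).2 h)
    have key : ∀ j, Function.IsPeriodicPt (rotate ξ) j p ↔ a 0 ∣ j := fun j => by
      rw [Function.IsPeriodicPt, Function.IsFixedPt, iterate_rotate, ← hξ.pow_eq_one_iff_dvd]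
      refine ⟨fun h => ?_, fun h => by rw [h, one_mul, cons_proj₀]⟩
      have := congrFun h 0
      rw [Fin.cons_zero] at this
      exact mul_right_cancel₀ h0 (by rw [this, one_mul])
    refine Nat.dvd_antisymm ?_ ?_
    · exact Function.isPeriodicPt_iff_minimalPeriod_dvd.1 ((key _).2 dvd_rfl)
    · exact (key _).1 (Function.isPeriodicPt_minimalPeriod _ _)
  · have h0 := (proj₀_mem_branch_iff ha hp).1 hB
    rw [rotate, h0, mul_zero, ← h0, cons_proj₀]

end Covering

/-! ### Normal orientation of the branching locus and local models -/

section Normal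

variable {n : ℕ} {a : Fin (n + 1) → ℕ}

/-- The gradient of `branchFun a` with respect to the Hermitian form with weights `a`. -/
def branchGrad (a : Fin (n + 1) → ℕ) (b : Fin n → ℂ) : Fin n → ℂ :=
  fun j => - star (b j ^ (a j.succ - 1))

/-- The square of the norm of `branchGrad a b`. -/
def branchGradSq (a : Fin (n + 1) → ℕ) (b : Fin n → ℂ) : ℝ :=
  rePair (fun j : Fin n => (a j.succ : ℝ)) (branchGrad a b) (branchGrad a b)

/-- The imaginary part of the Hermitian form with weights a_j is half of dβ. Complex multiples of
the gradient are therefore dβ-orthogonal to the kernel of the derivative of `branchFun a`. -/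
lemma imPair_smul_branchGrad (b u : Fin n → ℂ) (c : ℂ) :
    imPair (fun j : Fin n => (a j.succ : ℝ)) u (c • branchGrad a b) =
      (star (fderiv ℝ (branchFun a) b u) * c).im := by
  rw [fderiv_branchFun, brDeriv_apply, ← Finset.sum_neg_distrib, star_sum, Finset.sum_mul,
    Complex.im_sum]
  refine Finset.sum_congr rfl fun j _ => ?_
  simp only [branchGrad, Pi.smul_apply, smul_eq_mul]
  generalize b j ^ (a j.succ - 1) = t
  simp
  ring

lemma fderiv_branchFun_branchGrad (b : Fin n → ℂ) :
    fderiv ℝ (branchFun a) b (branchGrad a b) = branchGradSq a b := by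
  rw [fderiv_branchFun, brDeriv_apply, ← Finset.sum_neg_distrib, branchGradSq, rePair,
    Complex.ofReal_sum]
  refine Finset.sum_congr rfl fun j _ => ?_
  simp only [branchGrad]
  generalize b j ^ (a j.succ - 1) = t
  apply Complex.ext
  · simp
    ring
  · simp
    ring

lemma fderiv_branchFun_smul (b v : Fin n → ℂ) (c : ℂ) :
    fderiv ℝ (branchFun a) b (c • v) = c * fderiv ℝ (branchFun a) b v := by
  rw [fderiv_branchFun, fderiv_branchFun, brDeriv_smul, mul_neg]

variable {b : Fin n → ℂ}

lemma branchGradSq_pos (ha : ∀ j, 0 < a j) (hb : b ∈ brieskorn fun j : Fin n => a j.succ) :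
    0 < branchGradSq a b := by
  have h0 : 0 < rePair (fun _ => 1) b b := by
    rw [rePair_of_mem_unitSphere hb.2]; exact one_pos
  obtain ⟨j, -, hj⟩ := exists_of_rePair_self_pos (fun _ => zero_le_one) h0
  refine rePair_self_pos (fun _ => Nat.cast_nonneg _) (j := j) (Nat.cast_pos.2 (ha j.succ)) ?_
  simp [branchGrad, hj]

lemma fderiv_branchFun_euler (ha : ∀ j, 0 < a j) (hb : b ∈ brieskorn fun j : Fin n => a j.succ) :
    fderiv ℝ (branchFun a) b (euler (fun j : Fin n => a j.succ) b) = 0 := by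
  rw [fderiv_branchFun, brDeriv_euler fun j => ha j.succ, hb.1, neg_zero]

/-- The gradient is tangent to the sphere: the radial pairing with b is the weighted pairing with
the Euler vector, which the derivative of `branchFun a` annihilates on the branching locus. -/
lemma rePair_smul_branchGrad (ha : ∀ j, 0 < a j)
    (hb : b ∈ brieskorn fun j : Fin n => a j.succ) (c : ℂ) :
    rePair (fun _ => 1) b (c • branchGrad a b) = 0 := by
  have h1 := imPair_smul_branchGrad (a := a) b (euler (fun j : Fin n => a j.succ) b)
    (Complex.I * c)
  rw [fderiv_branchFun_euler ha hb, star_zero, zero_mul, Complex.zero_im, mul_smul, imPair_I_smul,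
    rePair_comm, rePair_euler, natCast_div_self_eq fun j => ha j.succ, rePair_comm] at h1
  exact h1

/-- The normal vectors to the branching locus in the contact hyperplane. -/
def normalLift (a : Fin (n + 1) → ℕ) (b : Fin n → ℂ) (c : ℂ) : Fin n → ℂ :=
  (c / branchGradSq a b) • branchGrad a b -
    weightedForm (fun j : Fin n => a j.succ) b ((c / branchGradSq a b) • branchGrad a b) •
      (Complex.I • euler (fun j : Fin n => a j.succ) b)

lemma weightedForm_I_smul_euler (ha : ∀ j, 0 < a j) (hb : b ∈ unitSphere n) :
    weightedForm (fun j : Fin n => a j.succ) b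
      (Complex.I • euler (fun j : Fin n => a j.succ) b) = 1 := by
  rw [weightedForm_apply, imPair_I_smul, rePair_euler, natCast_div_self_eq fun j => ha j.succ,
    rePair_of_mem_unitSphere hb]

lemma rePair_I_smul_euler (b : Fin n → ℂ) :
    rePair (fun _ => 1) b (Complex.I • euler (fun j : Fin n => a j.succ) b) = 0 := by
  rw [rePair_I_smul, imPair_euler, imPair_self, neg_zero]

lemma normalLift_mem (ha : ∀ j, 0 < a j) (hb : b ∈ brieskorn fun j : Fin n => a j.succ) (c : ℂ) :
    normalLift a b c ∈ tangentAt (unitSphere n) b := by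
  rw [mem_tangentAt_unitSphere hb.2, normalLift, sub_eq_add_neg, ← neg_smul, rePair_add,
    rePair_smul, rePair_smul_branchGrad ha hb, rePair_I_smul_euler]
  ring

lemma weightedForm_normalLift (ha : ∀ j, 0 < a j)
    (hb : b ∈ brieskorn fun j : Fin n => a j.succ) (c : ℂ) :
    weightedForm (fun j : Fin n => a j.succ) b (normalLift a b c) = 0 := by
  rw [normalLift]
  generalize (c / (branchGradSq a b : ℂ)) • branchGrad a b = v
  rw [map_sub, map_smul, weightedForm_I_smul_euler ha hb.2]
  simp

lemma fderiv_branchFun_normalLift (ha : ∀ j, 0 < a j)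
    (hb : b ∈ brieskorn fun j : Fin n => a j.succ) (c : ℂ) :
    fderiv ℝ (branchFun a) b (normalLift a b c) = c := by
  have h : (branchGradSq a b : ℂ) ≠ 0 := Complex.ofReal_ne_zero.2 (branchGradSq_pos ha hb).ne'
  rw [normalLift, map_sub, (fderiv ℝ (branchFun a) b).map_smul, fderiv_branchFun_smul,
    fderiv_branchFun_smul, fderiv_branchFun_euler ha hb, fderiv_branchFun_branchGrad,
    div_mul_cancel₀ _ h]
  simp

/-- The correction along i times the Euler vector pairs to zero with vectors tangent to the sphere,
so only the gradient term survives. -/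
lemma imPair_normalLift (ha : ∀ j, 0 < a j) {u : Fin n → ℂ} (hb : b ∈ unitSphere n)
    (hu : u ∈ tangentAt (unitSphere n) b) (c : ℂ) :
    imPair (fun j : Fin n => (a j.succ : ℝ)) u (normalLift a b c) =
      (star (fderiv ℝ (branchFun a) b u) * c).im / branchGradSq a b := by
  rw [mem_tangentAt_unitSphere hb] at hu
  rw [normalLift, sub_eq_add_neg, ← neg_smul, imPair_add, imPair_smul, imPair_I_smul,
    rePair_euler, natCast_div_self_eq fun j => ha j.succ, rePair_comm _ u b, hu, mul_zero, add_zero,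
    imPair_smul_branchGrad, ← mul_div_assoc, Complex.div_ofReal_im]

lemma mem_tangentAt_branch (ha : ∀ j, 0 < a j) (hb : b ∈ brieskorn fun j : Fin n => a j.succ)
    {x : Fin n → ℂ} :
    x ∈ tangentAt (brieskorn fun j : Fin n => a j.succ) b ↔
      fderiv ℝ (branchFun a) b x = 0 ∧ x ∈ tangentAt (unitSphere n) b := by
  rw [mem_tangentAt_brieskorn (fun j => ha j.succ) hb, mem_tangentAt_unitSphere hb.2,
    fderiv_branchFun, neg_eq_zero]

lemma sub_mem_tangentAt_unitSphere (hb : b ∈ unitSphere n) {x y : Fin n → ℂ}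
    (hx : x ∈ tangentAt (unitSphere n) b) (hy : y ∈ tangentAt (unitSphere n) b) :
    x - y ∈ tangentAt (unitSphere n) b := by
  obtain ⟨r, hr⟩ := (isSubmanifold_unitSphere n).exists_localRetraction hb
  obtain ⟨W, hW⟩ := hr.exists_submodule hb
  rw [hW] at *
  exact W.sub_mem hx hy

/-- The exterior derivative of the contact form on normal vectors to the branching locus. -/
lemma dForm_normal (ha : ∀ j, 0 < a j) (hb : b ∈ brieskorn fun j : Fin n => a j.succ)
    {u v : Fin n → ℂ} (hu : u ∈ tangentAt (unitSphere n) b) (hv : v ∈ tangentAt (unitSphere n) b)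
    (hv0 : weightedForm (fun j : Fin n => a j.succ) b v = 0)
    (horth : ∀ x ∈ tangentAt (brieskorn fun j : Fin n => a j.succ) b,
      weightedForm (fun j : Fin n => a j.succ) b x = 0 →
        dForm (weightedForm fun j : Fin n => a j.succ) b u x = 0) :
    dForm (weightedForm fun j : Fin n => a j.succ) b u v =
      2 * ((star (fderiv ℝ (branchFun a) b u) * fderiv ℝ (branchFun a) b v).im /
        branchGradSq a b) := by
  set c := fderiv ℝ (branchFun a) b v with hc
  -- The difference of v and the normal lift of its normal derivative is tangent to the branching
  -- locus and in the kernel, so u is orthogonal to it.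
  have h1 := horth (v - normalLift a b c)
    ((mem_tangentAt_branch ha hb).2 ⟨by rw [map_sub, fderiv_branchFun_normalLift ha hb, sub_self],
      sub_mem_tangentAt_unitSphere hb.2 hv (normalLift_mem ha hb c)⟩)
    (by rw [map_sub, hv0, weightedForm_normalLift ha hb, sub_self])
  rw [dForm_weightedForm] at h1 ⊢
  rw [← imPair_normalLift ha hb.2 hu]
  have h2 : imPair (fun j : Fin n => (a j.succ : ℝ)) u v =
      imPair (fun j : Fin n => (a j.succ : ℝ)) u (v - normalLift a b c) +
        imPair (fun j : Fin n => (a j.succ : ℝ)) u (normalLift a b c) := by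
    rw [← imPair_add, sub_add_cancel]
  linarith

lemma isPositiveNormal_branchFun (ha : ∀ j, 0 < a j)
    (hb : b ∈ brieskorn fun j : Fin n => a j.succ) :
    IsPositiveNormal (unitSphere n) (brieskorn fun j : Fin n => a j.succ)
      (weightedForm fun j : Fin n => a j.succ) b (branchFun a) := by
  intro u hu v hv _ hv0 horth h1 h2
  rw [dForm_normal ha hb hu hv hv0 fun x hx hx0 => (horth x hx hx0).1, h1, h2]
  have := branchGradSq_pos ha hb
  simp
  positivity

/-- Linear coordinates on the branching locus near `b`. -/
lemma exists_branch_coordinates (ha : ∀ j, 0 < a j)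
    (hb : b ∈ brieskorn fun j : Fin n => a j.succ) :
    ∃ (m : ℕ) (y : (Fin n → ℂ) →L[ℝ] (Fin m → ℝ)),
      BijOn y (tangentAt (brieskorn fun j : Fin n => a j.succ) b) univ ∧
      BijOn (fun v => (fderiv ℝ (branchFun a) b v, y v)) (tangentAt (unitSphere n) b) univ := by
  obtain ⟨r, hr⟩ := (isSubmanifold_brieskorn fun j : Fin n => ha j.succ).exists_localRetraction hb
  obtain ⟨W, hW⟩ := hr.exists_submodule hb
  obtain ⟨r', hr'⟩ := (isSubmanifold_unitSphere n).exists_localRetraction hb.2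
  obtain ⟨W', hW'⟩ := hr'.exists_submodule hb.2
  obtain ⟨π, hπ⟩ := W.subtype.exists_leftInverse_of_injective (by simp)
  have hπ' : ∀ x : W, π x = x := fun x => LinearMap.congr_fun hπ x
  let e := (Module.finBasis ℝ W).equivFun
  let y : (Fin n → ℂ) →L[ℝ] (Fin (Module.finrank ℝ W) → ℝ) :=
    LinearMap.toContinuousLinearMap (e.toLinearMap.comp π)
  have hy : ∀ x, y x = e (π x) := fun x => rfl
  have hinj : ∀ x ∈ W, y x = 0 → x = 0 := fun x hx h => by
    rw [hy, LinearEquiv.map_eq_zero_iff] at h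
    have := hπ' ⟨x, hx⟩
    rw [h] at this
    exact (congrArg Subtype.val this).symm
  have hsurj : ∀ t, ∃ x ∈ W, y x = t := fun t =>
    ⟨e.symm t, (e.symm t).2, by rw [hy, hπ', e.apply_symm_apply]⟩
  refine ⟨_, y, ⟨fun _ _ => mem_univ _, fun x hx x' hx' h => ?_, fun t _ => ?_⟩,
    fun _ _ => mem_univ _, fun x hx x' hx' h => ?_, ?_⟩
  · rw [hW] at hx hx'
    exact sub_eq_zero.1 (hinj _ (W.sub_mem hx hx') (by rw [map_sub, h, sub_self]))
  · obtain ⟨x, hx, h⟩ := hsurj t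
    exact ⟨x, (hW x).2 hx, h⟩
  · obtain ⟨h1, h2⟩ := Prod.ext_iff.1 h
    simp only at h1 h2
    have h3 : x - x' ∈ W := (hW _).1 ((mem_tangentAt_branch ha hb).2
      ⟨by rw [map_sub, h1, sub_self], sub_mem_tangentAt_unitSphere hb.2 hx hx'⟩)
    exact sub_eq_zero.1 (hinj _ h3 (by rw [map_sub, h2, sub_self]))
  · rintro ⟨c, t⟩ -
    obtain ⟨x, hx, hxt⟩ := hsurj (t - y (normalLift a b c))
    have hx' := (mem_tangentAt_branch ha hb).1 ((hW x).2 hx)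
    refine ⟨normalLift a b c + x, (hW' _).2 (W'.add_mem ((hW' _).1 (normalLift_mem ha hb c))
      ((hW' _).1 hx'.2)), ?_⟩
    simp only [map_add, fderiv_branchFun_normalLift ha hb, hx'.1, hxt]
    simp

/-- The standard local model of the branched covering. -/
lemma exists_isBranchChart (ha : ∀ j, 0 < a j) {z : Fin (n + 1) → ℂ}
    (hz : z ∈ cylinderBrieskorn a) (hB : proj₀ z ∈ brieskorn fun j : Fin n => a j.succ) :
    ∃ (m : ℕ) (y : (Fin n → ℂ) → (Fin m → ℝ)),
      IsBranchChart (a 0) (cylinderBrieskorn a) (unitSphere n)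
        (brieskorn fun j : Fin n => a j.succ) proj₀ z (fun x => x 0) (branchFun a) y := by
  obtain ⟨m, y, hy1, hy2⟩ := exists_branch_coordinates ha hB
  have hz0 := (proj₀_mem_branch_iff ha hz).1 hB
  have hζ : ∀ v, fderiv ℝ (fun x : Fin (n + 1) → ℂ => x 0) z v = v 0 := fun v => by
    have : (fun x : Fin (n + 1) → ℂ => x 0) =
      (ContinuousLinearMap.proj 0 : (Fin (n + 1) → ℂ) →L[ℝ] ℂ) := rfl
    rw [this, ContinuousLinearMap.fderiv]
    rfl
  refine ⟨m, y, smoothNear_of_contDiff (contDiff_apply ℝ ℂ 0) _,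
    smoothNear_of_contDiff (contDiff_branchFun a) _, smoothNear_of_contDiff y.contDiff _, ?_, ?_,
    eventually_nhdsWithin_of_forall fun x hx => mem_branch_iff hx,
    eventually_nhdsWithin_of_forall fun x hx => (mem_cylinder_iff.1 hx).1.symm⟩
  · simp only [hζ, fderiv_proj₀, ContinuousLinearMap.fderiv]
    -- For a₀ = 1 the variety is a graph over the sphere and z₀ plays the role of w. For a₀ ≥ 2 the
    -- factor z₀ ^ (a₀ - 1) vanishes: the z₀-direction is free, and tangent vectors project into the
    -- branching locus.
    rcases Nat.lt_or_ge (a 0) 2 with hk | hk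
    · have h1 : a 0 = 1 := by have := ha 0; omega
      have hT : ∀ v, v ∈ tangentAt (cylinderBrieskorn a) z ↔
          v 0 = fderiv ℝ (branchFun a) (proj₀ z) (proj₀ v) ∧
            proj₀ v ∈ tangentAt (unitSphere n) (proj₀ z) := fun v => by
        rw [mem_tangentAt_cylinder_iff ha hz, h1]
        simp
      refine ⟨fun _ _ => mem_univ _, fun v hv w hw h => ?_, ?_⟩
      · rw [hT] at hv hw
        obtain ⟨k1, k2⟩ := Prod.ext_iff.1 h
        simp only at k1 k2
        rw [← cons_proj₀ v, ← cons_proj₀ w, k1]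
        congr 1
        exact hy2.injOn hv.2 hw.2 (Prod.ext (by rw [← hv.1, ← hw.1, k1]) k2)
      · intro t _
        obtain ⟨u, hu, hut⟩ := hy2.surjOn (mem_univ t)
        exact ⟨Fin.cons (fderiv ℝ (branchFun a) (proj₀ z) u) u, (hT _).2 ⟨rfl, hu⟩, hut⟩
    · have hT : ∀ v, v ∈ tangentAt (cylinderBrieskorn a) z ↔
          proj₀ v ∈ tangentAt (brieskorn fun j : Fin n => a j.succ) (proj₀ z) := fun v => by
        rw [mem_tangentAt_cylinder_iff ha hz, mem_tangentAt_branch ha hB, hz0,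
          zero_pow (by omega), mul_zero, zero_mul, eq_comm]
      refine ⟨fun _ _ => mem_univ _, fun v hv w hw h => ?_, ?_⟩
      · rw [hT] at hv hw
        obtain ⟨k1, k2⟩ := Prod.ext_iff.1 h
        simp only at k1 k2
        rw [← cons_proj₀ v, ← cons_proj₀ w, k1]
        congr 1
        exact hy1.injOn hv hw k2
      · rintro ⟨c, t⟩ -
        obtain ⟨u, hu, hut⟩ := hy1.surjOn (mem_univ t)
        exact ⟨Fin.cons c u, (hT _).2 hu, Prod.ext rfl hut⟩
  · simp only [ContinuousLinearMap.fderiv]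
    exact hy2

theorem isCyclicBranchedCovering_proj₀ (ha : ∀ j, 0 < a j) :
    IsCyclicBranchedCovering (a 0) (cylinderBrieskorn a) (unitSphere n)
      (brieskorn fun j : Fin n => a j.succ) proj₀ where
  total_submanifold := ⟨3, isSubmanifold_cylinder ha⟩
  base_submanifold := ⟨1, isSubmanifold_unitSphere n, isSubmanifold_brieskorn fun j => ha j.succ⟩
  branch_subset := brieskorn_subset_unitSphere _
  smooth := smoothNear_of_contDiff contDiff_proj₀ _
  mapsTo := mapsTo_proj₀ a
  surjOn := surjOn_proj₀ ha
  covering := isCoveringMapOn_proj₀ ha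
  local_diffeo := fun _ hz hB => bijOn_proj₀ ha hz hB
  deck := exists_deck ha
  local_model := fun _ hz hB => by
    obtain ⟨m, y, h⟩ := exists_isBranchChart ha hz hB
    exact ⟨m, _, _, y, h⟩

/-- A positive perturbation is positive on the lines along which the covering is singular. -/
lemma IsPositivePerturbation.pos (ha : ∀ j, 0 < a j) {γ : OneForm (Fin (n + 1) → ℂ)}
    (hγ : IsPositivePerturbation (a 0) (cylinderBrieskorn a) (unitSphere n)
      (brieskorn fun j : Fin n => a j.succ) proj₀ (weightedForm fun j : Fin n => a j.succ) γ)
    {z : Fin (n + 1) → ℂ} (hz : z ∈ cylinderBrieskorn a) (hz0 : z 0 = 0) (hk : 2 ≤ a 0) {x : ℂ}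
    (hx : x ≠ 0) : 0 < dForm γ z (Pi.single 0 x) (Pi.single 0 (Complex.I * x)) := by
  have hB := (proj₀_mem_branch_iff ha hz).2 hz0
  obtain ⟨m, y, hc⟩ := exists_isBranchChart ha hz hB
  have hp : ∀ x : ℂ, proj₀ (Pi.single 0 x : Fin (n + 1) → ℂ) = 0 := fun x => by
    ext1 j
    simp [proj₀]
  have hT : ∀ x : ℂ, (Pi.single 0 x : Fin (n + 1) → ℂ) ∈ tangentAt (cylinderBrieskorn a) z :=
    fun x => by
    rw [mem_tangentAt_cylinder_iff ha hz, hp, map_zero, hz0, zero_pow (by omega), mul_zero,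
      zero_mul, mem_tangentAt_unitSphere hz.2]
    simp [rePair]
  refine hγ.2 z hz hB _ _ ⟨hT x, hT _, by rw [fderiv_proj₀, hp], by rw [fderiv_proj₀, hp],
    m, _, _, y, hc, isPositiveNormal_branchFun ha hB, ?_⟩
  have : (fun x : Fin (n + 1) → ℂ => x 0) =
      (ContinuousLinearMap.proj 0 : (Fin (n + 1) → ℂ) →L[ℝ] ℂ) := rfl
  rw [this, ContinuousLinearMap.fderiv]
  have h2 : 0 < Complex.normSq x := Complex.normSq_pos.2 hx
  rw [Complex.normSq_apply] at h2
  simpa using h2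

end Normal

/-! ### Real-linear maps of ℂ and k-th powers -/

section RealLinear

lemma exists_eq_add_conj (T : ℂ →L[ℝ] ℂ) : ∃ α β : ℂ, ∀ v, T v = α * v + β * star v := by
  refine ⟨(T 1 - Complex.I * T Complex.I) / 2, (T 1 + Complex.I * T Complex.I) / 2, fun v => ?_⟩
  have h : T v = v.re * T 1 + v.im * T Complex.I := by
    conv_lhs => rw [show v = v.re • (1 : ℂ) + v.im • Complex.I by simp [Complex.re_add_im]]
    rw [map_add, map_smul, map_smul, Complex.real_smul, Complex.real_smul]
  have h1 : v = v.re + v.im * Complex.I := (Complex.re_add_im v).symm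
  have h2 : star v = v.re - v.im * Complex.I := by
    apply Complex.ext <;> simp
  rw [h, h2]
  conv_rhs => rw [show (T 1 - Complex.I * T Complex.I) / 2 * v =
    (T 1 - Complex.I * T Complex.I) / 2 * (v.re + v.im * Complex.I) by rw [← h1]]
  linear_combination v.im * T Complex.I * Complex.I_sq

/-- The factor |α|² - |β|² is the determinant of v ↦ αv + βv̄. -/
lemma im_star_mul_of_eq_add_conj (α β p q : ℂ) :
    (star (α * p + β * star p) * (α * q + β * star q)).im =
      (Complex.normSq α - Complex.normSq β) * (star p * q).im := by
  simp [Complex.normSq_apply]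
  ring

open Polynomial in
-- On the unit circle v̄ = q v with q = v⁻², so the hypothesis becomes (α + βq)^k = P + Q q^k for
-- all q of modulus 1. This is an identity of polynomials; the constant and leading coefficients
-- give the claim.
lemma pow_eq_of_forall_conj {k : ℕ} (hk : 0 < k) {α β P Q : ℂ}
    (h : ∀ v : ℂ, (α * v + β * star v) ^ k = P * v ^ k + Q * star (v ^ k)) :
    α ^ k = P ∧ β ^ k = Q := by
  have hinf : (Metric.sphere (0 : ℂ) 1).Infinite := by
    refine (isPreconnected_sphere (by simp) (0 : ℂ) 1).infinite_of_nontrivial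
      ⟨1, by simp, -1, by simp, ?_⟩
    intro h1
    have := congrArg Complex.re h1
    norm_num at this
  have hpoly : (C α + C β * X) ^ k = C P + C Q * X ^ k := by
    refine eq_of_infinite_eval_eq _ _ (hinf.mono fun q hq => ?_)
    have hq1 : ‖q‖ = 1 := by simpa using hq
    have hq0 : q ≠ 0 := fun h0 => by simp [h0] at hq1
    obtain ⟨v, hv⟩ := IsAlgClosed.exists_pow_nat_eq q⁻¹ (n := 2) two_pos
    have hv1 : ‖v‖ = 1 := by
      have : ‖v‖ ^ 2 = 1 := by rw [← norm_pow, hv, norm_inv, hq1, inv_one]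
      exact (pow_eq_one_iff_of_nonneg (norm_nonneg v) two_ne_zero).1 this
    have hv0 : v ≠ 0 := fun h0 => by simp [h0] at hv1
    have hs : star v = q * v := by
      have h1 : star v * v = 1 := by
        have := Complex.conj_mul' v
        rw [hv1] at this
        simpa using this
      have h2 : q * v * v = 1 := by rw [mul_assoc, ← sq, hv, mul_inv_cancel₀ hq0]
      exact mul_right_cancel₀ hv0 (h1.trans h2.symm)
    have h3 := h v
    rw [star_pow, hs] at h3
    have h4 : (α + β * q) ^ k * v ^ k = (P + Q * q ^ k) * v ^ k := by
      rw [← mul_pow, add_mul, mul_assoc, h3, mul_pow]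
      ring
    have h5 := mul_right_cancel₀ (pow_ne_zero k hv0) h4
    simpa using h5
  constructor
  · have := congrArg (eval 0) hpoly
    simpa [hk.ne'] using this
  · have h1 := congrArg (fun p => coeff p (k * 1)) hpoly
    rw [coeff_pow_of_natDegree_le (by compute_degree)] at h1
    simpa [coeff_C, hk.ne'] using h1

lemma normSq_lt_of_forall_conj {k : ℕ} (hk : 0 < k) {α β P Q : ℂ}
    (h : ∀ v : ℂ, (α * v + β * star v) ^ k = P * v ^ k + Q * star (v ^ k))
    (hPQ : Complex.normSq Q < Complex.normSq P) : Complex.normSq β < Complex.normSq α := by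
  obtain ⟨rfl, rfl⟩ := pow_eq_of_forall_conj hk h
  rw [map_pow, map_pow] at hPQ
  exact lt_of_pow_lt_pow_left₀ k (Complex.normSq_nonneg _) hPQ

end RealLinear

/-! ### Independence of the orientation from the local model -/

section Orientation

variable {n : ℕ} {a : Fin (n + 1) → ℕ} {b : Fin n → ℂ}

/-- A local section of `branchFun a` on the sphere. -/
lemma exists_branch_section (ha : ∀ j, 0 < a j)
    (hb : b ∈ brieskorn fun j : Fin n => a j.succ) :
    ∃ σ : ℂ → (Fin n → ℂ), ContDiffAt ℝ ∞ σ 0 ∧ σ 0 = b ∧ (∀ᶠ c in 𝓝 0, σ c ∈ unitSphere n) ∧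
      ∀ᶠ c in 𝓝 0, branchFun a (σ c) = c := by
  obtain ⟨r, hr⟩ := (isSubmanifold_unitSphere n).exists_localRetraction hb.2
  set d := branchGradSq a b with hd
  have hd0 : (d : ℂ) ≠ 0 := Complex.ofReal_ne_zero.2 (branchGradSq_pos ha hb).ne'
  let ℓ : ℂ → (Fin n → ℂ) := fun c => b + (c / d) • branchGrad a b
  have hℓ0 : ℓ 0 = b := by simp [ℓ]
  let Λ : ℂ →L[ℝ] (Fin n → ℂ) := LinearMap.toContinuousLinearMap
    { toFun := fun c => (c / d) • branchGrad a b
      map_add' := fun c c' => by rw [add_div, add_smul]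
      map_smul' := fun t c => by
        rw [RingHom.id_apply, Complex.real_smul, mul_div_assoc, mul_smul]
        exact Complex.coe_smul t _ }
  have hℓ : ∀ c, ℓ c = b + Λ c := fun c => rfl
  have hℓs : ContDiff ℝ ∞ ℓ := contDiff_const.add Λ.contDiff
  have hℓd : HasFDerivAt ℓ Λ 0 := (Λ.hasFDerivAt).const_add b
  have hrℓ : ContDiffAt ℝ ∞ (fun c => r (ℓ c)) 0 :=
    ContDiffAt.comp (g := r) 0 (by rw [hℓ0]; exact hr.contDiffAt) hℓs.contDiffAt
  -- Along the normalized gradient line, retracted to the sphere, `branchFun a` has derivative the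
  -- identity at 0. Composing with a local inverse of G gives an exact section.
  let G : ℂ → ℂ := fun c => branchFun a (r (ℓ c))
  have hG : ContDiffAt ℝ ∞ G 0 := (contDiff_branchFun a).contDiffAt.comp 0 hrℓ
  have hb0 : branchFun a b = 0 := (mem_branch_iff hb.2).1 hb
  have hG0 : G 0 = 0 := by simp only [G, hℓ0, hr.apply hb.2, hb0]
  have hGd : HasFDerivAt G ((ContinuousLinearEquiv.refl ℝ ℂ : ℂ ≃L[ℝ] ℂ) : ℂ →L[ℝ] ℂ) 0 := by
    have h1 : HasFDerivAt (fun c => r (ℓ c)) ((fderiv ℝ r b).comp Λ) 0 := by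
      refine HasFDerivAt.comp (g := r) 0 ?_ hℓd
      rw [hℓ0]
      exact hr.differentiableAt.hasFDerivAt
    have h2 : HasFDerivAt G ((fderiv ℝ (branchFun a) b).comp ((fderiv ℝ r b).comp Λ)) 0 := by
      refine HasFDerivAt.comp (g := branchFun a) 0 ?_ h1
      rw [hℓ0, hr.apply hb.2]
      exact ((contDiff_branchFun a).differentiable (by simp) b).hasFDerivAt
    refine h2.congr_fderiv ?_
    apply ContinuousLinearMap.ext
    intro c
    have h3 : fderiv ℝ r b (Λ c) = Λ c := hr.fderiv_eq_self hb.2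
      ((mem_tangentAt_unitSphere hb.2).2 (rePair_smul_branchGrad ha hb _))
    change fderiv ℝ (branchFun a) b (fderiv ℝ r b (Λ c)) = c
    rw [h3]
    change fderiv ℝ (branchFun a) b ((c / d) • branchGrad a b) = c
    rw [fderiv_branchFun_smul, fderiv_branchFun_branchGrad, div_mul_cancel₀ _ hd0]
  have hinv := hG.to_localInverse hGd (by simp)
  have hright := (hG.hasStrictFDerivAt' hGd (by simp)).eventually_right_inverse
  have hself := (hG.hasStrictFDerivAt' hGd (by simp)).localInverse_apply_image
  rw [hG0] at hinv hright hself
  set κ := hG.localInverse hGd (by simp) with hκ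
  have hκ0 : κ 0 = 0 := hself
  have hσ : ContDiffAt ℝ ∞ (fun c => r (ℓ (κ c))) 0 :=
    ContDiffAt.comp (g := fun c => r (ℓ c)) 0 (by rw [hκ0]; exact hrℓ) hinv
  refine ⟨fun c => r (ℓ (κ c)), hσ, by simp only [hκ0, hℓ0, hr.apply hb.2], ?_, hright⟩
  have h4 : ContinuousAt (fun c => ℓ (κ c)) 0 :=
    ContinuousAt.comp (g := ℓ) hℓs.continuous.continuousAt hinv.continuousAt
  have h5 : Tendsto (fun c => ℓ (κ c)) (𝓝 0) (𝓝 b) := by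
    have := h4.tendsto
    rwa [hκ0, hℓ0] at this
  exact h5.eventually hr.mem

/-- The orientation of `ker df` does not depend on the local model. -/
lemma IsPositiveKerBasis.im_pos (ha : ∀ j, 0 < a j) {z v₁ v₂ : Fin (n + 1) → ℂ}
    (hz : z ∈ cylinderBrieskorn a) (hB : proj₀ z ∈ brieskorn fun j : Fin n => a j.succ)
    (h : IsPositiveKerBasis (a 0) (cylinderBrieskorn a) (unitSphere n)
      (brieskorn fun j : Fin n => a j.succ) proj₀ (weightedForm fun j : Fin n => a j.succ)
      z v₁ v₂) : 0 < (star (v₁ 0) * v₂ 0).im := by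
  obtain ⟨hv₁, hv₂, hk₁, hk₂, m, ζ, w, y, hchart, hnormal, hpos⟩ := h
  rw [fderiv_proj₀] at hk₁ hk₂
  have hz0 := (proj₀_mem_branch_iff ha hz).1 hB
  have hsingle : ∀ v : Fin (n + 1) → ℂ, proj₀ v = 0 → v = Pi.single 0 (v 0) := fun v hv => by
    ext1 j
    refine Fin.cases ?_ (fun i => ?_) j
    · simp
    · have : v i.succ = 0 := congrFun hv i
      simp [this]
  rcases Nat.lt_or_ge (a 0) 2 with hk | hk
  -- For a₀ = 1 the projection is immersive on M, so its kernel is trivial and contains no positive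
  -- basis.
  · have h1 : a 0 = 1 := by have := ha 0; omega
    have h2 := ((mem_tangentAt_cylinder_iff ha hz).1 hv₁).1
    rw [hk₁, map_zero, h1] at h2
    have h3 : v₁ 0 = 0 := by simpa using h2
    have h4 : v₁ = 0 := by rw [hsingle v₁ hk₁, h3, Pi.single_zero]
    simp [h4] at hpos
  set b := proj₀ z with hbdef
  obtain ⟨σ, hσ, hσ0, hσS, hσw⟩ := exists_branch_section ha hB
  have hwd : DifferentiableAt ℝ w b := hchart.smooth_w.differentiableAt rfl
  have hζd : DifferentiableAt ℝ ζ z := hchart.smooth_ζ.differentiableAt rfl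
  have hσd : HasFDerivAt σ (fderiv ℝ σ 0) 0 := (hσ.differentiableAt (by simp)).hasFDerivAt
  set A : ℂ →L[ℝ] ℂ := (fderiv ℝ w b).comp (fderiv ℝ σ 0) with hA
  have hσT : ∀ c, fderiv ℝ σ 0 c ∈ tangentAt (unitSphere n) b := fun c => by
    have := fderiv_mem_tangentAt_of_eventually_mem hσ hσS c
    rwa [hσ0] at this
  have hσdw : ∀ c, fderiv ℝ (branchFun a) b (fderiv ℝ σ 0 c) = c := fun c => by
    have h1 : HasFDerivAt (fun c => branchFun a (σ c))
        ((fderiv ℝ (branchFun a) b).comp (fderiv ℝ σ 0)) 0 := by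
      refine HasFDerivAt.comp (g := branchFun a) 0 ?_ hσd
      rw [hσ0]
      exact ((contDiff_branchFun a).differentiable (by simp) b).hasFDerivAt
    have h2 : HasFDerivAt (fun c => branchFun a (σ c)) (ContinuousLinearMap.id ℝ ℂ) 0 :=
      (hasFDerivAt_id (0 : ℂ)).congr_of_eventuallyEq hσw
    exact DFunLike.congr_fun (h1.unique h2) c
  -- The coordinate w vanishes on the branching locus, so its derivative factors through that of
  -- `branchFun a`; the factor A is the transition between the two normal coordinates.
  have hAw : ∀ u ∈ tangentAt (unitSphere n) b,
      fderiv ℝ w b u = A (fderiv ℝ (branchFun a) b u) := fun u hu => by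
    set c := fderiv ℝ (branchFun a) b u with hc
    have h1 : u - fderiv ℝ σ 0 c ∈ tangentAt (brieskorn fun j : Fin n => a j.succ) b :=
      (mem_tangentAt_branch ha hB).2 ⟨by rw [map_sub, hσdw, ← hc, sub_self],
        sub_mem_tangentAt_unitSphere hB.2 hu (hσT c)⟩
    have h2 : ∀ᶠ x in 𝓝[brieskorn fun j : Fin n => a j.succ] b, w x = (fun _ => (0 : ℂ)) x := by
      have h3 := (hchart.branch).filter_mono
        (nhdsWithin_mono b (brieskorn_subset_unitSphere fun j : Fin n => a j.succ))
      filter_upwards [h3, self_mem_nhdsWithin] with x hx hxB using hx.1 hxB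
    have h4 := fderiv_eq_of_eventually_eqOn hwd (differentiableAt_const _) h2 hB h1
    rw [map_sub] at h4
    change fderiv ℝ w b u = fderiv ℝ w b (fderiv ℝ σ 0 c)
    simpa [sub_eq_zero] using h4
  have hAsurj : ∀ t : ℂ, ∃ c, A c = t := fun t => by
    obtain ⟨u, hu, hut⟩ := hchart.chart_base.surjOn (mem_univ (t, 0))
    exact ⟨_, (hAw u hu).symm.trans (Prod.ext_iff.1 hut).1⟩
  obtain ⟨p, hp⟩ := hAsurj 1
  obtain ⟨q, hq⟩ := hAsurj Complex.I
  have hd := branchGradSq_pos ha hB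
  -- The normal lifts of p and q are dβ-orthogonal to the branching locus and map to 1 and i under
  -- dw. Positivity of w thus says that p, q is a positive basis, so A preserves orientation.
  have hpq : 0 < (star p * q).im := by
    have horth : ∀ c : ℂ, ∀ x ∈ tangentAt (brieskorn fun j : Fin n => a j.succ) b,
        dForm (weightedForm fun j : Fin n => a j.succ) b (normalLift a b c) x = 0 :=
      fun c x hx => by
      rw [mem_tangentAt_branch ha hB] at hx
      rw [dForm_weightedForm, imPair_comm, imPair_normalLift ha hB.2 hx.2, hx.1]
      simp
    have h1 := hnormal (normalLift a b p) (normalLift_mem ha hB p) (normalLift a b q)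
      (normalLift_mem ha hB q) (weightedForm_normalLift ha hB p) (weightedForm_normalLift ha hB q)
      (fun x hx _ => ⟨horth p x hx, horth q x hx⟩)
      (by rw [hAw _ (normalLift_mem ha hB p), fderiv_branchFun_normalLift ha hB, hp])
      (by rw [hAw _ (normalLift_mem ha hB q), fderiv_branchFun_normalLift ha hB, hq])
    rw [dForm_weightedForm, imPair_normalLift ha hB.2 (normalLift_mem ha hB p),
      fderiv_branchFun_normalLift ha hB] at h1
    have h2 : 0 < (star p * q).im / branchGradSq a b := by linarith
    exact (div_pos_iff_of_pos_right hd).1 h2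
  obtain ⟨P, Q, hPQ⟩ := exists_eq_add_conj A
  have hdetA : Complex.normSq Q < Complex.normSq P := by
    have h1 := im_star_mul_of_eq_add_conj P Q p q
    rw [← hPQ, ← hPQ, hp, hq] at h1
    simp only [star_one, one_mul, Complex.I_im] at h1
    have h2 : 0 < Complex.normSq P - Complex.normSq Q := by
      by_contra! h3
      nlinarith
    linarith
  set T : ℂ →L[ℝ] ℂ := (fderiv ℝ ζ z).comp (ContinuousLinearMap.single ℝ (fun _ => ℂ) 0) with hT
  have hTv : ∀ v, T v = fderiv ℝ ζ z (Pi.single 0 v) := fun v => rfl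
  obtain ⟨α, β, hαβ⟩ := exists_eq_add_conj T
  have hw0 : w b = 0 := (hchart.branch.self_of_nhdsWithin hB.2).1 hB
  have hζ0 : ζ z = 0 := by
    have := hchart.model.self_of_nhdsWithin hz
    rw [← hbdef, hw0] at this
    exact (pow_eq_zero_iff (ha 0).ne').1 this.symm
  -- Along the curve h(t) = (t v, σ(t^k v^k)) in M, where k = a₀, the model reads ζ(h(t))^k =
  -- w(σ(t^k v^k)). Division by t^k and t → 0 give T(v)^k = A(v^k). Here k ≥ 2 ensures that h has
  -- velocity (v, 0).
  have hTA : ∀ v, T v ^ a 0 = A (v ^ a 0) := fun v => by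
    let h : ℝ → (Fin (n + 1) → ℂ) := fun t =>
      Fin.cons ((t : ℂ) * v) (σ ((t : ℂ) ^ a 0 * v ^ a 0))
    have hpow : HasDerivAt (fun t : ℝ => (t : ℂ) ^ a 0 * v ^ a 0) 0 0 := by
      have h1 : HasDerivAt (fun t : ℝ => (t : ℂ)) 1 0 := Complex.ofRealCLM.hasDerivAt
      refine ((h1.pow (a 0)).mul_const _).congr_deriv ?_
      simp [show a 0 - 1 ≠ 0 by omega]
    have hpow0 : ((0 : ℝ) : ℂ) ^ a 0 * v ^ a 0 = 0 := by simp [(ha 0).ne']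
    have hh : HasDerivAt h (Pi.single 0 v) 0 := by
      refine hasDerivAt_pi.2 fun j => ?_
      refine Fin.cases ?_ (fun i => ?_) j
      · have h1 : HasDerivAt (fun t : ℝ => (t : ℂ) * v) (1 * v) 0 :=
          (Complex.ofRealCLM.hasDerivAt (x := 0)).mul_const v
        simpa [h] using h1
      · have h1 : HasDerivAt (fun t : ℝ => σ ((t : ℂ) ^ a 0 * v ^ a 0)) (fderiv ℝ σ 0 0) 0 := by
          refine HasFDerivAt.comp_hasDerivAt (l := σ) 0 ?_ hpow
          rw [hpow0]
          exact hσd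
        have h2 := hasDerivAt_pi.1 h1 i
        simpa [h] using h2
    have hh0 : h 0 = z := by
      simp only [h]
      rw [hpow0, hσ0, Complex.ofReal_zero, zero_mul, ← hz0]
      exact cons_proj₀ z
    have htend : Tendsto (fun t : ℝ => (t : ℂ) ^ a 0 * v ^ a 0) (𝓝 0) (𝓝 0) := by
      have := hpow.continuousAt.tendsto
      rwa [hpow0] at this
    have hhM : ∀ᶠ t in 𝓝 (0 : ℝ), h t ∈ cylinderBrieskorn a := by
      filter_upwards [htend.eventually hσS, htend.eventually hσw] with t h1 h2
      rw [mem_cylinder_iff]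
      simp only [h, Fin.cons_zero, proj₀_cons]
      exact ⟨by rw [h2, mul_pow], h1⟩
    have hht : Tendsto h (𝓝 0) (𝓝[cylinderBrieskorn a] z) := by
      refine tendsto_nhdsWithin_iff.2 ⟨?_, hhM⟩
      have := hh.continuousAt.tendsto
      rwa [hh0] at this
    have hmodel := hht.eventually hchart.model
    have h1 : HasDerivAt (fun t => ζ (h t)) (T v) 0 := by
      refine HasFDerivAt.comp_hasDerivAt (l := ζ) 0 ?_ hh
      rw [hh0]
      exact hζd.hasFDerivAt
    have h2 : HasDerivAt (fun s : ℝ => w (σ ((s : ℂ) * v ^ a 0))) (A (v ^ a 0)) 0 := by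
      have h3 : HasDerivAt (fun s : ℝ => (s : ℂ) * v ^ a 0) (1 * v ^ a 0) 0 :=
        (Complex.ofRealCLM.hasDerivAt (x := 0)).mul_const _
      rw [one_mul] at h3
      have h4 : HasDerivAt (fun s : ℝ => σ ((s : ℂ) * v ^ a 0)) (fderiv ℝ σ 0 (v ^ a 0)) 0 := by
        refine HasFDerivAt.comp_hasDerivAt (l := σ) 0 ?_ h3
        simpa using hσd
      refine HasFDerivAt.comp_hasDerivAt (l := w) 0 ?_ h4
      simpa [hσ0] using hwd.hasFDerivAt
    have k1 := (h1.tendsto_slope_zero).pow (a 0)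
    have k2 := h2.tendsto_slope_zero
    have k3 : Tendsto (fun t : ℝ => t ^ a 0) (𝓝[≠] 0) (𝓝[≠] 0) := by
      refine tendsto_nhdsWithin_iff.2 ⟨?_, ?_⟩
      · have : Tendsto (fun t : ℝ => t ^ a 0) (𝓝 0) (𝓝 (0 ^ a 0)) :=
          (continuous_pow (a 0)).tendsto 0
        rw [zero_pow (ha 0).ne'] at this
        exact this.mono_left nhdsWithin_le_nhds
      · filter_upwards [self_mem_nhdsWithin] with t ht using pow_ne_zero _ ht
    refine tendsto_nhds_unique k1 ((k2.comp k3).congr' ?_)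
    filter_upwards [hmodel.filter_mono nhdsWithin_le_nhds, self_mem_nhdsWithin] with t ht ht0
    have h5 : proj₀ (h t) = σ ((t : ℂ) ^ a 0 * v ^ a 0) := rfl
    simp only [zero_add, hh0, hζ0, sub_zero, Function.comp_apply, Complex.ofReal_zero, zero_mul,
      hσ0, hw0, Complex.ofReal_pow]
    rw [smul_pow, ← ht, h5, inv_pow]
  -- T preserves orientation because A does, so positivity in the coordinate ζ is positivity in z₀.
  have hdetT := normSq_lt_of_forall_conj (ha 0) (fun v => by
    rw [← hαβ, hTA, hPQ]) hdetA
  rw [hsingle v₁ hk₁, hsingle v₂ hk₂, ← hTv, ← hTv, hαβ, hαβ, im_star_mul_of_eq_add_conj] at hpos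
  exact (pos_iff_pos_of_mul_pos hpos).1 (by linarith)

/-- The form `x₀ dy₀ - y₀ dx₀` is positive on `ker df`. -/
lemma isPositivePerturbation_theta (ha : ∀ j, 0 < a j) :
    IsPositivePerturbation (a 0) (cylinderBrieskorn a) (unitSphere n)
      (brieskorn fun j : Fin n => a j.succ) proj₀ (weightedForm fun j : Fin n => a j.succ)
      (fun z => theta 0 z) := by
  refine ⟨smoothNear_of_contDiff (theta 0).contDiff _, fun z hz hB v₁ v₂ h => ?_⟩
  have h1 := h.im_pos ha hz hB
  rw [← theta_apply 0 v₁ v₂] at h1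
  simp only [dForm, ContinuousLinearMap.fderiv]
  rw [theta_comm 0 v₂ v₁]
  linarith

end Orientation

section Projection

variable {n : ℕ} {a : Fin (n + 1) → ℕ}

/-! ### The projection is a contact branched covering -/

theorem isContactBranchedCovering_proj₀ (ha : ∀ j, 0 < a j) :
    IsContactBranchedCovering (a 0) (cylinderBrieskorn a) (unitSphere n)
      (brieskorn fun j : Fin n => a j.succ) proj₀ (weightedForm fun j : Fin n => a j.succ)
      (pathForm a 1) where
  branched := isCyclicBranchedCovering_proj₀ ha
  contact_base := isContactForm_unitSphere fun j => ha j.succ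
  contact_branch := isContactForm_brieskorn fun j => ha j.succ
  contact_total := by
    have hγ := isPositivePerturbation_theta ha
    obtain ⟨ε₀, hε₀, h⟩ := exists_isContactForm_perturbedForm ha hγ.1
      fun z hz h0 hk x hx => IsPositivePerturbation.pos ha hγ hz h0 hk hx
    -- At s = 1 the perturbation has coefficient zero, so any admissible ε shows that `pathForm a 1`
    -- is contact.
    have := h (ε₀ / 2) (by linarith) (by linarith) 1 ⟨zero_le_one, le_rfl⟩
    rwa [perturbedForm_one] at this
  exists_perturbation := ⟨_, isPositivePerturbation_theta ha⟩
  isotopic := fun _ hγ => exists_isotopic_pathForm ha hγ.1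
    fun _ hz h0 hk _ hx => IsPositivePerturbation.pos ha hγ hz h0 hk hx

/-- Two contact forms that make the same map a contact branched covering are contactomorphic. -/
lemma IsContactBranchedCovering.areContactomorphic {E F : Type*} [NormedAddCommGroup E]
    [NormedSpace ℝ E] [NormedAddCommGroup F] [NormedSpace ℝ F] {k : ℕ} {M : Set E} {N B : Set F}
    {f : E → F} {α : OneForm F} {η η' : OneForm E}
    (h : IsContactBranchedCovering k M N B f α η)
    (h' : IsContactBranchedCovering k M N B f α η') : AreContactomorphic M η M η' := by
  obtain ⟨γ, hγ⟩ := h.exists_perturbation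
  obtain ⟨ε₁, hε₁, h₁⟩ := h.isotopic γ hγ
  obtain ⟨ε₂, hε₂, h₂⟩ := h'.isotopic γ hγ
  have hpos : 0 < min ε₁ ε₂ := lt_min hε₁ hε₂
  obtain ⟨Φ, -, -, -, hΦ⟩ := (h₁ (min ε₁ ε₂ / 2) (by linarith)
    (by linarith [min_le_left ε₁ ε₂])).2
  obtain ⟨Ψ, -, -, -, hΨ⟩ := (h₂ (min ε₁ ε₂ / 2) (by linarith)
    (by linarith [min_le_right ε₁ ε₂])).2
  obtain ⟨χ, hχ⟩ := hΦ.exists_symm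
  exact ⟨_, hχ.trans hΨ⟩

theorem areContactomorphic_brieskorn (ha : ∀ j, 0 < a j) {η : OneForm (Fin (n + 1) → ℂ)}
    (h : IsContactBranchedCovering (a 0) (cylinderBrieskorn a) (unitSphere n)
      (brieskorn fun j : Fin n => a j.succ) proj₀ (weightedForm fun j : Fin n => a j.succ) η) :
    AreContactomorphic (cylinderBrieskorn a) η (brieskorn a) (weightedForm a) := by
  obtain ⟨χ, hχ⟩ := h.areContactomorphic (isContactBranchedCovering_proj₀ ha)
  exact ⟨_, hχ.trans (isContactomorphism_straighten ha)⟩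

end Projection

section Transfer

variable {E F E' F' : Type*} [NormedAddCommGroup E] [NormedSpace ℝ E]
  [NormedAddCommGroup F] [NormedSpace ℝ F] [NormedAddCommGroup E'] [NormedSpace ℝ E']
  [NormedAddCommGroup F'] [NormedSpace ℝ F']

/-! ### Transport of branched coverings by diffeomorphisms -/

/-- `φ` and `ψ` restrict to mutually inverse diffeomorphisms between `M` and `M'`. -/
structure IsDiffeoPair (φ : E → E') (ψ : E' → E) (M : Set E) (M' : Set E') : Prop where
  smooth : SmoothNear M φ
  smooth_symm : SmoothNear M' ψ
  mapsTo : MapsTo φ M M'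
  mapsTo_symm : MapsTo ψ M' M
  inv : InvOn ψ φ M M'

namespace IsDiffeoPair

variable {φ : E → E'} {ψ : E' → E} {M : Set E} {M' : Set E'}

lemma symm (h : IsDiffeoPair φ ψ M M') : IsDiffeoPair ψ φ M' M :=
  ⟨h.smooth_symm, h.smooth, h.mapsTo_symm, h.mapsTo, h.inv.symm⟩

lemma isDiffeo (h : IsDiffeoPair φ ψ M M') : IsDiffeo φ M M' :=
  ⟨h.smooth, h.mapsTo, ψ, h.smooth_symm, h.mapsTo_symm, h.inv⟩

lemma fderiv_symm_apply (h : IsDiffeoPair φ ψ M M') {p : E} (hp : p ∈ M) {v : E}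
    (hv : v ∈ tangentAt M p) : fderiv ℝ ψ (φ p) (fderiv ℝ φ p v) = v :=
  fderiv_leftInvOn (h.smooth_symm.differentiableAt (h.mapsTo hp)) (h.smooth.differentiableAt hp)
    h.inv.1 hp hv

lemma fderiv_mem (h : IsDiffeoPair φ ψ M M') {p : E} (hp : p ∈ M) {v : E}
    (hv : v ∈ tangentAt M p) : fderiv ℝ φ p v ∈ tangentAt M' (φ p) :=
  fderiv_mem_tangentAt (h.smooth.contDiffAt hp) h.mapsTo hv

lemma fderiv_symm_mem (h : IsDiffeoPair φ ψ M M') {p : E} (hp : p ∈ M) {v : E'}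
    (hv : v ∈ tangentAt M' (φ p)) : fderiv ℝ ψ (φ p) v ∈ tangentAt M p := by
  have := h.symm.fderiv_mem (h.mapsTo hp) hv
  rwa [h.inv.1 hp] at this

lemma fderiv_apply_symm (h : IsDiffeoPair φ ψ M M') {p : E} (hp : p ∈ M) {v : E'}
    (hv : v ∈ tangentAt M' (φ p)) : fderiv ℝ φ p (fderiv ℝ ψ (φ p) v) = v := by
  have := h.symm.fderiv_symm_apply (h.mapsTo hp) hv
  rwa [h.inv.1 hp] at this

lemma bijOn_fderiv (h : IsDiffeoPair φ ψ M M') {p : E} (hp : p ∈ M) :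
    BijOn (fun v => fderiv ℝ φ p v) (tangentAt M p) (tangentAt M' (φ p)) :=
  InvOn.bijOn (f' := fun v => fderiv ℝ ψ (φ p) v)
    ⟨fun _ hv => h.fderiv_symm_apply hp hv, fun _ hv => h.fderiv_apply_symm hp hv⟩
    (fun _ hv => h.fderiv_mem hp hv) fun _ hv => h.fderiv_symm_mem hp hv

lemma bijOn_fderiv_symm (h : IsDiffeoPair φ ψ M M') {p : E} (hp : p ∈ M) :
    BijOn (fun v => fderiv ℝ ψ (φ p) v) (tangentAt M' (φ p)) (tangentAt M p) := by
  have := h.symm.bijOn_fderiv (h.mapsTo hp)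
  rwa [h.inv.1 hp] at this

lemma tendsto_symm (h : IsDiffeoPair φ ψ M M') {p : E} (hp : p ∈ M) :
    Tendsto ψ (𝓝[M'] (φ p)) (𝓝[M] p) := by
  refine tendsto_nhdsWithin_iff.2 ⟨?_, eventually_nhdsWithin_of_forall h.mapsTo_symm⟩
  have := (h.smooth_symm.contDiffAt (h.mapsTo hp)).continuousAt.tendsto
  rw [h.inv.1 hp] at this
  exact this.mono_left nhdsWithin_le_nhds

lemma fderiv_comp_symm {G : Type*} [NormedAddCommGroup G] [NormedSpace ℝ G]
    (h : IsDiffeoPair φ ψ M M') {p : E} (hp : p ∈ M) {w : E → G} (hw : DifferentiableAt ℝ w p)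
    (v : E') : fderiv ℝ (w ∘ ψ) (φ p) v = fderiv ℝ w p (fderiv ℝ ψ (φ p) v) := by
  rw [fderiv_comp_apply (by rwa [h.inv.1 hp]) (h.smooth_symm.differentiableAt (h.mapsTo hp)),
    h.inv.1 hp]

lemma smoothNear_comp_symm {G : Type*} [NormedAddCommGroup G] [NormedSpace ℝ G]
    (h : IsDiffeoPair φ ψ M M') {p : E} (hp : p ∈ M) {w : E → G} (hw : SmoothNear {p} w) :
    SmoothNear {φ p} (w ∘ ψ) := by
  refine hw.comp (h.smooth_symm.mono (singleton_subset_iff.2 (h.mapsTo hp))) ?_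
  rintro _ rfl
  exact h.inv.1 hp

/-- The homeomorphism given by a diffeomorphism. -/
def homeomorph (h : IsDiffeoPair φ ψ M M') : M ≃ₜ M' where
  toFun := h.mapsTo.restrict φ M M'
  invFun := h.mapsTo_symm.restrict ψ M' M
  left_inv x := Subtype.ext (h.inv.1 x.2)
  right_inv x := Subtype.ext (h.inv.2 x.2)
  continuous_toFun := by
    refine ContinuousOn.mapsToRestrict ?_ _
    exact fun x hx => (h.smooth.contDiffAt hx).continuousAt.continuousWithinAt
  continuous_invFun := by
    refine ContinuousOn.mapsToRestrict ?_ _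
    exact fun x hx => (h.smooth_symm.contDiffAt hx).continuousAt.continuousWithinAt

end IsDiffeoPair

/-- A codimension two submanifold of a submanifold, given by local equations. -/
lemma IsSubmanifold.of_complex_equation [FiniteDimensional ℝ F] {c : ℕ} {N B : Set F}
    (hN : IsSubmanifold c N) (hBN : B ⊆ N)
    (h : ∀ b ∈ B, ∃ w : F → ℂ, SmoothNear {b} w ∧
      SurjOn (fun v => fderiv ℝ w b v) (tangentAt N b) univ ∧
      ∀ᶠ x in 𝓝[N] b, x ∈ B ↔ w x = 0) : IsSubmanifold (c + 2) B := by
  refine isSubmanifold_of_zero_set (G := (Fin c → ℝ) × ℂ)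
    (by simp [Complex.finrank_real_complex]) fun b hb => ?_
  obtain ⟨U, hU, hbU, g, hg, hs, hNU⟩ := hN b (hBN hb)
  obtain ⟨w, ⟨V, hV, hbV, hw⟩, hws, hB⟩ := h b hb
  rw [singleton_subset_iff] at hbV
  obtain ⟨W, hWB, hW, hbW⟩ := eventually_nhds_iff.1 (eventually_nhdsWithin_iff.1 hB)
  refine ⟨U ∩ V ∩ W, (hU.inter hV).inter hW, ⟨⟨hbU, hbV⟩, hbW⟩, fun x => (g x, w x),
    (hg.mono fun x hx => hx.1.1).prodMk (hw.mono fun x hx => hx.1.2), ?_, ?_⟩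
  · have hgd : DifferentiableAt ℝ g b :=
      ((hg b hbU).contDiffAt (hU.mem_nhds hbU)).differentiableAt (by simp)
    have hwd : DifferentiableAt ℝ w b :=
      ((hw b hbV).contDiffAt (hV.mem_nhds hbV)).differentiableAt (by simp)
    have hT := tangentAt_eq_ker (hBN hb) hU hbU hg hs hNU
    rintro ⟨y, c⟩
    obtain ⟨x, rfl⟩ := hs y
    obtain ⟨v, hv, hvc⟩ := hws (mem_univ (c - fderiv ℝ w b x))
    rw [hT] at hv
    have hv0 : fderiv ℝ g b v = 0 := hv
    have hvc' : fderiv ℝ w b v = c - fderiv ℝ w b x := hvc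
    refine ⟨x + v, ?_⟩
    rw [(hgd.hasFDerivAt.prodMk hwd.hasFDerivAt).fderiv]
    simp [hv0, hvc']
  · ext x
    have h1 : x ∈ U → (x ∈ N ↔ g x = 0) := fun hx => by
      have := Set.ext_iff.1 hNU x
      simpa [hx] using this
    constructor
    · rintro ⟨hx, hxU⟩
      refine ⟨hxU, Prod.ext ((h1 hxU.1.1).1 (hBN hx)) ((hWB x hxU.2 (hBN hx)).1 hx)⟩
    · rintro ⟨hxU, hx⟩
      obtain ⟨hx1, hx2⟩ := Prod.ext_iff.1 hx
      exact ⟨(hWB x hxU.2 ((h1 hxU.1.1).2 hx1)).2 hx2, hxU⟩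

/-- `(φ, g)` is an equivalence between `f : M → N` with branching locus `B` and `f' : M' → N'` with
branching locus `B'`. -/
structure IsBranchEquiv (φ : E → E') (ψ : E' → E) (g : F → F') (g' : F' → F) (M : Set E)
    (N B : Set F) (f : E → F) (M' : Set E') (N' B' : Set F') (f' : E' → F') : Prop where
  total : IsDiffeoPair φ ψ M M'
  base : IsDiffeoPair g g' N N'
  smooth : SmoothNear M f
  smooth' : SmoothNear M' f'
  mapsTo : MapsTo f M N
  mapsTo' : MapsTo f' M' N'
  comm : ∀ p ∈ M, f' (φ p) = g (f p)
  subset : B ⊆ N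
  subset' : B' ⊆ N'
  mem_iff : ∀ x ∈ N, g x ∈ B' ↔ x ∈ B

namespace IsBranchEquiv

variable {φ : E → E'} {ψ : E' → E} {g : F → F'} {g' : F' → F} {M : Set E} {N B : Set F}
  {f : E → F} {M' : Set E'} {N' B' : Set F'} {f' : E' → F'} {k : ℕ}

lemma symm (e : IsBranchEquiv φ ψ g g' M N B f M' N' B' f') :
    IsBranchEquiv ψ φ g' g M' N' B' f' M N B f where
  total := e.total.symm
  base := e.base.symm
  smooth := e.smooth'
  smooth' := e.smooth
  mapsTo := e.mapsTo'
  mapsTo' := e.mapsTo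
  comm p hp := by
    have h1 := e.total.mapsTo_symm hp
    have h2 := e.comm _ h1
    rw [e.total.inv.2 hp] at h2
    rw [h2, e.base.inv.1 (e.mapsTo h1)]
  subset := e.subset'
  subset' := e.subset
  mem_iff x hx := by
    rw [← e.mem_iff _ (e.base.mapsTo_symm hx), e.base.inv.2 hx]

lemma fderiv_comm (e : IsBranchEquiv φ ψ g g' M N B f M' N' B' f') {p v : E} (hp : p ∈ M)
    (hv : v ∈ tangentAt M p) :
    fderiv ℝ f' (φ p) (fderiv ℝ φ p v) = fderiv ℝ g (f p) (fderiv ℝ f p v) := by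
  have h1 := e.smooth'.differentiableAt (e.total.mapsTo hp)
  have h2 := e.total.smooth.differentiableAt hp
  have h3 := e.base.smooth.differentiableAt (e.mapsTo hp)
  have h4 := e.smooth.differentiableAt hp
  rw [← fderiv_comp_apply h1 h2, ← fderiv_comp_apply h3 h4]
  exact fderiv_eq_of_eqOn (h1.comp p h2) (h3.comp p h4) e.comm hp hv

lemma fderiv_comm_symm (e : IsBranchEquiv φ ψ g g' M N B f M' N' B' f') {p : E} {v : E'}
    (hp : p ∈ M) (hv : v ∈ tangentAt M' (φ p)) :
    fderiv ℝ g' (g (f p)) (fderiv ℝ f' (φ p) v) = fderiv ℝ f p (fderiv ℝ ψ (φ p) v) := by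
  have := e.symm.fderiv_comm (e.total.mapsTo hp) hv
  rw [e.total.inv.1 hp, e.comm p hp] at this
  exact this.symm

/-- The transport of a local model. -/
lemma isBranchChart (e : IsBranchEquiv φ ψ g g' M N B f M' N' B' f') {p : E} (hp : p ∈ M) {m : ℕ}
    {ζ : E → ℂ} {w : F → ℂ} {y : F → (Fin m → ℝ)} (h : IsBranchChart k M N B f p ζ w y) :
    IsBranchChart k M' N' B' f' (φ p) (ζ ∘ ψ) (w ∘ g') (y ∘ g') := by
  have hfp := e.mapsTo hp
  have hζ := h.smooth_ζ.differentiableAt (mem_singleton p)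
  have hw := h.smooth_w.differentiableAt (mem_singleton (f p))
  have hy := h.smooth_y.differentiableAt (mem_singleton (f p))
  refine ⟨e.total.smoothNear_comp_symm hp h.smooth_ζ, ?_, ?_, ?_, ?_, ?_, ?_⟩
  · rw [e.comm p hp]
    exact e.base.smoothNear_comp_symm hfp h.smooth_w
  · rw [e.comm p hp]
    exact e.base.smoothNear_comp_symm hfp h.smooth_y
  · refine (h.chart_total.comp (e.total.bijOn_fderiv_symm hp)).congr fun v hv => ?_
    simp only [Function.comp_apply]
    rw [e.total.fderiv_comp_symm hp hζ, e.comm p hp, e.base.fderiv_comp_symm hfp hy,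
      e.fderiv_comm_symm hp hv]
  · rw [e.comm p hp]
    refine (h.chart_base.comp (e.base.bijOn_fderiv_symm hfp)).congr fun v hv => ?_
    simp only [Function.comp_apply]
    rw [e.base.fderiv_comp_symm hfp hw, e.base.fderiv_comp_symm hfp hy]
  · rw [e.comm p hp]
    filter_upwards [(e.base.tendsto_symm hfp).eventually h.branch, self_mem_nhdsWithin]
      with x h1 h2
    rw [Function.comp_apply, ← h1, e.symm.mem_iff x h2]
  · filter_upwards [(e.total.tendsto_symm hp).eventually h.model, self_mem_nhdsWithin]
      with x h1 h2
    rw [Function.comp_apply, Function.comp_apply, ← h1, e.symm.comm x h2]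

lemma mapsTo_branch (e : IsBranchEquiv φ ψ g g' M N B f M' N' B' f') : MapsTo g B B' :=
  fun x hx => (e.mem_iff x (e.subset hx)).2 hx

/-- The transport of a branched covering. -/
theorem isCyclicBranchedCovering [FiniteDimensional ℝ F']
    (e : IsBranchEquiv φ ψ g g' M N B f M' N' B' f')
    (h : IsCyclicBranchedCovering k M N B f) (hM' : ∃ c, IsSubmanifold c M')
    (hN' : ∃ c, IsSubmanifold c N') : IsCyclicBranchedCovering k M' N' B' f' := by
  have hφ : ∀ p' ∈ M', ∃ p ∈ M, φ p = p' := fun p' hp' =>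
    ⟨ψ p', e.total.mapsTo_symm hp', e.total.inv.2 hp'⟩
  have hsurj : SurjOn f' M' N' := fun x hx => by
    obtain ⟨p, hp, hpx⟩ := h.surjOn (e.base.mapsTo_symm hx)
    exact ⟨φ p, e.total.mapsTo hp, by rw [e.comm p hp, hpx, e.base.inv.2 hx]⟩
  have hB : ∀ p ∈ M, f' (φ p) ∈ B' ↔ f p ∈ B := fun p hp => by
    rw [e.comm p hp, e.mem_iff _ (e.mapsTo hp)]
  have hmodel : ∀ p' ∈ M', f' p' ∈ B' → ∃ (m : ℕ) (ζ : E' → ℂ) (w : F' → ℂ)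
      (y : F' → (Fin m → ℝ)), IsBranchChart k M' N' B' f' p' ζ w y := fun p' hp' hb => by
    obtain ⟨p, hp, rfl⟩ := hφ p' hp'
    obtain ⟨m, ζ, w, y, hc⟩ := h.local_model p hp ((hB p hp).1 hb)
    exact ⟨m, _, _, _, e.isBranchChart hp hc⟩
  obtain ⟨c, hc⟩ := hN'
  refine ⟨hM', ⟨c, hc, hc.of_complex_equation e.subset' fun b hb => ?_⟩, e.subset', e.smooth',
    e.mapsTo', hsurj, ?_, fun p' hp' hb => ?_, ?_, hmodel⟩
  -- The coordinate w of a local model at a point over b is a complex equation for B' in N'.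
  -- Surjectivity of f' provides such a point.
  · obtain ⟨p, hp, rfl⟩ := hsurj (e.subset' hb)
    obtain ⟨m, ζ, w, y, hc⟩ := hmodel p hp hb
    refine ⟨w, hc.smooth_w, fun z _ => ?_, hc.branch⟩
    obtain ⟨v, hv, hvz⟩ := hc.chart_base.surjOn (mem_univ (z, 0))
    exact ⟨v, hv, (Prod.ext_iff.1 hvz).1⟩
  · have h1 := (h.covering.comp_homeomorph e.total.symm.homeomorph).homeomorph_comp
      e.base.homeomorph
    have h2 : (e.base.homeomorph ∘ h.mapsTo.restrict f M N ∘ e.total.symm.homeomorph) =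
        e.mapsTo'.restrict f' M' N' := by
      ext x
      change g (f (ψ x)) = f' x
      rw [e.symm.comm x x.2, e.base.inv.2 (e.mapsTo' x.2)]
    have h3 : (e.base.homeomorph.symm ⁻¹' {x | (x : F) ∉ B}) = {x : N' | (x : F') ∉ B'} := by
      ext x
      change g' x ∉ B ↔ (x : F') ∉ B'
      rw [e.symm.mem_iff x x.2]
    rw [h3] at h1
    rw [← h2]
    exact h1
  · obtain ⟨p, hp, rfl⟩ := hφ p' hp'
    have h1 := (e.base.bijOn_fderiv (e.mapsTo hp)).comp
      ((h.local_diffeo p hp fun hb' => hb ((hB p hp).2 hb')).comp (e.total.bijOn_fderiv_symm hp))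
    rw [e.comm p hp]
    refine h1.congr fun v hv => ?_
    simp only [Function.comp_apply]
    rw [← e.fderiv_comm hp (e.total.fderiv_symm_mem hp hv), e.total.fderiv_apply_symm hp hv]
  · obtain ⟨τ, h1, h2, h3, h4, h5⟩ := h.deck
    -- Since ψ is inverse to φ only on M, conjugation of iterates has to be checked along orbits
    -- that stay in M.
    have hit : ∀ p ∈ M, ∀ j, τ^[j] p ∈ M ∧ (φ ∘ τ ∘ ψ)^[j] (φ p) = φ (τ^[j] p) := by
      intro p hp j
      induction j with
      | zero => exact ⟨hp, rfl⟩
      | succ j ih =>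
        simp only [Function.iterate_succ_apply', ih.2, Function.comp_apply, e.total.inv.1 ih.1]
        exact ⟨h1.2.1 ih.1, trivial⟩
    refine ⟨φ ∘ τ ∘ ψ, (e.total.symm.isDiffeo.trans h1).trans e.total.isDiffeo,
      fun p' hp' => ?_, fun p' hp' q' hq' hpq => ?_, fun p' hp' hb => ?_, fun p' hp' hb => ?_⟩
    · obtain ⟨p, hp, rfl⟩ := hφ p' hp'
      simp only [Function.comp_apply, e.total.inv.1 hp]
      rw [e.comm _ (h1.2.1 hp), h2 p hp, e.comm p hp]
    · obtain ⟨p, hp, rfl⟩ := hφ p' hp'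
      obtain ⟨q, hq, rfl⟩ := hφ q' hq'
      rw [e.comm p hp, e.comm q hq] at hpq
      obtain ⟨j, hj⟩ := h3 p hp q hq (e.base.inv.1.injOn (e.mapsTo hp) (e.mapsTo hq) hpq)
      exact ⟨j, by rw [(hit p hp j).2, hj]⟩
    · obtain ⟨p, hp, rfl⟩ := hφ p' hp'
      rw [← h4 p hp fun hb' => hb ((hB p hp).2 hb'),
        Function.minimalPeriod_eq_minimalPeriod_iff]
      intro j
      simp only [Function.IsPeriodicPt, Function.IsFixedPt]
      rw [(hit p hp j).2, e.total.inv.1.injOn.eq_iff (hit p hp j).1 hp]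
    · obtain ⟨p, hp, rfl⟩ := hφ p' hp'
      simp only [Function.comp_apply, e.total.inv.1 hp, h5 p hp ((hB p hp).1 hb)]

end IsBranchEquiv

end Transfer

section ContactTransfer

variable {E F E' F' : Type*} [NormedAddCommGroup E] [NormedSpace ℝ E]
  [NormedAddCommGroup F] [NormedSpace ℝ F] [NormedAddCommGroup E'] [NormedSpace ℝ E']
  [NormedAddCommGroup F'] [NormedSpace ℝ F']

/-! ### Transport of contact branched coverings -/

/-- An equivalence of branched coverings which is a contactomorphism, with conformal factor `h`, on
the base. -/
structure IsContactBranchEquiv (φ : E → E') (ψ : E' → E) (g : F → F') (g' : F' → F) (M : Set E)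
    (N B : Set F) (f : E → F) (α : OneForm F) (M' : Set E') (N' B' : Set F') (f' : E' → F')
    (α' : OneForm F') (h : F → ℝ) : Prop
    extends IsBranchEquiv φ ψ g g' M N B f M' N' B' f' where
  contact : IsContactForm N α
  contact' : IsContactForm N' α'
  smooth_factor : SmoothNear N h
  factor_pos : ∀ x ∈ N, 0 < h x
  pullback_eq : ∀ x ∈ N, ∀ v ∈ tangentAt N x, α' (g x) (fderiv ℝ g x v) = h x * α x v

lemma SmoothNear.inv {M : Set E} {h : E → ℝ} (hh : SmoothNear M h) (h0 : ∀ x ∈ M, h x ≠ 0) :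
    SmoothNear M fun x => (h x)⁻¹ := by
  rw [smoothNear_iff] at *
  intro p hp
  filter_upwards [hh p hp, (hh p hp).self_of_nhds.continuousAt.eventually_ne (h0 p hp)]
    with x h1 h2
  exact h1.inv h2

namespace IsContactBranchEquiv

variable {φ : E → E'} {ψ : E' → E} {g : F → F'} {g' : F' → F} {M : Set E} {N B : Set F}
  {f : E → F} {α : OneForm F} {M' : Set E'} {N' B' : Set F'} {f' : E' → F'} {α' : OneForm F'}
  {h : F → ℝ} {k : ℕ}

lemma symm (e : IsContactBranchEquiv φ ψ g g' M N B f α M' N' B' f' α' h) :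
    IsContactBranchEquiv ψ φ g' g M' N' B' f' α' M N B f α fun x => (h (g' x))⁻¹ where
  toIsBranchEquiv := e.toIsBranchEquiv.symm
  contact := e.contact'
  contact' := e.contact
  smooth_factor := SmoothNear.inv (e.smooth_factor.comp e.base.smooth_symm e.base.mapsTo_symm)
    fun x hx => (e.factor_pos _ (e.base.mapsTo_symm hx)).ne'
  factor_pos x hx := inv_pos.2 (e.factor_pos _ (e.base.mapsTo_symm hx))
  pullback_eq x hx v hv := by
    have h1 := e.pullback_eq _ (e.base.mapsTo_symm hx) _ (e.base.symm.fderiv_mem hx hv)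
    rw [e.base.symm.fderiv_symm_apply hx hv, e.base.inv.2 hx] at h1
    have h2 := (e.factor_pos _ (e.base.mapsTo_symm hx)).ne'
    rw [h1]
    field_simp

/-- The terms with the derivative of the conformal factor vanish on the contact hyperplane. -/
lemma dForm_fderiv (e : IsContactBranchEquiv φ ψ g g' M N B f α M' N' B' f' α' h) {x : F}
    (hx : x ∈ N) (hr : ∃ r, IsLocalRetraction N x r) {u v : F} (hu : u ∈ tangentAt N x)
    (hv : v ∈ tangentAt N x) (hu0 : α x u = 0) (hv0 : α x v = 0) :
    dForm α' (g x) (fderiv ℝ g x u) (fderiv ℝ g x v) = h x * dForm α x u v := by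
  obtain ⟨r, hr⟩ := hr
  obtain ⟨⟨t, ht, hαt⟩, -⟩ := e.contact.2 x hx
  rw [← dForm_pullback (e.base.smooth.contDiffAt hx)
    (e.contact'.1.differentiableAt (e.base.mapsTo hx))]
  exact hr.dForm_of_proportional hx (e.contact.1.differentiableAt hx)
    ((e.base.smooth.pullback e.base.mapsTo e.contact'.1).differentiableAt hx)
    (eventually_nhdsWithin_of_forall e.pullback_eq) ht hαt hu hv hu0 hv0

/-- On contact hyperplanes the exterior derivative is only multiplied by a positive factor, so
orthogonal complements and their orientations correspond. -/
lemma isPositiveNormal (e : IsContactBranchEquiv φ ψ g g' M N B f α M' N' B' f' α' h) {b : F}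
    (hb : b ∈ B) (hr : ∃ r, IsLocalRetraction N b r) {w : F → ℂ} (hw : DifferentiableAt ℝ w b)
    (hpos : IsPositiveNormal N B α b w) : IsPositiveNormal N' B' α' (g b) (w ∘ g') := by
  have hbN := e.subset hb
  have hh := e.factor_pos b hbN
  intro u' hu' v' hv' hαu hαv horth hwu hwv
  rw [e.base.fderiv_comp_symm hbN hw] at hwu hwv
  have hu := e.base.fderiv_symm_mem hbN hu'
  have hv := e.base.fderiv_symm_mem hbN hv'
  have hu1 := e.base.fderiv_apply_symm hbN hu'
  have hv1 := e.base.fderiv_apply_symm hbN hv'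
  generalize fderiv ℝ g' (g b) u' = u at *
  generalize fderiv ℝ g' (g b) v' = v at *
  subst hu1 hv1
  rw [e.pullback_eq b hbN u hu] at hαu
  rw [e.pullback_eq b hbN v hv] at hαv
  have hαu' := (mul_eq_zero.1 hαu).resolve_left hh.ne'
  have hαv' := (mul_eq_zero.1 hαv).resolve_left hh.ne'
  rw [e.dForm_fderiv hbN hr hu hv hαu' hαv']
  refine mul_pos hh (hpos u hu v hv hαu' hαv' (fun x hx hαx => ?_) hwu hwv)
  have hxN := tangentAt_mono e.subset b hx
  obtain ⟨h1, h2⟩ := horth _ (fderiv_mem_tangentAt (e.base.smooth.contDiffAt hbN)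
    e.mapsTo_branch hx) (by rw [e.pullback_eq b hbN x hxN, hαx, mul_zero])
  rw [e.dForm_fderiv hbN hr hu hxN hαu' hαx] at h1
  rw [e.dForm_fderiv hbN hr hv hxN hαv' hαx] at h2
  exact ⟨(mul_eq_zero.1 h1).resolve_left hh.ne', (mul_eq_zero.1 h2).resolve_left hh.ne'⟩

lemma isPositiveKerBasis (e : IsContactBranchEquiv φ ψ g g' M N B f α M' N' B' f' α' h)
    {p v₁ v₂ : E} (hp : p ∈ M) (hb : f p ∈ B) (hr : ∃ r, IsLocalRetraction N (f p) r)
    (hv : IsPositiveKerBasis k M N B f α p v₁ v₂) :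
    IsPositiveKerBasis k M' N' B' f' α' (φ p) (fderiv ℝ φ p v₁) (fderiv ℝ φ p v₂) := by
  obtain ⟨h1, h2, h3, h4, m, ζ, w, y, hc, hn, him⟩ := hv
  have hζ := hc.smooth_ζ.differentiableAt (mem_singleton p)
  refine ⟨e.total.fderiv_mem hp h1, e.total.fderiv_mem hp h2,
    by rw [e.fderiv_comm hp h1, h3, map_zero], by rw [e.fderiv_comm hp h2, h4, map_zero],
    m, _, _, _, e.isBranchChart hp hc, ?_, ?_⟩
  · rw [e.comm p hp]
    exact e.isPositiveNormal hb hr (hc.smooth_w.differentiableAt (mem_singleton (f p))) hn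
  · rw [e.total.fderiv_comp_symm hp hζ, e.total.fderiv_comp_symm hp hζ,
      e.total.fderiv_symm_apply hp h1, e.total.fderiv_symm_apply hp h2]
    exact him

/-- The transport of a form that is positive on `ker df`. -/
lemma isPositivePerturbation (e : IsContactBranchEquiv φ ψ g g' M N B f α M' N' B' f' α' h)
    (hr : ∀ x ∈ N, ∃ r, IsLocalRetraction N x r) {γ' : OneForm E'}
    (hγ : IsPositivePerturbation k M' N' B' f' α' γ') :
    IsPositivePerturbation k M N B f α fun x => (h (f x))⁻¹ • pullback φ γ' x := by
  have hu : SmoothNear N fun x => (h x)⁻¹ :=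
    e.smooth_factor.inv fun x hx => (e.factor_pos x hx).ne'
  have huf : SmoothNear M fun x => (h (f x))⁻¹ := hu.comp e.smooth e.mapsTo
  have hpb := e.total.smooth.pullback e.total.mapsTo hγ.1
  refine ⟨huf.smul hpb, fun p hp hb v₁ v₂ hv => ?_⟩
  -- The factor (h ∘ f)⁻¹ makes the perturbed pull-backs on both sides proportional. Its derivative
  -- vanishes on ker df, so positivity of the exterior derivative there is not affected.
  have hdu : ∀ v, fderiv ℝ f p v = 0 → fderiv ℝ (fun x => (h (f x))⁻¹) p v = 0 := fun v hv => by
    have := fderiv_comp_apply (hu.differentiableAt (e.mapsTo hp)) (e.smooth.differentiableAt hp) v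
    rw [hv, map_zero] at this
    exact this
  rw [dForm_smul (huf.differentiableAt hp) (hpb.differentiableAt hp), hdu _ hv.2.2.1,
    hdu _ hv.2.2.2.1, dForm_pullback (e.total.smooth.contDiffAt hp)
      (hγ.1.differentiableAt (e.total.mapsTo hp))]
  have h1 := hγ.2 (φ p) (e.total.mapsTo hp)
    (by rw [e.comm p hp]; exact (e.mem_iff _ (e.mapsTo hp)).2 hb) _ _
    (e.isPositiveKerBasis hp hb (hr _ (e.mapsTo hp)) hv)
  have h2 := mul_pos (inv_pos.2 (e.factor_pos _ (e.mapsTo hp))) h1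
  linarith

/-- The transport of the perturbed pull-backs. -/
lemma isContactomorphism_add_smul
    (e : IsContactBranchEquiv φ ψ g g' M N B f α M' N' B' f' α' h) (γ' : OneForm E') (ε : ℝ) :
    IsContactomorphism φ M (fun x => pullback f α x + ε • (h (f x))⁻¹ • pullback φ γ' x) M'
      (fun x => pullback f' α' x + ε • γ' x) := by
  refine ⟨e.total.isDiffeo, fun p hp => ⟨h (f p), e.factor_pos _ (e.mapsTo hp), fun v hv => ?_⟩⟩
  have h1 := e.pullback_eq _ (e.mapsTo hp) _
    (fderiv_mem_tangentAt (e.smooth.contDiffAt hp) e.mapsTo hv)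
  have h2 := (e.factor_pos _ (e.mapsTo hp)).ne'
  simp only [pullback_apply, add_apply, smul_apply, smul_eq_mul]
  rw [e.fderiv_comm hp hv, e.comm p hp, h1]
  field_simp

/-- The transport of a contact branched covering. -/
theorem isContactBranchedCovering [FiniteDimensional ℝ E] [FiniteDimensional ℝ F]
    [FiniteDimensional ℝ F'] (e : IsContactBranchEquiv φ ψ g g' M N B f α M' N' B' f' α' h)
    {η : OneForm E} {η' : OneForm E'} (hc : IsContactBranchedCovering k M N B f α η)
    (hM' : ∃ c, IsSubmanifold c M') (hN' : ∃ c, IsSubmanifold c N')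
    (hη' : SmoothNear M' η') (hφ : IsContactomorphism φ M η M' η') :
    IsContactBranchedCovering k M' N' B' f' α' η' := by
  obtain ⟨cM, hcM⟩ := hc.branched.total_submanifold
  obtain ⟨cN, hcN, hcB⟩ := hc.branched.base_submanifold
  obtain ⟨cN', hcN'⟩ := hN'
  have hretM : ∀ p ∈ M, ∃ r, IsLocalRetraction M p r := fun p hp => hcM.exists_localRetraction hp
  have hretN : ∀ p ∈ N, ∃ r, IsLocalRetraction N p r := fun p hp => hcN.exists_localRetraction hp
  refine ⟨e.isCyclicBranchedCovering hc.branched hM' ⟨cN', hcN'⟩, e.contact', ?_,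
    hc.contact_total.of_contactomorphism hretM hφ hη', ?_, fun γ' hγ' => ?_⟩
  · refine hc.contact_branch.of_contactomorphism (φ := g)
      (fun p hp => hcB.exists_localRetraction hp) ⟨⟨e.base.smooth.mono e.subset, e.mapsTo_branch,
      g', e.base.smooth_symm.mono e.subset', e.symm.mapsTo_branch, e.base.inv.mono e.subset
        e.subset'⟩, fun p hp => ⟨h p, e.factor_pos p (e.subset hp), fun v hv =>
          e.pullback_eq p (e.subset hp) v (tangentAt_mono e.subset p hv)⟩⟩
      (e.contact'.1.mono e.subset')
  · obtain ⟨γ, hγ⟩ := hc.exists_perturbation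
    exact ⟨_, e.symm.isPositivePerturbation (fun x hx => hcN'.exists_localRetraction hx) hγ⟩
  · obtain ⟨ε₀, hε₀, h1⟩ := hc.isotopic _ (e.isPositivePerturbation hretN hγ')
    refine ⟨ε₀, hε₀, fun ε hε hlt => ?_⟩
    obtain ⟨h2, h3⟩ := h1 ε hε hlt
    have h4 := e.isContactomorphism_add_smul γ' ε
    exact ⟨h2.of_contactomorphism hretM h4
      ((e.smooth'.pullback e.mapsTo' e.contact'.1).add (hγ'.1.const_smul ε)),
      h3.conj e.total.smooth_symm e.total.mapsTo_symm e.total.inv h4 hφ⟩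

end IsContactBranchEquiv

end ContactTransfer

section Rescaling

variable {m : ℕ}

/-! ### The weighted contact structure of the sphere -/

/-- The real diagonal matrix with entries `c`. -/
def diagonal (c : Fin m → ℝ) : (Fin m → ℂ) →L[ℝ] (Fin m → ℂ) :=
  ContinuousLinearMap.pi fun j => c j • (ContinuousLinearMap.proj j : (Fin m → ℂ) →L[ℝ] ℂ)

@[simp] lemma diagonal_apply (c : Fin m → ℝ) (z : Fin m → ℂ) (j : Fin m) :
    diagonal c z j = c j • z j := rfl

/-- The inverse of the norm of `diagonal c z`. -/
def rescaleFactor (c : Fin m → ℝ) (z : Fin m → ℂ) : ℝ := (√(∑ j, c j ^ 2 * ‖z j‖ ^ 2))⁻¹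

/-- The self-map of the sphere that is induced by a diagonal matrix. -/
def rescale (c : Fin m → ℝ) (z : Fin m → ℂ) : Fin m → ℂ := rescaleFactor c z • diagonal c z

lemma sum_sq_pos {c : Fin m → ℝ} (hc : ∀ j, 0 < c j) {z : Fin m → ℂ} (hz : z ∈ unitSphere m) :
    0 < ∑ j, c j ^ 2 * ‖z j‖ ^ 2 := by
  have h1 : ∑ j, ‖z j‖ ^ 2 ≠ 0 := by
    rw [show ∑ j, ‖z j‖ ^ 2 = 1 from hz]
    exact one_ne_zero
  obtain ⟨j, hj, hj0⟩ := Finset.exists_ne_zero_of_sum_ne_zero h1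
  refine Finset.sum_pos' (fun i _ => by positivity) ⟨j, hj, ?_⟩
  have := hc j
  positivity

lemma rescaleFactor_pos {c : Fin m → ℝ} (hc : ∀ j, 0 < c j) {z : Fin m → ℂ}
    (hz : z ∈ unitSphere m) : 0 < rescaleFactor c z :=
  inv_pos.2 (Real.sqrt_pos.2 (sum_sq_pos hc hz))

lemma smoothNear_rescaleFactor {c : Fin m → ℝ} (hc : ∀ j, 0 < c j) :
    SmoothNear (unitSphere m) (rescaleFactor c) := by
  rw [smoothNear_iff]
  intro z hz
  have hs := contDiff_sum_norm_sq fun j => c j ^ 2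
  filter_upwards [hs.continuous.continuousAt.eventually_ne (sum_sq_pos hc hz).ne'] with x hx
  refine (hs.contDiffAt.sqrt hx).inv (Real.sqrt_ne_zero'.2 ?_)
  exact lt_of_le_of_ne (Finset.sum_nonneg fun j _ => by positivity) (Ne.symm hx)

lemma smoothNear_rescale {c : Fin m → ℝ} (hc : ∀ j, 0 < c j) :
    SmoothNear (unitSphere m) (rescale c) :=
  (smoothNear_rescaleFactor hc).smul (smoothNear_of_contDiff (diagonal c).contDiff _)

lemma sum_norm_sq_smul_diagonal (c : Fin m → ℝ) (z : Fin m → ℂ) (t : ℝ) :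
    ∑ j, ‖(t • diagonal c z) j‖ ^ 2 = t ^ 2 * ∑ j, c j ^ 2 * ‖z j‖ ^ 2 := by
  rw [Finset.mul_sum]
  refine Finset.sum_congr rfl fun j _ => ?_
  simp only [Pi.smul_apply, diagonal_apply, norm_smul, Real.norm_eq_abs, mul_pow, sq_abs]

lemma rescaleFactor_sq {c : Fin m → ℝ} (hc : ∀ j, 0 < c j) {z : Fin m → ℂ}
    (hz : z ∈ unitSphere m) : rescaleFactor c z ^ 2 * ∑ j, c j ^ 2 * ‖z j‖ ^ 2 = 1 := by
  have := sum_sq_pos hc hz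
  rw [rescaleFactor, inv_pow, Real.sq_sqrt this.le, inv_mul_cancel₀ this.ne']

lemma mapsTo_rescale {c : Fin m → ℝ} (hc : ∀ j, 0 < c j) :
    MapsTo (rescale c) (unitSphere m) (unitSphere m) := fun z hz => by
  change ∑ j, ‖(rescaleFactor c z • diagonal c z) j‖ ^ 2 = 1
  rw [sum_norm_sq_smul_diagonal, rescaleFactor_sq hc hz]

lemma leftInvOn_rescale {c d : Fin m → ℝ} (hc : ∀ j, 0 < c j) (hcd : ∀ j, d j * c j = 1) :
    LeftInvOn (rescale d) (rescale c) (unitSphere m) := fun z hz => by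
  have ht := rescaleFactor_pos hc hz
  have h1 : rescaleFactor d (rescale c z) = (rescaleFactor c z)⁻¹ := by
    rw [rescaleFactor]
    congr 1
    have : ∑ j, d j ^ 2 * ‖rescale c z j‖ ^ 2 = rescaleFactor c z ^ 2 * ∑ j, ‖z j‖ ^ 2 := by
      rw [Finset.mul_sum]
      refine Finset.sum_congr rfl fun j _ => ?_
      simp only [rescale, Pi.smul_apply, diagonal_apply, norm_smul, Real.norm_eq_abs, mul_pow,
        sq_abs]
      calc _ = (d j * c j) ^ 2 * (rescaleFactor c z ^ 2 * ‖z j‖ ^ 2) := by ring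
        _ = _ := by rw [hcd, one_pow, one_mul]
    rw [this, show ∑ j, ‖z j‖ ^ 2 = 1 from hz, mul_one, Real.sqrt_sq ht.le]
  ext1 j
  rw [rescale, h1]
  simp only [Pi.smul_apply, diagonal_apply, rescale, smul_smul]
  rw [show (rescaleFactor c z)⁻¹ * (d j * (rescaleFactor c z * c j)) =
    (rescaleFactor c z)⁻¹ * rescaleFactor c z * (d j * c j) by ring, hcd,
    inv_mul_cancel₀ ht.ne', one_mul, one_smul]

lemma isDiffeoPair_rescale {c d : Fin m → ℝ} (hc : ∀ j, 0 < c j) (hd : ∀ j, 0 < d j)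
    (hcd : ∀ j, d j * c j = 1) :
    IsDiffeoPair (rescale c) (rescale d) (unitSphere m) (unitSphere m) :=
  ⟨smoothNear_rescale hc, smoothNear_rescale hd, mapsTo_rescale hc, mapsTo_rescale hd,
    leftInvOn_rescale hc hcd, leftInvOn_rescale hd fun j => by rw [mul_comm, hcd]⟩

/-- The derivative of the radial factor contributes a multiple of the base point, on which the form
vanishes, and c_j² = a_j produces the weights. -/
lemma stdForm_rescale {a : Fin m → ℕ} {c : Fin m → ℝ} (hc : ∀ j, 0 < c j)
    (hca : ∀ j, c j ^ 2 = a j) {z : Fin m → ℂ} (hz : z ∈ unitSphere m) (v : Fin m → ℂ) :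
    stdForm m (rescale c z) (fderiv ℝ (rescale c) z v) =
      rescaleFactor c z ^ 2 * weightedForm a z v := by
  have h1 : HasFDerivAt (rescale c) _ z :=
    ((smoothNear_rescaleFactor hc).differentiableAt hz).hasFDerivAt.smul
      (diagonal c).hasFDerivAt
  have h2 : fderiv ℝ (rescale c) z v = rescaleFactor c z • diagonal c v +
      fderiv ℝ (rescaleFactor c) z v • diagonal c z := by
    rw [h1.fderiv]
    rfl
  have h3 : imPair (fun j => ((1 : ℕ) : ℝ)) (diagonal c z) (diagonal c v) =
      imPair (fun j => (a j : ℝ)) z v := by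
    simp only [imPair]
    refine Finset.sum_congr rfl fun j _ => ?_
    rw [← hca]
    simp
    ring
  rw [h2, stdForm, weightedForm_apply, weightedForm_apply, imPair_comm, rescale, imPair_smul,
    imPair_comm, imPair_add, imPair_smul, imPair_smul, imPair_self, h3]
  ring

end Rescaling

section BrieskornCover

variable {n : ℕ} {a : Fin (n + 1) → ℕ}

/-! ### Brieskorn manifolds as contact branched covers of the standard sphere -/

/-- The covering `proj₀` of the cylinder section is transported by `straighten a 1` upstairs and by
the normalized diagonal map with entries √a_j downstairs. Upstairs, `pathForm a 1` corresponds
exactly to the Brieskorn form. -/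
theorem exists_isContactBranchedCovering_brieskorn (ha : ∀ j, 0 < a j) :
    ∃ (g : (Fin n → ℂ) → (Fin n → ℂ)) (F : (Fin (n + 1) → ℂ) → (Fin n → ℂ)),
      IsContactomorphism g (unitSphere n) (weightedForm fun j : Fin n => a j.succ)
        (unitSphere n) (stdForm n) ∧
      IsContactBranchedCovering (a 0) (brieskorn a) (unitSphere n)
        (g '' brieskorn fun j : Fin n => a j.succ) F (stdForm n) (weightedForm a) := by
  let c : Fin n → ℝ := fun j => √(a j.succ)
  have hpos : ∀ j : Fin n, (0 : ℝ) < a j.succ := fun j => Nat.cast_pos.2 (ha j.succ)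
  have hc : ∀ j, 0 < c j := fun j => Real.sqrt_pos.2 (hpos j)
  have hca : ∀ j, c j ^ 2 = (a j.succ : ℕ) := fun j => Real.sq_sqrt (hpos j).le
  have hbase : IsDiffeoPair (rescale c) (rescale fun j => (c j)⁻¹) (unitSphere n) (unitSphere n) :=
    isDiffeoPair_rescale hc (fun j => inv_pos.2 (hc j)) fun j => inv_mul_cancel₀ (hc j).ne'
  obtain ⟨hs1, hs0, hinv⟩ := isDiffeo_straighten ha
  have hcover := isContactBranchedCovering_proj₀ ha
  have hBN := brieskorn_subset_unitSphere fun j : Fin n => a j.succ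
  have hstd : IsContactForm (unitSphere n) (stdForm n) :=
    isContactForm_unitSphere fun _ => one_pos
  have hs0N : MapsTo (proj₀ ∘ straighten a 0) (brieskorn a) (unitSphere n) :=
    (mapsTo_proj₀ a).comp hs0.2.1
  have e : IsContactBranchEquiv (straighten a 1) (straighten a 0) (rescale c)
      (rescale fun j => (c j)⁻¹) (cylinderBrieskorn a) (unitSphere n)
      (brieskorn fun j : Fin n => a j.succ) proj₀ (weightedForm fun j : Fin n => a j.succ)
      (brieskorn a) (unitSphere n) (rescale c '' brieskorn fun j : Fin n => a j.succ)
      (rescale c ∘ proj₀ ∘ straighten a 0) (stdForm n) (fun z => rescaleFactor c z ^ 2) :=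
    { total := ⟨hs1.1, hs0.1, hs1.2.1, hs0.2.1, hinv⟩
      base := hbase
      smooth := smoothNear_of_contDiff contDiff_proj₀ _
      smooth' := hbase.smooth.comp
        ((smoothNear_of_contDiff contDiff_proj₀ (cylinderBrieskorn a)).comp hs0.1 hs0.2.1) hs0N
      mapsTo := mapsTo_proj₀ a
      mapsTo' := hbase.mapsTo.comp hs0N
      comm := fun p hp => by simp only [Function.comp_apply, hinv.1 hp]
      subset := hBN
      subset' := (hbase.mapsTo.mono_left hBN).image_subset
      mem_iff := fun x hx => hbase.inv.1.injOn.mem_image_iff hBN hx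
      contact := hcover.contact_base
      contact' := hstd
      smooth_factor := (smoothNear_of_contDiff (contDiff_id.pow 2) univ).comp
        (smoothNear_rescaleFactor hc) (mapsTo_univ _ _)
      factor_pos := fun z hz => pow_pos (rescaleFactor_pos hc hz) 2
      pullback_eq := fun z hz v _ => stdForm_rescale hc hca hz v }
  refine ⟨rescale c, rescale c ∘ proj₀ ∘ straighten a 0, ⟨hbase.isDiffeo, fun z hz =>
    ⟨_, e.factor_pos z hz, e.pullback_eq z hz⟩⟩, ?_⟩
  exact e.isContactBranchedCovering hcover ⟨3, isSubmanifold_brieskorn ha⟩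
    ⟨1, isSubmanifold_unitSphere n⟩ (smoothNear_of_contDiff (contDiff_weightedForm a) _)
    (isContactomorphism_straighten ha)

end BrieskornCover

end ContactBranched

end

open ContactBranched in
theorem mainTheorem1 (n : ℕ) (hn : 0 < n) (a : Fin (n + 1) → ℕ) (ha : ∀ j, 0 < a j) :
    (∃ η : OneForm (Fin (n + 1) → ℂ),
      IsContactBranchedCovering (a 0) (cylinderBrieskorn a) (unitSphere n)
        (brieskorn fun j : Fin n => a j.succ) proj₀ (weightedForm fun j : Fin n => a j.succ) η) ∧
    (∀ η : OneForm (Fin (n + 1) → ℂ),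
      IsContactBranchedCovering (a 0) (cylinderBrieskorn a) (unitSphere n)
        (brieskorn fun j : Fin n => a j.succ) proj₀ (weightedForm fun j : Fin n => a j.succ) η →
      AreContactomorphic (cylinderBrieskorn a) η (brieskorn a) (weightedForm a)) ∧
    (∃ (g : (Fin n → ℂ) → (Fin n → ℂ)) (F : (Fin (n + 1) → ℂ) → (Fin n → ℂ)),
      IsContactomorphism g (unitSphere n) (weightedForm fun j : Fin n => a j.succ)
        (unitSphere n) (stdForm n) ∧
      IsContactBranchedCovering (a 0) (brieskorn a) (unitSphere n)
        (g '' brieskorn fun j : Fin n => a j.succ) F (stdForm n) (weightedForm a)) := by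
  exact ⟨⟨_, isContactBranchedCovering_proj₀ ha⟩, fun _ h => areContactomorphic_brieskorn ha h,
    exists_isContactBranchedCovering_brieskorn ha⟩
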